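/- Let $M>0$, $\Lambda<0$, $f(r)=1-\frac{2M}{r}-\frac{\Lambda r^2}{3}$, let $r_h$ be the unique positive zero of $f$, and let $r=r(x)$, $x\in(-\infty,0)$, be the inverse of $x(r)=-\int_r^\infty \frac{dr'}{f(r')}$ on $(r_h,\infty)$. For an integer $\ell\ge 2$ put $\mu=(\ell-1)(\ell+2)$, $w_\ell=\frac{1}{12M}\frac{(\ell+2)!}{(\ell-2)!}$, $$V^-_\ell=f\Big(\frac{\ell(\ell+1)}{r^2}-\frac{6M}{r^3}\Big),\qquad V^+_\ell=f\,\frac{[\mu^2\ell(\ell+1)-24M^2\Lambda]r^3+6\mu^2Mr^2+36\mu M^2r+72M^3}{r^3(6M+\mu r)^2},$$ $$W_\ell=w_\ell+\frac{6Mf}{r(\mu r+6M)},\qquad \chi^+_\ell=\frac{r\,e^{w_\ell x}}{\mu r+6M},\qquad \gamma_{Ch}=w_\ell-\frac{2M\Lambda}{\mu},$$ all regarded as functions of $x$. Let $\mathcal H^\pm_\ell=-\partial_x^2+V^\pm_\ell$ and $\mathcal D^\pm_\ell=\pm\partial_x+W_\ell$. For $\gamma\in\mathbb R\cup\{\infty\}$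 let ${}^{\gamma}\mathcal H^\pm_\ell$ be the self-adjoint operator in $L^2((-\infty,0),dx)$ given by $\mathcal H^\pm_\ell$ and the boundary condition $\psi'(0)=\gamma\psi(0)$ (for $\gamma=\infty$, written $D$: $\psi(0)=0$); its operator domain $\mathrm{dom}({}^{\gamma}\mathcal H^\pm_\ell)$ consists of the $\psi\in L^2$ with $\psi,\psi'$ locally absolutely continuous on $(-\infty,0]$, $\mathcal H_\ell^\pm\psi\in L^2$, satisfying the boundary condition, and its smooth domain is $\mathrm{dom}^\infty({}^{\gamma}\mathcal H^\pm_\ell)=\bigcap_{n}\mathrm{dom}\big(({}^{\gamma}\mathcal H^\pm_\ell)^n\big)$. The operators $\mathcal D^\pm_\ell$ act on the locally absolutely continuous $\psi\in L^2$ with $\mathcal D^\pm_\ell\psi\in L^2$, and these contain all the operator domains below. Then $\mathcal H^\pm_\ell=\mathcal D^\pm_\ell\mathcal D^\mp_\ell-w_\ell^2$ on $C^2$ functions on $(-\infty,0)$, and the following hold. (i) The spectra of ${}^{D}\mathcal H^+_\ell$ and ${}^{-\gamma_{Ch}}\mathcal H^-_\ell$ are nonnegative. $\mathcal D^-_\ell$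 is a bijection from $\mathrm{dom}^\infty({}^{D}\mathcal H^+_\ell)$ onto $\mathrm{dom}^\infty({}^{-\gamma_{Ch}}\mathcal H^-_\ell)$. Moreover $\mathcal D^-_\ell$ is injective on $\mathrm{dom}({}^{D}\mathcal H^+_\ell)$ and the image of this space contains $\mathrm{dom}({}^{-\gamma_{Ch}}\mathcal H^-_\ell)$. (ii) The spectrum of ${}^{D}\mathcal H^-_\ell$ is nonnegative, while that of ${}^{\gamma_{Ch}}\mathcal H^+_\ell$ contains the negative eigenvalue $-w_\ell^2$ with eigenfunction $\chi^+_\ell$. $\mathcal D^-_\ell$ maps $\mathrm{dom}^\infty({}^{\gamma_{Ch}}\mathcal H^+_\ell)$ onto $\mathrm{dom}^\infty({}^{D}\mathcal H^-_\ell)$, with kernel the linear span of $\chi^+_\ell$; on $\mathrm{dom}({}^{\gamma_{Ch}}\mathcal H^+_\ell)$ its kernel is also the span of $\chi^+_\ell$, and the image of this space contains $\mathrm{dom}({}^{D}\mathcal H^-_\ell)$. $\mathcal D^+_\ell$ maps $\mathrm{dom}^\infty({}^{D}\mathcal H^-_\ell)$ injectively into $\mathrm{dom}^\infty({}^{\gamma_{Ch}}\mathcal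 H^+_\ell)$, and it is injective on $\mathrm{dom}({}^{D}\mathcal H^-_\ell)$. (iii) No other pair of boundary conditions is compatible with $\mathcal D^\mp_\ell$, even if only the smooth domain has to be mapped into the operator domain: for $\gamma,\gamma'\in\mathbb R\cup\{\infty\}$, $\mathcal D^-_\ell\big(\mathrm{dom}^\infty({}^{\gamma}\mathcal H^+_\ell)\big)\subset\mathrm{dom}({}^{\gamma'}\mathcal H^-_\ell)$ if and only if $(\gamma,\gamma')=(\infty,-\gamma_{Ch})$ or $(\gamma,\gamma')=(\gamma_{Ch},\infty)$; and $\mathcal D^+_\ell\big(\mathrm{dom}^\infty({}^{\gamma}\mathcal H^-_\ell)\big)\subset\mathrm{dom}({}^{\gamma'}\mathcal H^+_\ell)$ if and only if $(\gamma,\gamma')=(-\gamma_{Ch},\infty)$ or $(\gamma,\gamma')=(\infty,\gamma_{Ch})$. -/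

import Mathlib

open MeasureTheory Set
open scoped OnePoint

noncomputable section

namespace SAdS

/-! ### Partially defined operators on a complex normed space -/

section Abstract

variable {E : Type*} [NormedAddCommGroup E] [NormedSpace ℂ E]

/-- The resolvent set of a partially defined operator `A`: the `z` for which `A - z` is a bijection
from `dom A` onto the whole space with a bounded inverse `R`. -/
def resolventSet (A : E →ₗ.[ℂ] E) : Set ℂ :=
  {z | ∃ R : E →L[ℂ] E,
    (∀ v : E, ∃ h : R v ∈ A.domain, A ⟨R v, h⟩ - z • R v = v) ∧
    (∀ u : A.domain, R (A u - z • (u : E)) = u)}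

/-- The spectrum of a partially defined operator. -/
def spectrum (A : E →ₗ.[ℂ] E) : Set ℂ := (resolventSet A)ᶜ

/-- The spectrum is contained in `[0, ∞)`. -/
def HasNonnegSpectrum (A : E →ₗ.[ℂ] E) : Prop :=
  ∀ z ∈ spectrum A, 0 ≤ z.re ∧ z.im = 0

/-- The domain of the power `A ^ n`. -/
def powDomain (A : E →ₗ.[ℂ] E) : ℕ → Set E
  | 0 => univ
  | n + 1 => {u | ∃ h : u ∈ A.domain, A ⟨u, h⟩ ∈ powDomain A n}

/-- The smooth vectors of `A`: the intersection of the domains of all the powers of `A`. -/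
def smoothDomain (A : E →ₗ.[ℂ] E) : Set E := ⋂ n, powDomain A n

/-- `T` is defined on all of `S` and maps it into `S'`. -/
def MapsTo (T : E →ₗ.[ℂ] E) (S S' : Set E) : Prop :=
  ∀ u ∈ S, ∃ h : u ∈ T.domain, T ⟨u, h⟩ ∈ S'

/-- `T` is injective on the part of `S` where it is defined. -/
def InjOn (T : E →ₗ.[ℂ] E) (S : Set E) : Prop :=
  ∀ u v : T.domain, (u : E) ∈ S → (v : E) ∈ S → T u = T v → u = v

/-- The image of `S` under `T` contains `S'`. -/
def SurjOn (T : E →ₗ.[ℂ] E) (S S' : Set E) : Prop :=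
  ∀ v ∈ S', ∃ u : T.domain, (u : E) ∈ S ∧ T u = v

/-- The kernel of `T` restricted to `S`. -/
def kerOn (T : E →ₗ.[ℂ] E) (S : Set E) : Set E :=
  {u | u ∈ S ∧ ∃ h : u ∈ T.domain, T ⟨u, h⟩ = 0}

end Abstract

/-! ### Differential operators on the half line `(-∞, 0)` -/

/-- Lebesgue measure on `(-∞, 0)`. -/
abbrev halfVol : Measure ℝ := volume.restrict (Iio (0 : ℝ))

/-- The Hilbert space `L²((-∞, 0), dx)`. -/
abbrev L2 : Type := Lp ℂ 2 halfVol

/-- `g` is locally absolutely continuous on `(-∞, 0]` with almost everywhere derivative `h`. -/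
def IsPrimitive (g h : ℝ → ℂ) : Prop :=
  ∀ x ≤ (0 : ℝ), IntervalIntegrable h volume x 0 ∧ g x = g 0 - ∫ t in x..0, h t

/-- The boundary condition with parameter `γ ∈ ℝ ∪ {∞}` on the boundary value `a = ψ(0)` and the
boundary derivative `b = ψ'(0)`: Dirichlet `ψ(0) = 0` for `γ = ∞`, and `ψ'(0) = γ ψ(0)` for a real
`γ` (Neumann for `γ = 0`). -/
def BoundaryCondition : OnePoint ℝ → ℂ → ℂ → Prop
  | ∞, a, _ => a = 0
  | (γ : ℝ), a, b => b = (γ : ℂ) * a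

lemma BoundaryCondition.zero (γ : OnePoint ℝ) : BoundaryCondition γ 0 0 := by
  rcases γ with _ | γ
  · rfl
  · change (0 : ℂ) = (γ : ℂ) * 0
    simp

lemma BoundaryCondition.add {γ : OnePoint ℝ} {a b a' b' : ℂ} (h : BoundaryCondition γ a b)
    (h' : BoundaryCondition γ a' b') : BoundaryCondition γ (a + a') (b + b') := by
  rcases γ with _ | γ
  · change a = 0 at h
    change a' = 0 at h'
    change a + a' = 0
    simp [h, h']
  · change b = (γ : ℂ) * a at h
    change b' = (γ : ℂ) * a' at h'
    change b + b' = (γ : ℂ) * (a + a')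
    rw [h, h']
    ring

lemma BoundaryCondition.smul {γ : OnePoint ℝ} {a b : ℂ} (c : ℂ) (h : BoundaryCondition γ a b) :
    BoundaryCondition γ (c * a) (c * b) := by
  rcases γ with _ | γ
  · change a = 0 at h
    change c * a = 0
    simp [h]
  · change b = (γ : ℂ) * a at h
    change c * b = (γ : ℂ) * (c * a)
    rw [h]
    ring

lemma IsPrimitive.zero : IsPrimitive (fun _ => 0) (fun _ => 0) := fun x _ =>
  ⟨IntervalIntegrable.zero, by simp⟩

lemma IsPrimitive.add {g h g' h' : ℝ → ℂ} (H : IsPrimitive g h) (H' : IsPrimitive g' h') :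
    IsPrimitive (fun x => g x + g' x) (fun x => h x + h' x) := fun x hx =>
  ⟨(H x hx).1.add (H' x hx).1, by
    beta_reduce
    rw [intervalIntegral.integral_add (H x hx).1 (H' x hx).1, (H x hx).2, (H' x hx).2]
    ring⟩

lemma IsPrimitive.smul {g h : ℝ → ℂ} (c : ℂ) (H : IsPrimitive g h) :
    IsPrimitive (fun x => c * g x) (fun x => c * h x) := fun x hx =>
  ⟨(H x hx).1.const_mul c, by
    beta_reduce
    rw [intervalIntegral.integral_const_mul, (H x hx).2]
    ring⟩

lemma IsPrimitive.continuousOn {g h : ℝ → ℂ} (H : IsPrimitive g h) (a : ℝ) (ha : a ≤ 0) :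
    ContinuousOn g (Icc a 0) := by
  have h1 : ContinuousOn (fun x => ∫ t in x..0, h t) (uIcc a 0) := by
    apply intervalIntegral.continuousOn_primitive_interval_left
    rw [← intervalIntegrable_iff']
    exact (H a ha).1
  rw [uIcc_of_le ha] at h1
  exact (continuousOn_const.sub h1).congr fun x hx => (H x hx.2).2

/-- A locally absolutely continuous function that vanishes almost everywhere vanishes, and so does
its derivative. -/
lemma IsPrimitive.eq_zero {g h : ℝ → ℂ} (H : IsPrimitive g h) (hg : g =ᵐ[halfVol] 0) :
    h =ᵐ[halfVol] 0 := by
  have hc : ContinuousOn g (Iio 0) := by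
    intro x hx
    have hx' : x < 0 := hx
    exact ((H.continuousOn (x - 1) (by linarith)).continuousAt
      (Icc_mem_nhds (by linarith) hx')).continuousWithinAt
  have h0 : ∀ x < (0 : ℝ), g x = 0 := fun x hx =>
    Measure.eqOn_open_of_ae_eq hg isOpen_Iio hc continuousOn_const hx
  have hn : ∀ n : ℕ, ∀ᵐ x, x ∈ Ioo (-(n : ℝ)) 0 → h x = 0 := by
    intro n
    have hle : -(n : ℝ) ≤ 0 := by simp
    have hi := (H _ hle).1
    filter_upwards [hi.ae_hasDerivAt_integral] with x hx hxm
    have hd := hx (by rw [uIcc_of_le hle]; exact ⟨hxm.1.le, hxm.2.le⟩) 0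
      (by rw [uIcc_of_le hle]; exact ⟨hle, le_rfl⟩)
    have hev : (fun y => ∫ t in (0 : ℝ)..y, h t) =ᶠ[nhds x] fun _ => -g 0 := by
      filter_upwards [isOpen_Iio.mem_nhds hxm.2] with y hy
      have := (H y (le_of_lt hy)).2
      rw [h0 y hy] at this
      rw [intervalIntegral.integral_symm]
      rw [sub_eq_zero.mp this.symm]
    exact hd.unique ((hasDerivAt_const x (-g 0)).congr_of_eventuallyEq hev)
  have hall := ae_all_iff.2 hn
  refine (ae_restrict_iff' measurableSet_Iio).2 ?_
  filter_upwards [hall] with x hx hxm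
  obtain ⟨n, hnx⟩ := exists_nat_gt (-x)
  exact hx n ⟨by linarith, hxm⟩

/-- The graph of `u ↦ σ u' + W u`, on the maximal domain: the locally absolutely continuous `u` in
`L²` with `σ u' + W u` in `L²`. -/
def firstOrderGraph (σ : ℝ) (W : ℝ → ℝ) : Submodule ℂ (L2 × L2) where
  carrier := {p | ∃ g h : ℝ → ℂ, IsPrimitive g h ∧ p.1 =ᵐ[halfVol] g ∧
    p.2 =ᵐ[halfVol] fun x => (σ : ℂ) * h x + (W x : ℂ) * g x}
  zero_mem' := by
    refine ⟨fun _ => 0, fun _ => 0, IsPrimitive.zero, Lp.coeFn_zero _ _ _, ?_⟩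
    filter_upwards [Lp.coeFn_zero ℂ 2 halfVol] with x hx
    simpa using hx
  add_mem' := by
    rintro ⟨u, v⟩ ⟨u', v'⟩ ⟨g, h, H, hu, hv⟩ ⟨g', h', H', hu', hv'⟩
    refine ⟨_, _, H.add H', ?_, ?_⟩
    · filter_upwards [Lp.coeFn_add u u', hu, hu'] with x h1 h2 h3
      simp only [Prod.mk_add_mk, h1, Pi.add_apply] at h2 h3 ⊢
      rw [h2, h3]
    · filter_upwards [Lp.coeFn_add v v', hv, hv'] with x h1 h2 h3
      simp only [Prod.mk_add_mk, h1, Pi.add_apply] at h2 h3 ⊢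
      rw [h2, h3]
      ring
  smul_mem' := by
    rintro c ⟨u, v⟩ ⟨g, h, H, hu, hv⟩
    refine ⟨_, _, H.smul c, ?_, ?_⟩
    · filter_upwards [Lp.coeFn_smul c u, hu] with x h1 h2
      simp only [Prod.smul_mk, h1, Pi.smul_apply, smul_eq_mul] at h2 ⊢
      rw [h2]
    · filter_upwards [Lp.coeFn_smul c v, hv] with x h1 h2
      simp only [Prod.smul_mk, h1, Pi.smul_apply, smul_eq_mul] at h2 ⊢
      rw [h2]
      ring

/-- The operator `σ d/dx + W` in `L²((-∞, 0), dx)`, on its maximal domain. -/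
def firstOrderOp (σ : ℝ) (W : ℝ → ℝ) : L2 →ₗ.[ℂ] L2 := (firstOrderGraph σ W).toLinearPMap

lemma firstOrderGraph_snd (σ : ℝ) (W : ℝ → ℝ) :
    ∀ p ∈ firstOrderGraph σ W, p.1 = 0 → p.2 = 0 := by
  rintro ⟨u, v⟩ ⟨g, h, H, hu, hv⟩ hu0
  simp only at hu hv hu0
  subst hu0
  have hg : g =ᵐ[halfVol] 0 := hu.symm.trans (Lp.coeFn_zero _ _ _)
  rw [Lp.eq_zero_iff_ae_eq_zero]
  filter_upwards [hv, hg, H.eq_zero hg] with x h1 h2 h3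
  simp [h1, h2, h3]

lemma firstOrderOp_graph (σ : ℝ) (W : ℝ → ℝ) :
    (firstOrderOp σ W).graph = firstOrderGraph σ W :=
  Submodule.toLinearPMap_graph_eq _ (firstOrderGraph_snd σ W)

/-- The graph of `u ↦ -u'' + V u` with the boundary condition `γ` at `0`: `u` and `u'` are locally
absolutely continuous on `(-∞, 0]`, both `u` and `-u'' + V u` are in `L²`, and the boundary values
`u(0)`, `u'(0)` satisfy the boundary condition. -/
def schrodingerGraph (V : ℝ → ℝ) (γ : OnePoint ℝ) : Submodule ℂ (L2 × L2) where
  carrier := {p | ∃ g g₁ g₂ : ℝ → ℂ, IsPrimitive g g₁ ∧ IsPrimitive g₁ g₂ ∧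
    BoundaryCondition γ (g 0) (g₁ 0) ∧ p.1 =ᵐ[halfVol] g ∧
    p.2 =ᵐ[halfVol] fun x => -g₂ x + (V x : ℂ) * g x}
  zero_mem' := by
    refine ⟨fun _ => 0, fun _ => 0, fun _ => 0, IsPrimitive.zero, IsPrimitive.zero,
      BoundaryCondition.zero γ, Lp.coeFn_zero _ _ _, ?_⟩
    filter_upwards [Lp.coeFn_zero ℂ 2 halfVol] with x hx
    simpa using hx
  add_mem' := by
    rintro ⟨u, v⟩ ⟨u', v'⟩ ⟨g, g₁, g₂, H, K, B, hu, hv⟩ ⟨g', g₁', g₂', H', K', B', hu', hv'⟩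
    refine ⟨_, _, _, H.add H', K.add K', B.add B', ?_, ?_⟩
    · filter_upwards [Lp.coeFn_add u u', hu, hu'] with x h1 h2 h3
      simp only [Prod.mk_add_mk, h1, Pi.add_apply] at h2 h3 ⊢
      rw [h2, h3]
    · filter_upwards [Lp.coeFn_add v v', hv, hv'] with x h1 h2 h3
      simp only [Prod.mk_add_mk, h1, Pi.add_apply] at h2 h3 ⊢
      rw [h2, h3]
      ring
  smul_mem' := by
    rintro c ⟨u, v⟩ ⟨g, g₁, g₂, H, K, B, hu, hv⟩
    refine ⟨_, _, _, H.smul c, K.smul c, B.smul c, ?_, ?_⟩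
    · filter_upwards [Lp.coeFn_smul c u, hu] with x h1 h2
      simp only [Prod.smul_mk, h1, Pi.smul_apply, smul_eq_mul] at h2 ⊢
      rw [h2]
    · filter_upwards [Lp.coeFn_smul c v, hv] with x h1 h2
      simp only [Prod.smul_mk, h1, Pi.smul_apply, smul_eq_mul] at h2 ⊢
      rw [h2]
      ring

/-- The self-adjoint realization of `-d²/dx² + V` in `L²((-∞, 0), dx)` given by the boundary
condition `γ ∈ ℝ ∪ {∞}` at `x = 0`. -/
def schrodingerOp (V : ℝ → ℝ) (γ : OnePoint ℝ) : L2 →ₗ.[ℂ] L2 :=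
  (schrodingerGraph V γ).toLinearPMap

lemma schrodingerGraph_snd (V : ℝ → ℝ) (γ : OnePoint ℝ) :
    ∀ p ∈ schrodingerGraph V γ, p.1 = 0 → p.2 = 0 := by
  rintro ⟨u, v⟩ ⟨g, g₁, g₂, H, K, -, hu, hv⟩ hu0
  simp only at hu hv hu0
  subst hu0
  have hg : g =ᵐ[halfVol] 0 := hu.symm.trans (Lp.coeFn_zero _ _ _)
  rw [Lp.eq_zero_iff_ae_eq_zero]
  filter_upwards [hv, hg, K.eq_zero (H.eq_zero hg)] with x h1 h2 h3
  simp [h1, h2, h3]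

lemma schrodingerOp_graph (V : ℝ → ℝ) (γ : OnePoint ℝ) :
    (schrodingerOp V γ).graph = schrodingerGraph V γ :=
  Submodule.toLinearPMap_graph_eq _ (schrodingerGraph_snd V γ)

/-! ### The Schwarzschild anti-de Sitter black hole -/

/-- The metric function `f(r) = 1 - 2M/r - Λ r²/3`. -/
def metricF (M Λ r : ℝ) : ℝ := 1 - 2 * M / r - Λ * r ^ 2 / 3

/-- The horizon radius: the positive zero of `f` (it is unique when `M > 0 > Λ`). -/
def horizonRadius (M Λ : ℝ) : ℝ := sSup {r | 0 < r ∧ metricF M Λ r = 0}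

/-- The tortoise coordinate `x(r) = -∫_r^∞ dr' / f(r')`. -/
def tortoise (M Λ r : ℝ) : ℝ := -∫ s in Ioi r, (metricF M Λ s)⁻¹

/-- The inverse `r(x)`, `x < 0`, of the tortoise coordinate on `(r_h, ∞)`. -/
def radius (M Λ x : ℝ) : ℝ :=
  Function.invFunOn (tortoise M Λ) (Ioi (horizonRadius M Λ)) x

/-- `μ = (ℓ - 1)(ℓ + 2)`. -/
def mu (ℓ : ℕ) : ℝ := ((ℓ : ℝ) - 1) * (ℓ + 2)

/-- `w_ℓ = (ℓ + 2)! / (12 M (ℓ - 2)!)`, for `ℓ ≥ 2`. -/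
def wFreq (M : ℝ) (ℓ : ℕ) : ℝ :=
  1 / (12 * M) * ((Nat.factorial (ℓ + 2) : ℝ) / (Nat.factorial (ℓ - 2) : ℝ))

/-- The Regge–Wheeler potential as a function of `r`. -/
def reggeWheelerPotential (M Λ : ℝ) (ℓ : ℕ) (r : ℝ) : ℝ :=
  metricF M Λ r * ((ℓ : ℝ) * (ℓ + 1) / r ^ 2 - 6 * M / r ^ 3)

/-- The Zerilli potential as a function of `r`. -/
def zerilliPotential (M Λ : ℝ) (ℓ : ℕ) (r : ℝ) : ℝ :=
  metricF M Λ r *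
    (((mu ℓ ^ 2 * (ℓ * (ℓ + 1)) - 24 * M ^ 2 * Λ) * r ^ 3 + 6 * mu ℓ ^ 2 * M * r ^ 2
        + 36 * mu ℓ * M ^ 2 * r + 72 * M ^ 3) /
      (r ^ 3 * (6 * M + mu ℓ * r) ^ 2))

/-- `V_ℓ⁻(x)`. -/
def VMinus (M Λ : ℝ) (ℓ : ℕ) (x : ℝ) : ℝ := reggeWheelerPotential M Λ ℓ (radius M Λ x)

/-- `V_ℓ⁺(x)`. -/
def VPlus (M Λ : ℝ) (ℓ : ℕ) (x : ℝ) : ℝ := zerilliPotential M Λ ℓ (radius M Λ x)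

/-- `W_ℓ = w_ℓ + 6 M f / (r (μ r + 6 M))` as a function of `x`. -/
def superW (M Λ : ℝ) (ℓ : ℕ) (x : ℝ) : ℝ :=
  wFreq M ℓ + 6 * M * metricF M Λ (radius M Λ x) /
    (radius M Λ x * (radius M Λ x * mu ℓ + 6 * M))

/-- `χ_ℓ⁺ = r exp(w_ℓ x) / (μ r + 6 M)` as a function of `x`. -/
def chiPlus (M Λ : ℝ) (ℓ : ℕ) (x : ℝ) : ℝ :=
  radius M Λ x * Real.exp (wFreq M ℓ * x) / (mu ℓ * radius M Λ x + 6 * M)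

/-- `γ_Ch = w_ℓ - 2 M Λ / ((ℓ - 1)(ℓ + 2))`. -/
def gammaCh (M Λ : ℝ) (ℓ : ℕ) : ℝ := wFreq M ℓ - 2 * M * Λ / mu ℓ

/-- The Zerilli Hamiltonian `H_ℓ⁺ = -d²/dx² + V_ℓ⁺` with the boundary condition `γ`. -/
def HPlus (M Λ : ℝ) (ℓ : ℕ) (γ : OnePoint ℝ) : L2 →ₗ.[ℂ] L2 := schrodingerOp (VPlus M Λ ℓ) γ

/-- The Regge–Wheeler Hamiltonian `H_ℓ⁻ = -d²/dx² + V_ℓ⁻` with the boundary condition `γ`. -/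
def HMinus (M Λ : ℝ) (ℓ : ℕ) (γ : OnePoint ℝ) : L2 →ₗ.[ℂ] L2 := schrodingerOp (VMinus M Λ ℓ) γ

/-- `D_ℓ⁺ = d/dx + W_ℓ` in `L²`. -/
def DPlus (M Λ : ℝ) (ℓ : ℕ) : L2 →ₗ.[ℂ] L2 := firstOrderOp 1 (superW M Λ ℓ)

/-- `D_ℓ⁻ = -d/dx + W_ℓ` in `L²`. -/
def DMinus (M Λ : ℝ) (ℓ : ℕ) : L2 →ₗ.[ℂ] L2 := firstOrderOp (-1) (superW M Λ ℓ)

/-- The differential expression `-ψ'' + V ψ`. -/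
def schrodingerExpr (V : ℝ → ℝ) (ψ : ℝ → ℂ) (x : ℝ) : ℂ :=
  -deriv (deriv ψ) x + (V x : ℂ) * ψ x

/-- The differential expression `σ ψ' + W ψ`. -/
def firstOrderExpr (σ : ℝ) (W : ℝ → ℝ) (ψ : ℝ → ℂ) (x : ℝ) : ℂ :=
  (σ : ℂ) * deriv ψ x + (W x : ℂ) * ψ x

end SAdS

end

/-! ### Calculus of locally absolutely continuous functions on the closed half line -/

namespace SAdS

open Filter Topology ComplexConjugate

/-! The two potentials are supersymmetric partners: `V^± = W² ± W' - w²`, with `W ≥ w > 0` and `W`,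
`W'` bounded. Put `σ = -1` for `H^+` and `σ = 1` for `H^-`. Then `H u = v` splits into the first
order system `φ = σ u' + W u`, `-σ φ' + W φ = v + w² u`. In terms of the boundary values `a = u(0)`,
`b = φ(0)` one has `u'(0) = σ (b - W(0) a)`: Dirichlet says `a = 0`, and the Robin condition with
parameter `-σ W(0)` says `b = 0`. Since `W(0) = γ_Ch`, these are exactly the conditions of the
theorem (`schrodinger_iff` and its two special cases), and all that remains concerns `D^±` and
boundary traces.

Two facts about `D^±` carry parts (i) and (ii). Integrating `Re (conj ψ · Dψ)` and using `W ≥ w`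
gives `w ‖ψ‖ ≤ ‖Dψ‖` for `D^+` always and for `D^-` under Dirichlet (`energy`, `le_norm`); this
yields injectivity, and also `⟨u, H u⟩ = ‖φ‖² - w² ‖u‖² ≥ 0` once the boundary term of Green's
formula vanishes. On the other hand the positive zero mode `E` of `D^-` solves both first order
equations by variation of constants, with solutions in `L²` (`exists_dirichlet`, `exists_preimage`).
So `H + w²` is onto in the three nonnegative cases, and the spectrum is nonnegative by
`hasNonnegSpectrum_of_graph`. The mode `E` is `χ^+`; it spans the kernel of `D^-`.

On smooth vectors `D^±` intertwine the two Hamiltonians and exchange the conditions `a = 0` and `b =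
0`. Surjectivity is a bootstrap: if `D^- u = φ`, then `H^+ u = D^+ φ - w² u`, so `u` inherits its
regularity from `D^+ φ`.

For (iii), cutting off local solutions of `-u'' + V u = κ u` produces smooth vectors with any
boundary data allowed by `γ` and any real `κ`. The image has `φ(0)` independent of `κ`, while
`φ'(0)` contains the term `-σ (κ + w²) u(0)`; varying `κ` rules out all pairs but two
(`mapsTo_iff`).

The concrete input is that in the variable `s = 1/r`, extended by `0` to `x ≥ 0`, everything is a
rational function of a bounded solution of `s' = -P(s)` with `P` a cubic polynomial. -/

lemma intervalIntegrable_of_integrable {F : Type*} [NormedAddCommGroup F] {h : ℝ → F}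
    (hi : Integrable h halfVol) {x : ℝ} (hx : x ≤ 0) : IntervalIntegrable h volume x 0 := by
  rw [intervalIntegrable_iff_integrableOn_Ioo_of_le hx]
  exact IntegrableOn.mono_set hi fun y hy => hy.2

lemma intervalIntegrable_of_memLp {F : Type*} [NormedAddCommGroup F] {h : ℝ → F}
    (hi : MemLp h 2 halfVol) {x : ℝ} (hx : x ≤ 0) : IntervalIntegrable h volume x 0 := by
  rw [intervalIntegrable_iff_integrableOn_Ioo_of_le hx]
  have h1 : MemLp h 2 (volume.restrict (Ioo x 0)) :=
    hi.mono_measure (Measure.restrict_mono (fun y hy => hy.2) le_rfl)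
  exact h1.integrable one_le_two

lemma IsPrimitive.congr_deriv {g h h' : ℝ → ℂ} (H : IsPrimitive g h) (e : h =ᵐ[halfVol] h') :
    IsPrimitive g h' := by
  intro x hx
  have e' : ∀ᵐ t, t ∈ uIoc x 0 → h t = h' t := by
    -- The interval of integration contains its endpoint `0`, which `halfVol` does not see.
    have h0 : ∀ᵐ t : ℝ, t ≠ 0 := by simp [ae_iff]
    filter_upwards [(ae_restrict_iff' measurableSet_Iio).1 e, h0] with t ht h0 hm
    rw [uIoc_of_le hx] at hm
    exact ht (lt_of_le_of_ne hm.2 h0)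
  refine ⟨(H x hx).1.congr_ae ((ae_restrict_iff' measurableSet_uIoc).2 e'), ?_⟩
  rw [(H x hx).2, intervalIntegral.integral_congr_ae e']

lemma IsPrimitive.sub {g h g' h' : ℝ → ℂ} (H : IsPrimitive g h) (H' : IsPrimitive g' h') :
    IsPrimitive (fun x => g x - g' x) (fun x => h x - h' x) := by
  have := H.add (H'.smul (-1))
  simpa [← sub_eq_add_neg] using this

lemma IsPrimitive.continuousOn_Iic {g h : ℝ → ℂ} (H : IsPrimitive g h) :
    ContinuousOn g (Iic 0) := by
  intro x hx
  have hx' : x ≤ 0 := hx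
  have h1 := H.continuousOn (x - 1) (by linarith) x ⟨by linarith, hx'⟩
  refine h1.mono_of_mem_nhdsWithin ?_
  rw [← Ici_inter_Iic, inter_comm]
  exact inter_mem self_mem_nhdsWithin (mem_nhdsWithin_of_mem_nhds (Ici_mem_nhds (by linarith)))

lemma isPrimitive_const (c : ℂ) : IsPrimitive (fun _ => c) (fun _ => 0) := fun x _ =>
  ⟨IntervalIntegrable.zero, by simp⟩

lemma isPrimitive_integral {h : ℝ → ℂ} (hh : ∀ x ≤ (0 : ℝ), IntervalIntegrable h volume x 0) :
    IsPrimitive (fun x => -∫ t in x..0, h t) h := fun x hx => ⟨hh x hx, by simp⟩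

lemma IsPrimitive.of_hasDerivAt {g h : ℝ → ℂ} (hg : ContinuousOn g (Iic 0))
    (hd : ∀ x < (0 : ℝ), HasDerivAt g (h x) x) (hh : ContinuousOn h (Iic 0)) :
    IsPrimitive g h := by
  intro x hx
  have hi : IntervalIntegrable h volume x 0 := by
    apply ContinuousOn.intervalIntegrable
    rw [uIcc_of_le hx]
    exact hh.mono fun y hy => hy.2
  refine ⟨hi, ?_⟩
  rw [intervalIntegral.integral_eq_sub_of_hasDerivAt_of_le hx (hg.mono fun y hy => hy.2)
    (fun y hy => hd y hy.2) hi]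
  ring

/-- A locally absolutely continuous function and its derivative are determined by the almost
everywhere class of the function. -/
lemma IsPrimitive.unique {g h g' h' : ℝ → ℂ} (H : IsPrimitive g h) (H' : IsPrimitive g' h')
    (e : g =ᵐ[halfVol] g') : (∀ x ≤ (0 : ℝ), g x = g' x) ∧ h =ᵐ[halfVol] h' := by
  have h1 := (H.sub H').eq_zero (by
    filter_upwards [e] with x hx
    simp [hx])
  refine ⟨?_, ?_⟩
  · have h2 := (H.sub H').congr_deriv h1
    have hc : ∀ x ≤ (0 : ℝ), g x - g' x = g 0 - g' 0 := by
      intro x hx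
      have := (h2 x hx).2
      simpa using this
    -- The difference is constant; one point of equality, which exists because `halfVol` is not
    -- zero, makes it vanish.
    have he : ∃ x < (0 : ℝ), g x = g' x := by
      by_contra! hne
      have h3 : ∀ᵐ x ∂halfVol, False := by
        filter_upwards [e, ae_restrict_mem measurableSet_Iio] with x hx hx0
        exact hne x hx0 hx
      rw [eventually_false_iff_eq_bot, ae_eq_bot] at h3
      have h4 := congrArg (fun m : Measure ℝ => m (univ : Set ℝ)) h3
      simp at h4
    obtain ⟨x0, hx0, hx0'⟩ := he
    intro x hx
    have a := hc x hx
    have b := hc x0 hx0.le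
    rw [hx0', sub_self] at b
    rw [← b] at a
    exact sub_eq_zero.1 a
  · filter_upwards [h1] with x hx
    exact sub_eq_zero.1 hx

/-- Product rule for real absolutely continuous functions. `f` and `g` are controlled only on `[x,
0]`, so they are replaced by the globally defined primitives `F` and `G`; the complex case follows
by splitting into real and imaginary parts. -/
lemma intervalIntegral_mul_of_primitive {f g h k : ℝ → ℝ} {x : ℝ}
    (hh : IntervalIntegrable h volume x 0) (hk : IntervalIntegrable k volume x 0)
    (hf : ∀ y ∈ uIcc x 0, f y = f 0 - ∫ t in y..0, h t)
    (hg : ∀ y ∈ uIcc x 0, g y = g 0 - ∫ t in y..0, k t) :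
    f x * g x = f 0 * g 0 - ∫ t in x..0, (h t * g t + f t * k t) := by
  set F : ℝ → ℝ := fun y => f 0 + ∫ t in (0 : ℝ)..y, h t with hF
  set G : ℝ → ℝ := fun y => g 0 + ∫ t in (0 : ℝ)..y, k t with hG
  have eF : ∀ y ∈ uIcc x 0, f y = F y := fun y hy => by
    rw [hf y hy, intervalIntegral.integral_symm, sub_neg_eq_add]
  have eG : ∀ y ∈ uIcc x 0, g y = G y := fun y hy => by
    rw [hg y hy, intervalIntegral.integral_symm, sub_neg_eq_add]
  have cst : ∀ c : ℝ, AbsolutelyContinuousOnInterval (fun _ : ℝ => c) x 0 := fun c =>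
    (LipschitzWith.const c).lipschitzOnWith.absolutelyContinuousOnInterval
  have aF : AbsolutelyContinuousOnInterval F x 0 :=
    (cst _).add (hh.absolutelyContinuousOnInterval_intervalIntegral (by simp))
  have aG : AbsolutelyContinuousOnInterval G x 0 :=
    (cst _).add (hk.absolutelyContinuousOnInterval_intervalIntegral (by simp))
  have key := aF.integral_deriv_mul_eq_sub aG
  rw [eF x (by simp), eG x (by simp), eF 0 (by simp), eG 0 (by simp)]
  have : ∫ t in x..0, (h t * g t + f t * k t) = ∫ t in x..0, deriv F t * G t + F t * deriv G t := by
    apply intervalIntegral.integral_congr_ae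
    filter_upwards [hh.ae_hasDerivAt_integral, hk.ae_hasDerivAt_integral] with t h1 h2 ht
    have ht' := uIoc_subset_uIcc ht
    have d1 : HasDerivAt F (h t) t := (h1 ht' 0 (by simp)).const_add _
    have d2 : HasDerivAt G (k t) t := (h2 ht' 0 (by simp)).const_add _
    rw [d1.deriv, d2.deriv, eF t ht', eG t ht']
  rw [this, key]
  ring

lemma IsPrimitive.re_im {g h : ℝ → ℂ} (H : IsPrimitive g h) {x : ℝ} (hx : x ≤ 0) :
    (IntervalIntegrable (fun t => (h t).re) volume x 0 ∧
      ∀ y ∈ uIcc x 0, (g y).re = (g 0).re - ∫ t in y..0, (h t).re) ∧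
    (IntervalIntegrable (fun t => (h t).im) volume x 0 ∧
      ∀ y ∈ uIcc x 0, (g y).im = (g 0).im - ∫ t in y..0, (h t).im) := by
  have hR : ∀ y ≤ (0 : ℝ), IntervalIntegrable (fun t => (h t).re) volume y 0 := fun y hy =>
    ⟨(H y hy).1.1.re, (H y hy).1.2.re⟩
  have hI : ∀ y ≤ (0 : ℝ), IntervalIntegrable (fun t => (h t).im) volume y 0 := fun y hy =>
    ⟨(H y hy).1.1.im, (H y hy).1.2.im⟩
  refine ⟨⟨hR x hx, fun y hy => ?_⟩, ⟨hI x hx, fun y hy => ?_⟩⟩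
  · rw [uIcc_of_le hx] at hy
    have := Complex.reCLM.intervalIntegral_comp_comm (H y hy.2).1
    simp only [Complex.reCLM_apply] at this
    rw [this, (H y hy.2).2, Complex.sub_re]
  · rw [uIcc_of_le hx] at hy
    have := Complex.imCLM.intervalIntegral_comp_comm (H y hy.2).1
    simp only [Complex.imCLM_apply] at this
    rw [this, (H y hy.2).2, Complex.sub_im]

lemma IsPrimitive.mul {g h g' h' : ℝ → ℂ} (H : IsPrimitive g h) (H' : IsPrimitive g' h') :
    IsPrimitive (fun x => g x * g' x) (fun x => h x * g' x + g x * h' x) := by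
  intro x hx
  have cg : ContinuousOn g (uIcc x 0) := by rw [uIcc_of_le hx]; exact H.continuousOn x hx
  have cg' : ContinuousOn g' (uIcc x 0) := by rw [uIcc_of_le hx]; exact H'.continuousOn x hx
  have hi : IntervalIntegrable (fun x => h x * g' x + g x * h' x) volume x 0 :=
    ((H x hx).1.mul_continuousOn cg').add ((H' x hx).1.continuousOn_mul cg)
  refine ⟨hi, ?_⟩
  obtain ⟨⟨r1, r2⟩, i1, i2⟩ := H.re_im hx
  obtain ⟨⟨r1', r2'⟩, i1', i2'⟩ := H'.re_im hx
  have crg : ContinuousOn (fun t => (g t).re) (uIcc x 0) := Complex.continuous_re.comp_continuousOn cg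
  have cig : ContinuousOn (fun t => (g t).im) (uIcc x 0) := Complex.continuous_im.comp_continuousOn cg
  have crg' : ContinuousOn (fun t => (g' t).re) (uIcc x 0) :=
    Complex.continuous_re.comp_continuousOn cg'
  have cig' : ContinuousOn (fun t => (g' t).im) (uIcc x 0) :=
    Complex.continuous_im.comp_continuousOn cg'
  have rr := intervalIntegral_mul_of_primitive r1 r1' r2 r2'
  have ri := intervalIntegral_mul_of_primitive r1 i1' r2 i2'
  have ir := intervalIntegral_mul_of_primitive i1 r1' i2 r2'
  have ii := intervalIntegral_mul_of_primitive i1 i1' i2 i2'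
  have hre := Complex.reCLM.intervalIntegral_comp_comm hi
  have him := Complex.imCLM.intervalIntegral_comp_comm hi
  simp only [Complex.reCLM_apply, Complex.imCLM_apply] at hre him
  apply Complex.ext
  · rw [Complex.sub_re, ← hre, Complex.mul_re, Complex.mul_re, rr, ii]
    have : ∫ t in x..0, (h t * g' t + g t * h' t).re =
        (∫ t in x..0, ((h t).re * (g' t).re + (g t).re * (h' t).re)) -
        ∫ t in x..0, ((h t).im * (g' t).im + (g t).im * (h' t).im) := by
      rw [← intervalIntegral.integral_sub]
      · congr 1
        ext t
        simp only [Complex.add_re, Complex.mul_re]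
        ring
      · exact (r1.mul_continuousOn crg').add (r1'.continuousOn_mul crg)
      · exact (i1.mul_continuousOn cig').add (i1'.continuousOn_mul cig)
    rw [this]
    ring
  · rw [Complex.sub_im, ← him, Complex.mul_im, Complex.mul_im, ri, ir]
    have : ∫ t in x..0, (h t * g' t + g t * h' t).im =
        (∫ t in x..0, ((h t).re * (g' t).im + (g t).re * (h' t).im)) +
        ∫ t in x..0, ((h t).im * (g' t).re + (g t).im * (h' t).re) := by
      rw [← intervalIntegral.integral_add]
      · congr 1
        ext t
        simp only [Complex.add_im, Complex.mul_im]
        ring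
      · exact (r1.mul_continuousOn cig').add (i1'.continuousOn_mul crg)
      · exact (i1.mul_continuousOn crg').add (r1'.continuousOn_mul cig)
    rw [this]
    ring

lemma IsPrimitive.conj {g h : ℝ → ℂ} (H : IsPrimitive g h) :
    IsPrimitive (fun x => conj (g x)) (fun x => conj (h x)) := by
  intro x hx
  have hc := Complex.conjCLE.toContinuousLinearMap.intervalIntegral_comp_comm (H x hx).1
  simp only [ContinuousLinearEquiv.coe_coe, Complex.conjCLE_apply] at hc
  refine ⟨⟨?_, ?_⟩, ?_⟩
  · exact Complex.conjCLE.toContinuousLinearMap.integrable_comp (H x hx).1.1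
  · exact Complex.conjCLE.toContinuousLinearMap.integrable_comp (H x hx).1.2
  · rw [hc]
    beta_reduce
    rw [(H x hx).2, map_sub]

lemma IsPrimitive.aestronglyMeasurable {g h : ℝ → ℂ} (H : IsPrimitive g h) :
    AEStronglyMeasurable g halfVol :=
  (H.continuousOn_Iic.mono Iio_subset_Iic_self).aestronglyMeasurable measurableSet_Iio

lemma integral_halfVol_eq (h : ℝ → ℂ) : ∫ x, h x ∂halfVol = ∫ x in Iic (0 : ℝ), h x :=
  (integral_Iic_eq_integral_Iio).symm

lemma integrable_halfVol_iff {F : Type*} [NormedAddCommGroup F] {h : ℝ → F} :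
    Integrable h halfVol ↔ IntegrableOn h (Iic (0 : ℝ)) :=
  (integrableOn_Iic_iff_integrableOn_Iio).symm

/-- If `g` and its derivative are integrable on the half line then `g` vanishes at `-∞`. -/
lemma IsPrimitive.integral_eq {g h : ℝ → ℂ} (H : IsPrimitive g h) (hg : Integrable g halfVol)
    (hh : Integrable h halfVol) : ∫ x, h x ∂halfVol = g 0 := by
  have h1 := intervalIntegral_tendsto_integral_Iic (0 : ℝ) (integrable_halfVol_iff.1 hh) tendsto_id
  have h2 : Tendsto g atBot (𝓝 (g 0 - ∫ x in Iic (0 : ℝ), h x)) := by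
    refine (tendsto_const_nhds.sub h1).congr' ?_
    filter_upwards [eventually_le_atBot (0 : ℝ)] with x hx
    exact (H x hx).2.symm
  -- The limit of `g` at `-∞` exists because `h` is integrable, and it must be `0` because `g` is
  -- integrable on a set of infinite measure.
  have h3 : g 0 - ∫ x in Iic (0 : ℝ), h x = 0 := by
    refine IntegrableAtFilter.eq_zero_of_tendsto (μ := volume) (f := g) (l := atBot)
      ⟨Iic 0, Iic_mem_atBot 0, integrable_halfVol_iff.1 hg⟩ (fun s hs => ?_) h2
    obtain ⟨a, ha⟩ := mem_atBot_sets.1 hs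
    have : volume (Iic a) ≤ volume s := measure_mono fun y hy => ha y hy
    simpa using this
  rw [integral_halfVol_eq, ← sub_eq_zero.1 h3]

end SAdS

/-! ### Square integrability, boundary traces, and the first order factorization -/

namespace SAdS

open Filter Topology ComplexConjugate

lemma integrable_conj_mul {f g : ℝ → ℂ} (hf : MemLp f 2 halfVol) (hg : MemLp g 2 halfVol) :
    Integrable (fun x => conj (f x) * g x) halfVol :=
  MemLp.integrable_mul (p := 2) (q := 2) hf.star hg

lemma memLp_of_intervalIntegral_bounded {g : ℝ → ℂ} (hg : AEStronglyMeasurable g halfVol)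
    (hi : ∀ x ≤ (0 : ℝ), IntervalIntegrable (fun t => ‖g t‖ ^ 2) volume x 0) (K : ℝ)
    (hK : ∀ x ≤ (0 : ℝ), ∫ t in x..0, ‖g t‖ ^ 2 ≤ K) : MemLp g 2 halfVol := by
  rw [memLp_two_iff_integrable_sq_norm hg, integrable_halfVol_iff]
  refine integrableOn_Iic_of_intervalIntegral_norm_bounded (l := atTop) (a := fun n : ℕ => -(n : ℝ))
    K 0 (fun n => ?_) (tendsto_neg_atTop_atBot.comp tendsto_natCast_atTop_atTop)
    (Eventually.of_forall fun n => ?_)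
  · exact (hi (-(n : ℝ)) (by simp)).1
  · simpa using hK (-(n : ℝ)) (by simp)

lemma IsPrimitive.normSq {g h : ℝ → ℂ} (H : IsPrimitive g h) :
    ∀ x ≤ (0 : ℝ), IntervalIntegrable (fun t => 2 * (conj (g t) * h t).re) volume x 0 ∧
      ‖g x‖ ^ 2 = ‖g 0‖ ^ 2 - ∫ t in x..0, 2 * (conj (g t) * h t).re := by
  intro x hx
  obtain ⟨⟨h1, h2⟩, -⟩ := (H.conj.mul H).re_im hx
  have e : ∀ t, (conj (h t) * g t + conj (g t) * h t).re = 2 * (conj (g t) * h t).re := by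
    intro t
    simp [Complex.mul_re]
    ring
  have e2 : ∀ z : ℂ, (conj z * z).re = ‖z‖ ^ 2 := by
    intro z
    rw [mul_comm, Complex.mul_conj, Complex.ofReal_re, Complex.normSq_eq_norm_sq]
  simp only [e, e2] at h1 h2
  exact ⟨h1, h2 x (by simp)⟩

/-- If `g` and `g''` are square integrable on the half line, so is `g'`. -/
lemma memLp_deriv {g g₁ g₂ : ℝ → ℂ} (H : IsPrimitive g g₁) (K : IsPrimitive g₁ g₂)
    (hg : MemLp g 2 halfVol) (hg₂ : MemLp g₂ 2 halfVol) : MemLp g₁ 2 halfVol := by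
  have hsq : ∀ x ≤ (0 : ℝ), IntervalIntegrable (fun t => ‖g₁ t‖ ^ 2) volume x 0 := by
    intro x hx
    apply ContinuousOn.intervalIntegrable
    rw [uIcc_of_le hx]
    exact (K.continuousOn x hx).norm.pow 2
  have hI := integrable_conj_mul hg hg₂
  set B : ℝ := ∫ t, ‖conj (g t) * g₂ t‖ ∂halfVol with hB
  set c : ℝ := ‖conj (g 0) * g₁ 0‖ + B with hc
  -- Integrate `(conj g · g')' = |g'|² + conj g · g''` over `[x, 0]`; the last term is integrable,
  -- and `B` bounds its contribution.
  have hre : ∀ x ≤ (0 : ℝ), (conj (g x) * g₁ x).re ≤ c - ∫ t in x..0, ‖g₁ t‖ ^ 2 := by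
    intro x hx
    obtain ⟨⟨-, h2⟩, -⟩ := (H.conj.mul K).re_im hx
    have h3 := h2 x (by simp)
    have hr : IntervalIntegrable (fun t => (conj (g t) * g₂ t).re) volume x 0 :=
      intervalIntegrable_of_integrable hI.re hx
    have e : ∀ t, (conj (g₁ t) * g₁ t + conj (g t) * g₂ t).re =
        ‖g₁ t‖ ^ 2 + (conj (g t) * g₂ t).re := by
      intro t
      rw [Complex.add_re, mul_comm (conj (g₁ t)), Complex.mul_conj, Complex.ofReal_re,
        Complex.normSq_eq_norm_sq]
    simp only [e] at h3
    rw [intervalIntegral.integral_add (hsq x hx) hr] at h3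
    have h4 : -∫ t in x..0, (conj (g t) * g₂ t).re ≤ B := by
      refine (neg_le_abs _).trans ?_
      rw [← Real.norm_eq_abs]
      refine (intervalIntegral.norm_integral_le_integral_norm hx).trans ?_
      have h5 : ∫ t in x..0, ‖(conj (g t) * g₂ t).re‖ ≤ ∫ t in x..0, ‖conj (g t) * g₂ t‖ :=
        intervalIntegral.integral_mono_on hx hr.norm
          (intervalIntegrable_of_integrable hI.norm hx) fun t _ => Complex.abs_re_le_norm _
      refine h5.trans ?_
      rw [intervalIntegral.integral_of_le hx, integral_Ioc_eq_integral_Ioo]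
      exact setIntegral_mono_set hI.norm (ae_of_all _ fun t => norm_nonneg _)
        (LE.le.eventuallyLE fun t ht => ht.2)
    have h6 := Complex.re_le_norm (conj (g 0) * g₁ 0)
    linarith
  refine memLp_of_intervalIntegral_bounded K.aestronglyMeasurable hsq (c + 1) ?_
  -- If `∫ |g'|²` ever exceeds `c + 1`, then `(|g|²)' = 2 Re (conj g · g') ≤ -2` from there down to
  -- `-∞`, so `|g|²` stays above `1` and cannot be integrable.
  by_contra! hcon
  obtain ⟨x₀, hx₀, hlt⟩ := hcon
  have hneg : ∀ x ≤ x₀, (conj (g x) * g₁ x).re ≤ -1 := by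
    intro x hx
    have h1 := hre x (hx.trans hx₀)
    have h2 : ∫ t in x₀..0, ‖g₁ t‖ ^ 2 ≤ ∫ t in x..0, ‖g₁ t‖ ^ 2 :=
      intervalIntegral.integral_mono_interval hx hx₀ le_rfl (ae_of_all _ fun t => sq_nonneg _)
        (hsq x (hx.trans hx₀))
    linarith
  have hbig : ∀ x ≤ x₀ - 1, 1 ≤ ‖g x‖ ^ 2 := by
    intro x hx
    have hx1 : x ≤ x₀ := by linarith
    obtain ⟨i1, e1⟩ := H.normSq x (hx1.trans hx₀)
    obtain ⟨i2, e2⟩ := H.normSq x₀ hx₀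
    have i3 : IntervalIntegrable (fun t => 2 * (conj (g t) * g₁ t).re) volume x x₀ :=
      i1.trans i2.symm
    have h1 : ∫ t in x..x₀, 2 * (conj (g t) * g₁ t).re ≤ ∫ t in x..x₀, (-2 : ℝ) :=
      intervalIntegral.integral_mono_on hx1 i3 intervalIntegrable_const fun t ht => by
        have := hneg t ht.2
        linarith
    rw [intervalIntegral.integral_const, smul_eq_mul] at h1
    have h2 := intervalIntegral.integral_add_adjacent_intervals i3 i2
    have h3 : 0 ≤ ‖g x₀‖ ^ 2 := sq_nonneg _
    nlinarith
  have hm : IntegrableOn (fun x => ‖g x‖ ^ 2) (Iic (x₀ - 1)) := by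
    have := (memLp_two_iff_integrable_sq_norm hg.1).1 hg
    exact (integrable_halfVol_iff.1 this).mono_set (Iic_subset_Iic.2 (by linarith))
  have h1 : IntegrableOn (fun _ => (1 : ℝ)) (Iic (x₀ - 1)) := by
    refine hm.mono' aestronglyMeasurable_const ?_
    filter_upwards [ae_restrict_mem measurableSet_Iic] with x hx
    simpa using hbig x hx
  rw [integrableOn_const_iff] at h1
  simp at h1

lemma memLp_coe {u : L2} {g : ℝ → ℂ} (e : u =ᵐ[halfVol] g) : MemLp g 2 halfVol :=
  (memLp_congr_ae e).1 (Lp.memLp u)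

lemma inner_eq_integral {u v : L2} {f g : ℝ → ℂ} (hu : u =ᵐ[halfVol] f) (hv : v =ᵐ[halfVol] g) :
    inner ℂ u v = ∫ x, conj (f x) * g x ∂halfVol := by
  rw [L2.inner_def]
  apply integral_congr_ae
  filter_upwards [hu, hv] with x h1 h2
  rw [h1, h2, RCLike.inner_apply, mul_comm]

/-- `u` has a locally absolutely continuous representative with value `a` at `0`. -/
def HasTrace (u : L2) (a : ℂ) : Prop :=
  ∃ g h : ℝ → ℂ, IsPrimitive g h ∧ u =ᵐ[halfVol] g ∧ g 0 = a

lemma HasTrace.unique {u : L2} {a b : ℂ} (ha : HasTrace u a) (hb : HasTrace u b) : a = b := by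
  obtain ⟨g, h, H, e, rfl⟩ := ha
  obtain ⟨g', h', H', e', rfl⟩ := hb
  exact (H.unique H' (e.symm.trans e')).1 0 le_rfl

lemma HasTrace.add {u v : L2} {a b : ℂ} (ha : HasTrace u a) (hb : HasTrace v b) :
    HasTrace (u + v) (a + b) := by
  obtain ⟨g, h, H, e, rfl⟩ := ha
  obtain ⟨g', h', H', e', rfl⟩ := hb
  refine ⟨_, _, H.add H', ?_, rfl⟩
  filter_upwards [Lp.coeFn_add u v, e, e'] with x h1 h2 h3
  rw [h1, Pi.add_apply, h2, h3]

lemma HasTrace.smul {u : L2} {a : ℂ} (c : ℂ) (ha : HasTrace u a) : HasTrace (c • u) (c * a) := by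
  obtain ⟨g, h, H, e, rfl⟩ := ha
  refine ⟨_, _, H.smul c, ?_, rfl⟩
  filter_upwards [Lp.coeFn_smul c u, e] with x h1 h2
  rw [h1, Pi.smul_apply, h2, smul_eq_mul]

lemma mem_graph_iff_apply {E : Type*} [NormedAddCommGroup E] [NormedSpace ℂ E] {A : E →ₗ.[ℂ] E}
    {u v : E} : (u, v) ∈ A.graph ↔ ∃ h : u ∈ A.domain, A ⟨u, h⟩ = v := by
  rw [LinearPMap.mem_graph_iff]
  constructor
  · rintro ⟨y, rfl, rfl⟩
    exact ⟨y.2, rfl⟩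
  · rintro ⟨h, rfl⟩
    exact ⟨⟨u, h⟩, rfl, rfl⟩

lemma mem_firstOrderGraph_iff {σ : ℝ} {W : ℝ → ℝ} {u v : L2} :
    (u, v) ∈ firstOrderGraph σ W ↔
      ∃ h : u ∈ (firstOrderOp σ W).domain, firstOrderOp σ W ⟨u, h⟩ = v := by
  rw [← firstOrderOp_graph, mem_graph_iff_apply]

lemma mem_schrodingerGraph_iff {V : ℝ → ℝ} {γ : OnePoint ℝ} {u v : L2} :
    (u, v) ∈ schrodingerGraph V γ ↔
      ∃ h : u ∈ (schrodingerOp V γ).domain, schrodingerOp V γ ⟨u, h⟩ = v := by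
  rw [← schrodingerOp_graph, mem_graph_iff_apply]

lemma firstOrderGraph_hasTrace {σ : ℝ} {W : ℝ → ℝ} {u v : L2} (h : (u, v) ∈ firstOrderGraph σ W) :
    ∃ a, HasTrace u a := by
  obtain ⟨g, h, H, e, -⟩ := h
  exact ⟨g 0, g, h, H, e, rfl⟩

lemma firstOrderGraph_add {σ : ℝ} {W : ℝ → ℝ} {u v u' v' : L2} (h : (u, v) ∈ firstOrderGraph σ W)
    (h' : (u', v') ∈ firstOrderGraph σ W) : (u + u', v + v') ∈ firstOrderGraph σ W :=
  (firstOrderGraph σ W).add_mem h h'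

lemma firstOrderGraph_smul {σ : ℝ} {W : ℝ → ℝ} {u v : L2} (c : ℂ)
    (h : (u, v) ∈ firstOrderGraph σ W) : (c • u, c • v) ∈ firstOrderGraph σ W :=
  (firstOrderGraph σ W).smul_mem c h

lemma firstOrderGraph_unique {σ : ℝ} {W : ℝ → ℝ} {u v v' : L2} (h : (u, v) ∈ firstOrderGraph σ W)
    (h' : (u, v') ∈ firstOrderGraph σ W) : v = v' := by
  have := firstOrderGraph_snd σ W _ ((firstOrderGraph σ W).sub_mem h h') (sub_self u)
  exact sub_eq_zero.1 this

/-- A regular superpotential `W` on the half line, with derivative `dW`, together with a positive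
zero mode `E` of `-d/dx + W`. -/
structure IsSuperPotential (W dW E : ℝ → ℝ) (w C : ℝ) : Prop where
  w_pos : 0 < w
  continuous : Continuous W
  continuous_deriv : Continuous dW
  le : ∀ x, w ≤ W x
  bound : ∀ x, W x ≤ C
  bound_deriv : ∀ x, |dW x| ≤ C
  hasDerivAt : ∀ x < (0 : ℝ), HasDerivAt W (dW x) x
  contDiffOn : ContDiffOn ℝ (⊤ : ℕ∞) W (Iio 0)
  mode_pos : ∀ x, 0 < E x
  mode_continuous : Continuous E
  mode_hasDerivAt : ∀ x < (0 : ℝ), HasDerivAt E (W x * E x) x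

/-- The partner potentials of a superpotential. -/
def partnerPotential (σ : ℝ) (W dW : ℝ → ℝ) (w x : ℝ) : ℝ := W x ^ 2 - σ * dW x - w ^ 2

namespace IsSuperPotential

variable {W dW E : ℝ → ℝ} {w C : ℝ} (S : IsSuperPotential W dW E w C)

include S

lemma isPrimitive : IsPrimitive (fun x => (W x : ℂ)) (fun x => (dW x : ℂ)) :=
  IsPrimitive.of_hasDerivAt (Complex.continuous_ofReal.comp S.continuous).continuousOn
    (fun x hx => (S.hasDerivAt x hx).ofReal_comp)
    (Complex.continuous_ofReal.comp S.continuous_deriv).continuousOn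

lemma norm_le (x : ℝ) : ‖(W x : ℂ)‖ ≤ C := by
  rw [Complex.norm_real, Real.norm_eq_abs, abs_of_pos (S.w_pos.trans_le (S.le x))]
  exact S.bound x

lemma memLp_mul {g : ℝ → ℂ} (hg : MemLp g 2 halfVol) :
    MemLp (fun x => (W x : ℂ) * g x) 2 halfVol := by
  refine hg.of_le_mul (c := C) ?_ (ae_of_all _ fun x => ?_)
  · exact (Complex.continuous_ofReal.comp S.continuous).aestronglyMeasurable.mul hg.1
  · rw [norm_mul]
    exact mul_le_mul_of_nonneg_right (S.norm_le x) (norm_nonneg _)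

lemma memLp_partner_mul (σ : ℝ) {g : ℝ → ℂ} (hg : MemLp g 2 halfVol) :
    MemLp (fun x => (partnerPotential σ W dW w x : ℂ) * g x) 2 halfVol := by
  refine hg.of_le_mul (c := C ^ 2 + |σ| * C + w ^ 2) ?_ (ae_of_all _ fun x => ?_)
  · refine (Complex.continuous_ofReal.comp ?_).aestronglyMeasurable.mul hg.1
    exact ((S.continuous.pow 2).sub (continuous_const.mul S.continuous_deriv)).sub continuous_const
  · rw [norm_mul]
    refine mul_le_mul_of_nonneg_right ?_ (norm_nonneg _)
    rw [Complex.norm_real, Real.norm_eq_abs]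
    have h1 : |W x| ≤ C := by
      rw [abs_of_pos (S.w_pos.trans_le (S.le x))]; exact S.bound x
    have h2 : |W x ^ 2| ≤ C ^ 2 := by
      rw [abs_pow]
      exact pow_le_pow_left₀ (abs_nonneg _) h1 2
    have h3 : |σ * dW x| ≤ |σ| * C := by
      rw [abs_mul]
      exact mul_le_mul_of_nonneg_left (S.bound_deriv x) (abs_nonneg _)
    calc |partnerPotential σ W dW w x| ≤ |W x ^ 2 - σ * dW x| + |w ^ 2| := abs_sub _ _
      _ ≤ |W x ^ 2| + |σ * dW x| + |w ^ 2| := by gcongr; exact abs_sub _ _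
      _ ≤ _ := by rw [abs_of_nonneg (sq_nonneg w)]; gcongr

/-- The domain of the Schrödinger operator in terms of the two first order operators. -/
lemma schrodinger_iff {σ : ℝ} (hσ : σ * σ = 1) {γ : OnePoint ℝ} {u v : L2} :
    (u, v) ∈ schrodingerGraph (partnerPotential σ W dW w) γ ↔
      ∃ (φ : L2) (a b : ℂ), (u, φ) ∈ firstOrderGraph σ W ∧
        (φ, v + (w : ℂ) ^ 2 • u) ∈ firstOrderGraph (-σ) W ∧ HasTrace u a ∧ HasTrace φ b ∧
        BoundaryCondition γ a (σ * (b - W 0 * a)) := by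
  have hσ' : (σ : ℂ) * σ = 1 := by exact_mod_cast hσ
  constructor
  · rintro ⟨g, g₁, g₂, H, K, B, hu, hv⟩
    simp only at hu hv
    have hg := memLp_coe hu
    have hg₂ : MemLp g₂ 2 halfVol := by
      have h1 := (S.memLp_partner_mul σ hg).sub (memLp_coe hv)
      refine (memLp_congr_ae ?_).1 h1
      refine ae_of_all _ fun x => ?_
      simp
    have hg₁ := memLp_deriv H K hg hg₂
    have hφ : MemLp (fun x => (σ : ℂ) * g₁ x + (W x : ℂ) * g x) 2 halfVol :=
      (hg₁.const_mul _).add (S.memLp_mul hg)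
    have Hφ := (K.smul (σ : ℂ)).add (S.isPrimitive.mul H)
    refine ⟨hφ.toLp _, g 0, σ * g₁ 0 + W 0 * g 0, ⟨g, g₁, H, hu, hφ.coeFn_toLp⟩,
      ⟨_, _, Hφ, hφ.coeFn_toLp, ?_⟩, ⟨g, g₁, H, hu, rfl⟩, ⟨_, _, Hφ, hφ.coeFn_toLp, rfl⟩, ?_⟩
    · simp only
      filter_upwards [Lp.coeFn_add v ((w : ℂ) ^ 2 • u), Lp.coeFn_smul ((w : ℂ) ^ 2) u, hu, hv]
        with x h1 h2 h3 h4
      rw [h1, Pi.add_apply, h2, Pi.smul_apply, h3, h4, smul_eq_mul]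
      simp only [partnerPotential]
      push_cast
      linear_combination (-g₂ x) * (-hσ')
    · convert B using 1
      linear_combination (g₁ 0) * hσ'
  · rintro ⟨φ, a, b, ⟨g, h, H, hu, hφ⟩, ⟨k, l, K, hφ', hv⟩, ha, hb, B⟩
    simp only at hu hφ hφ' hv
    obtain rfl : a = g 0 := ha.unique ⟨g, h, H, hu, rfl⟩
    obtain rfl : b = k 0 := hb.unique ⟨k, l, K, hφ', rfl⟩
    -- The derivative of `g` is only known almost everywhere; this choice of it is itself locally
    -- absolutely continuous, as the second order domain requires.
    have H' := H.congr_deriv (h' := fun x => (σ : ℂ) * (k x - W x * g x)) (by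
      filter_upwards [hφ, hφ'] with x h1 h2
      rw [← h2, h1]
      linear_combination (-h x) * hσ')
    refine ⟨g, _, _, H', (K.sub (S.isPrimitive.mul H')).smul (σ : ℂ), B, hu, ?_⟩
    simp only
    filter_upwards [Lp.coeFn_add v ((w : ℂ) ^ 2 • u), Lp.coeFn_smul ((w : ℂ) ^ 2) u, hu, hv]
        with x h1 h2 h3 h4
    rw [h1, Pi.add_apply, h2, Pi.smul_apply, h3, smul_eq_mul] at h4
    simp only [partnerPotential]
    push_cast at h4 ⊢
    linear_combination h4 - (k x * W x - W x ^ 2 * g x) * hσ'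

/-- With the Dirichlet condition. -/
lemma schrodinger_infty_iff {σ : ℝ} (hσ : σ * σ = 1) {u v : L2} :
    (u, v) ∈ schrodingerGraph (partnerPotential σ W dW w) ∞ ↔
      ∃ φ : L2, (u, φ) ∈ firstOrderGraph σ W ∧
        (φ, v + (w : ℂ) ^ 2 • u) ∈ firstOrderGraph (-σ) W ∧ HasTrace u 0 := by
  rw [S.schrodinger_iff hσ]
  constructor
  · rintro ⟨φ, a, b, h1, h2, h3, h4, h5⟩
    obtain rfl : a = 0 := h5
    exact ⟨φ, h1, h2, h3⟩
  · rintro ⟨φ, h1, h2, h3⟩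
    obtain ⟨b, hb⟩ := firstOrderGraph_hasTrace h2
    exact ⟨φ, 0, b, h1, h2, h3, hb, rfl⟩

/-- With the Robin condition that is the Dirichlet condition for the superpartner. -/
lemma schrodinger_robin_iff {σ : ℝ} (hσ : σ * σ = 1) {γ : ℝ} (hγ : γ = -σ * W 0) {u v : L2} :
    (u, v) ∈ schrodingerGraph (partnerPotential σ W dW w) (γ : OnePoint ℝ) ↔
      ∃ φ : L2, (u, φ) ∈ firstOrderGraph σ W ∧
        (φ, v + (w : ℂ) ^ 2 • u) ∈ firstOrderGraph (-σ) W ∧ HasTrace φ 0 := by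
  have hσ' : (σ : ℂ) * σ = 1 := by exact_mod_cast hσ
  rw [S.schrodinger_iff hσ, hγ]
  constructor
  · rintro ⟨φ, a, b, h1, h2, h3, h4, h5⟩
    change (σ : ℂ) * (b - W 0 * a) = ((-σ * W 0 : ℝ) : ℂ) * a at h5
    push_cast at h5
    obtain rfl : b = 0 := by linear_combination (σ : ℂ) * h5 - b * hσ'
    exact ⟨φ, h1, h2, h4⟩
  · rintro ⟨φ, h1, h2, h3⟩
    obtain ⟨a, ha⟩ := firstOrderGraph_hasTrace h1
    refine ⟨φ, a, 0, h1, h2, ha, h3, ?_⟩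
    change (σ : ℂ) * (0 - W 0 * a) = ((-σ * W 0 : ℝ) : ℂ) * a
    push_cast
    ring

/-- As `W` is bounded, the maximal domain of `σ d/dx + W` is that of `d/dx`. -/
lemma memLp_of_firstOrder {σ : ℝ} (hσ : σ * σ = 1) {u v : L2} {g h : ℝ → ℂ}
    (hu : u =ᵐ[halfVol] g) (hv : v =ᵐ[halfVol] fun x => (σ : ℂ) * h x + (W x : ℂ) * g x) :
    MemLp h 2 halfVol := by
  have hσ' : (σ : ℂ) * σ = 1 := by exact_mod_cast hσ
  have h1 := ((memLp_coe hv).sub (S.memLp_mul (memLp_coe hu))).const_mul (σ : ℂ)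
  refine (memLp_congr_ae (ae_of_all _ fun x => ?_)).1 h1
  simp only [Pi.sub_apply]
  linear_combination (h x) * hσ'

/-- Green's formula. -/
lemma green {σ : ℝ} (hσ : σ * σ = 1) {φ η ψ ξ : L2} {a b : ℂ}
    (hφ : (φ, η) ∈ firstOrderGraph (-σ) W) (hψ : (ψ, ξ) ∈ firstOrderGraph σ W)
    (hb : HasTrace φ b) (ha : HasTrace ψ a) :
    inner ℂ φ ξ - inner ℂ η ψ = (σ : ℂ) * (conj b * a) := by
  obtain ⟨g, h, H, e1, e2⟩ := hφ
  obtain ⟨k, l, K, e3, e4⟩ := hψ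
  simp only at e1 e2 e3 e4
  obtain rfl : b = g 0 := hb.unique ⟨g, h, H, e1, rfl⟩
  obtain rfl : a = k 0 := ha.unique ⟨k, l, K, e3, rfl⟩
  have mg := memLp_coe e1
  have mk := memLp_coe e3
  have mh := S.memLp_of_firstOrder (by rw [neg_mul_neg, hσ]) e1 e2
  have ml := S.memLp_of_firstOrder hσ e3 e4
  -- The product and its derivative are integrable, so `-∞` contributes nothing and only the
  -- boundary term at `0` survives.
  have key := (H.conj.mul K).integral_eq (integrable_conj_mul mg mk)
    ((integrable_conj_mul mh mk).add (integrable_conj_mul mg ml))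
  rw [inner_eq_integral e1 e4, inner_eq_integral e2 e3, ← integral_sub, ← key,
    ← integral_const_mul]
  · apply integral_congr_ae
    refine ae_of_all _ fun x => ?_
    simp only [map_add, map_mul, Complex.conj_ofReal, Complex.ofReal_neg, map_neg]
    ring
  · exact integrable_conj_mul mg (memLp_coe e4)
  · exact integrable_conj_mul (memLp_coe e2) mk

/-- The energy inequality. -/
lemma energy {σ : ℝ} (hσ : σ * σ = 1) {ψ ξ : L2} {a : ℂ} (hψ : (ψ, ξ) ∈ firstOrderGraph σ W)
    (ha : HasTrace ψ a) : σ / 2 * ‖a‖ ^ 2 + w * ‖ψ‖ ^ 2 ≤ (inner ℂ ψ ξ).re := by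
  obtain ⟨k, l, K, e3, e4⟩ := hψ
  simp only at e3 e4
  obtain rfl : a = k 0 := ha.unique ⟨k, l, K, e3, rfl⟩
  have mk := memLp_coe e3
  have ml := S.memLp_of_firstOrder hσ e3 e4
  have i1 := integrable_conj_mul mk ml
  have i2 := integrable_conj_mul mk mk
  have i3 := integrable_conj_mul mk (S.memLp_mul mk)
  have key := (K.conj.mul K).integral_eq i2 ((integrable_conj_mul ml mk).add i1)
  have nn : ‖ψ‖ ^ 2 = ∫ x, ‖k x‖ ^ 2 ∂halfVol := by
    have h1 : (‖ψ‖ ^ 2 : ℂ) = ∫ x, conj (k x) * k x ∂halfVol := by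
      rw [← inner_eq_integral e3 e3, inner_self_eq_norm_sq_to_K]
      rfl
    have h2 : ∀ x, conj (k x) * k x = ((‖k x‖ ^ 2 : ℝ) : ℂ) := fun x => by
      rw [mul_comm, Complex.mul_conj, Complex.normSq_eq_norm_sq]
    simp only [h2, integral_complex_ofReal] at h1
    exact_mod_cast h1
  -- The integrand is half the derivative of `|k|²`; this is the source of the boundary term, whose
  -- sign is that of `σ`.
  have kre : ∫ x, (conj (k x) * l x).re ∂halfVol = ‖k 0‖ ^ 2 / 2 := by
    have h1 := congrArg Complex.re key
    have h2 := integral_re ((integrable_conj_mul ml mk).add i1)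
    simp only [RCLike.re_to_complex, Pi.add_apply] at h2
    rw [← h2] at h1
    have h3 : ∀ x, (conj (l x) * k x + conj (k x) * l x).re = 2 * (conj (k x) * l x).re := by
      intro x
      simp [Complex.mul_re]
      ring
    simp only [h3, integral_const_mul] at h1
    rw [mul_comm (conj (k 0)), Complex.mul_conj, Complex.ofReal_re,
      Complex.normSq_eq_norm_sq] at h1
    linarith
  have hI := integral_re (integrable_conj_mul mk (memLp_coe e4))
  simp only [RCLike.re_to_complex] at hI
  rw [inner_eq_integral e3 e4, ← hI, nn]
  have h4 : ∀ x, (conj (k x) * ((σ : ℂ) * l x + (W x : ℂ) * k x)).re =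
      σ * (conj (k x) * l x).re + W x * ‖k x‖ ^ 2 := by
    intro x
    rw [← Complex.normSq_eq_norm_sq, Complex.normSq_apply]
    simp [Complex.mul_re, Complex.mul_im]
    ring
  have i4 : Integrable (fun x => W x * ‖k x‖ ^ 2) halfVol := by
    have := i3.re
    refine this.congr (ae_of_all _ fun x => ?_)
    change (conj (k x) * ((W x : ℂ) * k x)).re = W x * ‖k x‖ ^ 2
    rw [← Complex.normSq_eq_norm_sq, Complex.normSq_apply]
    simp [Complex.mul_re, Complex.mul_im]
    ring
  have i5 : Integrable (fun x => ‖k x‖ ^ 2) halfVol :=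
    (memLp_two_iff_integrable_sq_norm mk.1).1 mk
  have i1r : Integrable (fun x => (conj (k x) * l x).re) halfVol := i1.re
  simp only [h4]
  rw [integral_add (i1r.const_mul σ) i4, integral_const_mul]
  have h5 : w * ∫ x, ‖k x‖ ^ 2 ∂halfVol ≤ ∫ x, W x * ‖k x‖ ^ 2 ∂halfVol := by
    rw [← integral_const_mul]
    exact integral_mono (i5.const_mul w) i4 fun x =>
      mul_le_mul_of_nonneg_right (S.le x) (sq_nonneg _)
  rw [kre]
  linarith

/-- The lower bound for `σ d/dx + W` that follows from `w ≤ W`. -/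
lemma le_norm {σ : ℝ} (hσ : σ * σ = 1) {ψ ξ : L2} {a : ℂ} (hψ : (ψ, ξ) ∈ firstOrderGraph σ W)
    (ha : HasTrace ψ a) (h0 : a = 0 ∨ σ = 1) : w * ‖ψ‖ ≤ ‖ξ‖ := by
  have h1 := S.energy hσ hψ ha
  have h2 : (inner ℂ ψ ξ).re ≤ ‖ψ‖ * ‖ξ‖ := (Complex.re_le_norm _).trans (norm_inner_le_norm _ _)
  have h3 : 0 ≤ σ / 2 * ‖a‖ ^ 2 := by
    rcases h0 with rfl | rfl
    · simp
    · positivity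
  rcases (norm_nonneg ψ).eq_or_lt with h | h
  · rw [← h]; simp
  · have : ‖ψ‖ * (w * ‖ψ‖) ≤ ‖ψ‖ * ‖ξ‖ := by nlinarith
    exact le_of_mul_le_mul_left this h

end IsSuperPotential

end SAdS

/-! ### Solving the first order equations by means of the zero mode -/

namespace SAdS

open Filter Topology ComplexConjugate

namespace IsSuperPotential

variable {W dW E : ℝ → ℝ} {w C : ℝ} (S : IsSuperPotential W dW E w C)

include S

/-- `E exp(-w x)` has derivative `(W - w) E exp(-w x) ≥ 0`. The resulting exponential decay puts `E`
in `L²` and controls the solution formula for `d/dx + W`. -/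
lemma mode_le {t x : ℝ} (htx : t ≤ x) (hx : x ≤ 0) : E t ≤ E x * Real.exp (w * (t - x)) := by
  have hm : MonotoneOn (fun y => E y * Real.exp (-w * y)) (Iic 0) := by
    have hd : ∀ y ∈ interior (Iic (0 : ℝ)), HasDerivWithinAt (fun y => E y * Real.exp (-w * y))
        (W y * E y * Real.exp (-w * y) + E y * (Real.exp (-w * y) * (-w * 1)))
        (interior (Iic 0)) y := by
      intro y hy
      rw [interior_Iic] at hy
      exact ((S.mode_hasDerivAt y hy).mul
        (((hasDerivAt_id y).const_mul (-w)).exp)).hasDerivWithinAt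
    refine monotoneOn_of_hasDerivWithinAt_nonneg (convex_Iic 0) ?_ hd fun y _ => ?_
    · have := S.mode_continuous
      fun_prop
    · have h1 := S.le y
      have h2 := S.mode_pos y
      have h3 := Real.exp_pos (-w * y)
      have : W y * E y * Real.exp (-w * y) + E y * (Real.exp (-w * y) * (-w * 1)) =
          (W y - w) * (E y * Real.exp (-w * y)) := by ring
      rw [this]
      exact mul_nonneg (by linarith) (by positivity)
  have h1 := hm (htx.trans hx) hx htx
  have h2 : E t = E t * Real.exp (-w * t) * Real.exp (w * t) := by
    rw [mul_assoc, ← Real.exp_add]; simp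
  rw [h2]
  calc E t * Real.exp (-w * t) * Real.exp (w * t)
      ≤ E x * Real.exp (-w * x) * Real.exp (w * t) :=
        mul_le_mul_of_nonneg_right h1 (Real.exp_pos _).le
    _ = _ := by rw [mul_assoc, ← Real.exp_add]; ring_nf

lemma isPrimitive_mode : IsPrimitive (fun x => (E x : ℂ)) (fun x => (W x : ℂ) * E x) := by
  refine IsPrimitive.of_hasDerivAt (Complex.continuous_ofReal.comp S.mode_continuous).continuousOn
    (fun x hx => ?_) ?_
  · rw [← Complex.ofReal_mul]
    exact (S.mode_hasDerivAt x hx).ofReal_comp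
  · exact ((Complex.continuous_ofReal.comp S.continuous).mul
      (Complex.continuous_ofReal.comp S.mode_continuous)).continuousOn

lemma continuous_mode_inv : Continuous fun x => (E x : ℂ)⁻¹ :=
  (Complex.continuous_ofReal.comp S.mode_continuous).inv₀ fun x => by
    simpa using (S.mode_pos x).ne'

lemma isPrimitive_mode_inv :
    IsPrimitive (fun x => ((E x)⁻¹ : ℂ)) (fun x => -(W x : ℂ) * (E x : ℂ)⁻¹) := by
  have hE : Continuous fun x => (E x : ℂ)⁻¹ := S.continuous_mode_inv
  refine IsPrimitive.of_hasDerivAt ?_ (fun x hx => ?_) ?_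
  · exact hE.continuousOn
  · have h1 := ((S.mode_hasDerivAt x hx).inv (S.mode_pos x).ne').ofReal_comp
    have h2 := (S.mode_pos x).ne'
    convert h1 using 1
    · ext y; simp
    · push_cast
      have : (E x : ℂ) ≠ 0 := by exact_mod_cast h2
      field_simp
  · exact ((Complex.continuous_ofReal.comp S.continuous).neg.mul hE).continuousOn

lemma memLp_mode : MemLp (fun x => (E x : ℂ)) 2 halfVol := by
  have h1 : AEStronglyMeasurable (fun x => (E x : ℂ)) halfVol :=
    (Complex.continuous_ofReal.comp S.mode_continuous).aestronglyMeasurable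
  rw [memLp_two_iff_integrable_sq_norm h1]
  have h2 : Integrable (fun x => E 0 ^ 2 * Real.exp (2 * w * x)) halfVol :=
    (integrable_halfVol_iff.2
      (integrableOn_exp_mul_Iic (by linarith [S.w_pos]) 0)).const_mul _
  refine h2.mono' (h1.norm.pow 2) ?_
  filter_upwards [ae_restrict_mem measurableSet_Iio] with x hx
  have h3 := S.mode_le (le_of_lt hx) le_rfl
  have h4 := S.mode_pos x
  rw [sub_zero] at h3
  rw [Real.norm_of_nonneg (sq_nonneg _), Complex.norm_real, Real.norm_of_nonneg h4.le]
  calc E x ^ 2 ≤ (E 0 * Real.exp (w * x)) ^ 2 := pow_le_pow_left₀ h4.le h3 2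
    _ = _ := by
      rw [mul_pow, ← Real.exp_nat_mul]
      congr 2
      push_cast
      ring

/-- A priori estimate for `σ g' + W g = η`: since `-σ (|g|²)' = 2 W |g|² - 2 Re (conj g · η) ≥ w
|g|² - w⁻¹ |η|²`, integrating over `[x, 0]` bounds `∫ |g|²` as soon as `σ (|g(x)|² - |g(0)|²)` is
bounded above. For `σ = -1` and `g(0) = 0` that bound is free; for `σ = 1` it requires `g` to be
bounded. -/
lemma memLp_of_isPrimitive {σ : ℝ} (hσ : σ * σ = 1) {g η : ℝ → ℂ} (hη : MemLp η 2 halfVol)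
    (H : IsPrimitive g fun x => (σ : ℂ) * (η x - (W x : ℂ) * g x)) {K : ℝ}
    (hK : ∀ x ≤ (0 : ℝ), σ * (‖g x‖ ^ 2 - ‖g 0‖ ^ 2) ≤ K) : MemLp g 2 halfVol := by
  have hw := S.w_pos
  have hη2 : Integrable (fun x => ‖η x‖ ^ 2) halfVol :=
    (memLp_two_iff_integrable_sq_norm hη.1).1 hη
  have hsq : ∀ x ≤ (0 : ℝ), IntervalIntegrable (fun t => ‖g t‖ ^ 2) volume x 0 := by
    intro x hx
    apply ContinuousOn.intervalIntegrable
    rw [uIcc_of_le hx]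
    exact (H.continuousOn x hx).norm.pow 2
  refine memLp_of_intervalIntegral_bounded H.aestronglyMeasurable hsq
    (w⁻¹ * (K + w⁻¹ * ∫ x, ‖η x‖ ^ 2 ∂halfVol)) fun x hx => ?_
  obtain ⟨i1, e1⟩ := H.normSq x hx
  have iη := intervalIntegrable_of_integrable hη2 hx
  have pt : ∀ t, w * ‖g t‖ ^ 2 - w⁻¹ * ‖η t‖ ^ 2 ≤
      -σ * (2 * (conj (g t) * ((σ : ℂ) * (η t - (W t : ℂ) * g t))).re) := by
    intro t
    have h1 : -σ * (2 * (conj (g t) * ((σ : ℂ) * (η t - (W t : ℂ) * g t))).re) =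
        2 * W t * ‖g t‖ ^ 2 - 2 * (conj (g t) * η t).re := by
      rw [← Complex.normSq_eq_norm_sq, Complex.normSq_apply]
      simp only [Complex.mul_re, Complex.mul_im, Complex.sub_re, Complex.sub_im, Complex.conj_re,
        Complex.conj_im, Complex.ofReal_re, Complex.ofReal_im]
      linear_combination (-2 * ((g t).re * (η t).re + (g t).im * (η t).im -
        W t * ((g t).re * (g t).re + (g t).im * (g t).im))) * hσ
    have h2 : (conj (g t) * η t).re ≤ ‖g t‖ * ‖η t‖ := by
      refine (Complex.re_le_norm _).trans ?_
      rw [norm_mul, Complex.norm_conj]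
    have h3 : 2 * (‖g t‖ * ‖η t‖) ≤ w * ‖g t‖ ^ 2 + w⁻¹ * ‖η t‖ ^ 2 := by
      have : w * ‖g t‖ ^ 2 + w⁻¹ * ‖η t‖ ^ 2 - 2 * (‖g t‖ * ‖η t‖) =
          w⁻¹ * (w * ‖g t‖ - ‖η t‖) ^ 2 := by
        field_simp
        ring
      have h4 : 0 ≤ w⁻¹ * (w * ‖g t‖ - ‖η t‖) ^ 2 := by positivity
      linarith
    have h4 : w * ‖g t‖ ^ 2 ≤ W t * ‖g t‖ ^ 2 :=
      mul_le_mul_of_nonneg_right (S.le t) (sq_nonneg _)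
    rw [h1]
    linarith
  have h1 := intervalIntegral.integral_mono_on hx (((hsq x hx).const_mul w).sub (iη.const_mul w⁻¹))
    (i1.const_mul (-σ)) fun t _ => pt t
  rw [intervalIntegral.integral_sub ((hsq x hx).const_mul w) (iη.const_mul w⁻¹),
    intervalIntegral.integral_const_mul, intervalIntegral.integral_const_mul,
    intervalIntegral.integral_const_mul] at h1
  have h2 : ∫ t in x..0, ‖η t‖ ^ 2 ≤ ∫ x, ‖η x‖ ^ 2 ∂halfVol := by
    rw [intervalIntegral.integral_of_le hx, integral_Ioc_eq_integral_Ioo]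
    exact setIntegral_mono_set hη2 (ae_of_all _ fun t => sq_nonneg _)
      (LE.le.eventuallyLE fun t ht => ht.2)
  have h3 := hK x hx
  have h4 : w⁻¹ * ∫ t in x..0, ‖η t‖ ^ 2 ≤ w⁻¹ * ∫ x, ‖η x‖ ^ 2 ∂halfVol :=
    mul_le_mul_of_nonneg_left h2 (by positivity)
  have h5 : w * ∫ t in x..0, ‖g t‖ ^ 2 ≤ K + w⁻¹ * ∫ x, ‖η x‖ ^ 2 ∂halfVol := by
    rw [e1] at h3
    linarith
  rw [le_inv_mul_iff₀ hw]
  exact h5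

/-- `-d/dx + W` with the Dirichlet condition is onto. -/
lemma exists_dirichlet (φ : L2) : ∃ u : L2, (u, φ) ∈ firstOrderGraph (-1) W ∧ HasTrace u 0 := by
  have hφ : MemLp φ 2 halfVol := Lp.memLp φ
  have hE : Continuous fun x => (E x : ℂ)⁻¹ := S.continuous_mode_inv
  have hI : ∀ x ≤ (0 : ℝ), IntervalIntegrable (fun t => (E t : ℂ)⁻¹ * φ t) volume x 0 :=
    fun x hx => (intervalIntegrable_of_memLp hφ hx).continuousOn_mul hE.continuousOn
  have H := ((S.isPrimitive_mode.mul (isPrimitive_integral hI)).smul (-1)).congr_deriv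
    (h' := fun x => ((-1 : ℝ) : ℂ) * (φ x - (W x : ℂ) *
      (-1 * ((E x : ℂ) * -∫ t in x..0, (E t : ℂ)⁻¹ * φ t))))
    (ae_of_all _ fun x => by
      have : (E x : ℂ) ≠ 0 := by simpa using (S.mode_pos x).ne'
      push_cast
      field_simp
      ring)
  -- Variation of constants with base point `0`, which gives the Dirichlet condition.
  set g : ℝ → ℂ := fun x => -1 * ((E x : ℂ) * -∫ t in x..0, (E t : ℂ)⁻¹ * φ t) with hg
  have g0 : g 0 = 0 := by simp [hg]
  have mg := S.memLp_of_isPrimitive (by norm_num) hφ H (K := 0) fun x _ => by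
    rw [g0]
    simp
  refine ⟨mg.toLp g, ⟨g, _, H, mg.coeFn_toLp, ae_of_all _ fun x => ?_⟩,
    ⟨g, _, H, mg.coeFn_toLp, g0⟩⟩
  push_cast
  ring

/-- `d/dx + W` is onto. -/
lemma exists_preimage (η : L2) : ∃ φ : L2, (φ, η) ∈ firstOrderGraph 1 W := by
  have hw := S.w_pos
  have hη : MemLp η 2 halfVol := Lp.memLp η
  have hη2 : Integrable (fun x => ‖η x‖ ^ 2) halfVol :=
    (memLp_two_iff_integrable_sq_norm hη.1).1 hη
  have hI : Integrable (fun t => (E t : ℂ) * η t) halfVol := by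
    have := integrable_conj_mul S.memLp_mode hη
    simpa using this
  set c : ℂ := ∫ t, (E t : ℂ) * η t ∂halfVol with hc
  have H := (S.isPrimitive_mode_inv.mul ((isPrimitive_const c).add (isPrimitive_integral
    fun x hx => intervalIntegrable_of_integrable hI hx))).congr_deriv
    (h' := fun x => ((1 : ℝ) : ℂ) * (η x - (W x : ℂ) *
      ((E x : ℂ)⁻¹ * (c + -∫ t in x..0, (E t : ℂ) * η t))))
    (ae_of_all _ fun x => by
      have : (E x : ℂ) ≠ 0 := by simpa using (S.mode_pos x).ne'
      push_cast
      field_simp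
      ring)
  -- `E⁻¹` grows at `-∞`, so the constant `c` moves the base point there: `g = E⁻¹ ∫_{-∞}^x E η`.
  set g : ℝ → ℂ := fun x => (E x : ℂ)⁻¹ * (c + -∫ t in x..0, (E t : ℂ) * η t) with hg
  set B : ℝ := 2⁻¹ * ((2 * w)⁻¹ + ∫ x, ‖η x‖ ^ 2 ∂halfVol) with hB
  have hI' := integrable_halfVol_iff.1 hI
  have hη2' := integrable_halfVol_iff.1 hη2
  have bd : ∀ x ≤ (0 : ℝ), ‖g x‖ ≤ B := by
    intro x hx
    have e1 : c + -∫ t in x..0, (E t : ℂ) * η t = ∫ t in Iic x, (E t : ℂ) * η t := by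
      rw [hc, integral_halfVol_eq, ← intervalIntegral.integral_Iic_sub_Iic
        (hI'.mono_set (Iic_subset_Iic.2 hx)) hI']
      ring
    have hexp := integrableOn_exp_mul_Iic (a := 2 * w) (by linarith) x
    have e2 : ‖∫ t in Iic x, (E t : ℂ) * η t‖ ≤
        ∫ t in Iic x, E x * 2⁻¹ * (Real.exp (-(2 * w * x)) * Real.exp (2 * w * t) +
          ‖η t‖ ^ 2) := by
      refine norm_integral_le_of_norm_le
        (((hexp.const_mul _).add (hη2'.mono_set (Iic_subset_Iic.2 hx))).const_mul _) ?_
      filter_upwards [ae_restrict_mem measurableSet_Iic] with t ht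
      have h1 := S.mode_le ht hx
      have h2 := S.mode_pos t
      have h3 := S.mode_pos x
      rw [norm_mul, Complex.norm_real, Real.norm_of_nonneg h2.le, ← Real.exp_add]
      have h4 : Real.exp (-(2 * w * x) + 2 * w * t) = Real.exp (w * (t - x)) ^ 2 := by
        rw [← Real.exp_nat_mul]
        congr 1
        push_cast
        ring
      rw [h4]
      have h5 : E t * ‖η t‖ ≤ E x * Real.exp (w * (t - x)) * ‖η t‖ :=
        mul_le_mul_of_nonneg_right h1 (norm_nonneg _)
      -- With `mode_le`, `E(t) |η(t)| ≤ E(x)/2 · (exp(2w(t-x)) + |η(t)|²)`; integrating over `t ≤ x`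
      -- produces the constant `B`.
      have h6 := two_mul_le_add_sq (Real.exp (w * (t - x))) ‖η t‖
      nlinarith
    have e3 : ∫ t in Iic x, E x * 2⁻¹ * (Real.exp (-(2 * w * x)) * Real.exp (2 * w * t) +
          ‖η t‖ ^ 2) ≤ E x * B := by
      rw [integral_const_mul, integral_add (hexp.const_mul _)
        (hη2'.mono_set (Iic_subset_Iic.2 hx)), integral_const_mul,
        integral_exp_mul_Iic (by linarith), ← mul_div_assoc, ← Real.exp_add, neg_add_cancel,
        Real.exp_zero, one_div, hB, mul_assoc]
      refine mul_le_mul_of_nonneg_left ?_ (S.mode_pos x).le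
      refine mul_le_mul_of_nonneg_left ?_ (by norm_num)
      refine add_le_add le_rfl ?_
      rw [← integral_Iic_eq_integral_Iio]
      exact setIntegral_mono_set hη2' (ae_of_all _ fun t => sq_nonneg _)
        (LE.le.eventuallyLE (Iic_subset_Iic.2 hx))
    have hpos := S.mode_pos x
    simp only [hg]
    rw [e1, norm_mul, norm_inv, Complex.norm_real, Real.norm_of_nonneg hpos.le,
      inv_mul_le_iff₀ hpos]
    exact e2.trans e3
  have mg := S.memLp_of_isPrimitive (by norm_num) hη H (K := B ^ 2) fun x hx => by
    have h1 := pow_le_pow_left₀ (norm_nonneg _) (bd x hx) 2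
    have h2 : 0 ≤ ‖g 0‖ ^ 2 := sq_nonneg _
    linarith
  refine ⟨mg.toLp g, ⟨g, _, H, mg.coeFn_toLp, ae_of_all _ fun x => ?_⟩⟩
  push_cast
  ring

/-- The zero mode of `-d/dx + W` as an element of `L²`. -/
lemma exists_mode : ∃ X : L2, X ≠ 0 ∧ (X =ᵐ[halfVol] fun x => (E x : ℂ)) ∧
    (X, (0 : L2)) ∈ firstOrderGraph (-1) W ∧ HasTrace X (E 0) := by
  have m := S.memLp_mode
  have hT : HasTrace (m.toLp _) (E 0) := ⟨_, _, S.isPrimitive_mode, m.coeFn_toLp, rfl⟩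
  refine ⟨m.toLp _, ?_, m.coeFn_toLp, ⟨_, _, S.isPrimitive_mode, m.coeFn_toLp, ?_⟩, hT⟩
  · intro h0
    have h1 : HasTrace (0 : L2) 0 := ⟨_, _, IsPrimitive.zero, Lp.coeFn_zero _ _ _, rfl⟩
    rw [h0] at hT
    have := hT.unique h1
    exact (S.mode_pos 0).ne' (by exact_mod_cast this)
  · filter_upwards [Lp.coeFn_zero ℂ 2 halfVol] with x hx
    rw [hx]
    push_cast
    simp

/-- The kernel of `-d/dx + W` is spanned by the zero mode. -/
lemma eq_smul_mode {X u : L2} (hX : (X, (0 : L2)) ∈ firstOrderGraph (-1) W)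
    (hX0 : HasTrace X (E 0)) (hu : (u, (0 : L2)) ∈ firstOrderGraph (-1) W) :
    ∃ c : ℂ, u = c • X := by
  obtain ⟨a, ha⟩ := firstOrderGraph_hasTrace hu
  have hE : (E 0 : ℂ) ≠ 0 := by simpa using (S.mode_pos 0).ne'
  refine ⟨a / E 0, ?_⟩
  have h1 := firstOrderGraph_add hu (firstOrderGraph_smul (-(a / E 0)) hX)
  have h2 := ha.add (hX0.smul (-(a / E 0)))
  have h3 := S.le_norm (by norm_num) h1 h2 (Or.inl (by field_simp; ring))
  rw [smul_zero, add_zero, norm_zero] at h3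
  have h4 : ‖u + -(a / (E 0 : ℂ)) • X‖ = 0 :=
    le_antisymm (by nlinarith [S.w_pos, norm_nonneg (u + -(a / (E 0 : ℂ)) • X)]) (norm_nonneg _)
  rw [norm_eq_zero, neg_smul, ← sub_eq_add_neg] at h4
  exact sub_eq_zero.1 h4

lemma eq_zero_of_firstOrder {σ : ℝ} (hσ : σ * σ = 1) {u : L2} {a : ℂ}
    (hu : (u, (0 : L2)) ∈ firstOrderGraph σ W) (ha : HasTrace u a) (h0 : a = 0 ∨ σ = 1) :
    u = 0 := by
  have h3 := S.le_norm hσ hu ha h0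
  rw [norm_zero] at h3
  exact norm_eq_zero.1 (le_antisymm (by nlinarith [S.w_pos, norm_nonneg u]) (norm_nonneg _))

end IsSuperPotential

end SAdS

/-! ### Nonnegativity of the spectra -/

namespace SAdS

open Filter Topology ComplexConjugate

/-- A nonnegative operator `A` such that `A + c` is onto for some `c > 0` has nonnegative
spectrum. -/
lemma hasNonnegSpectrum_of_graph {F : Type*} [NormedAddCommGroup F] [InnerProductSpace ℂ F]
    [CompleteSpace F] (A : F →ₗ.[ℂ] F) {c : ℝ} (hc : 0 < c)
    (hpos : ∀ u v : F, (u, v) ∈ A.graph → ∃ r : ℝ, 0 ≤ r ∧ inner ℂ u v = (r : ℂ))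
    (hsurj : ∀ v : F, ∃ u : F, (u, v - (c : ℂ) • u) ∈ A.graph) : HasNonnegSpectrum A := by
  -- Here `v = (A + c) u`. The bound makes `R = (A + c)⁻¹` a well defined bounded operator; it is
  -- positive with norm at most `c⁻¹`, so its spectrum lies in `[0, c⁻¹]`.
  have hle : ∀ u v : F, (u, v - (c : ℂ) • u) ∈ A.graph → ‖u‖ ≤ c⁻¹ * ‖v‖ := by
    intro u v h
    obtain ⟨r, hr, e⟩ := hpos _ _ h
    rw [inner_sub_right, inner_smul_right, inner_self_eq_norm_sq_to_K] at e
    have e1 : inner ℂ u v = ((r + c * ‖u‖ ^ 2 : ℝ) : ℂ) := by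
      push_cast
      linear_combination e
    have h1 : r + c * ‖u‖ ^ 2 ≤ ‖u‖ * ‖v‖ := by
      have h2 := norm_inner_le_norm (𝕜 := ℂ) u v
      rw [e1, Complex.norm_real] at h2
      exact (le_abs_self _).trans h2
    rw [le_inv_mul_iff₀ hc]
    rcases (norm_nonneg u).eq_or_lt with h0 | h0
    · rw [← h0]; simp
    · have : ‖u‖ * (c * ‖u‖) ≤ ‖u‖ * ‖v‖ := by nlinarith
      exact le_of_mul_le_mul_left this h0
  have huniq : ∀ u u' v : F, (u, v - (c : ℂ) • u) ∈ A.graph → (u', v - (c : ℂ) • u') ∈ A.graph →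
      u = u' := by
    intro u u' v h h'
    have h1 := A.graph.sub_mem h h'
    have h2 := hle (u - u') 0 (by
      convert h1 using 1
      rw [Prod.mk_sub_mk, smul_sub]
      congr 1
      abel)
    rw [norm_zero, mul_zero] at h2
    exact sub_eq_zero.1 (norm_le_zero_iff.1 h2)
  choose R₀ hR₀ using hsurj
  let R₁ : F →ₗ[ℂ] F :=
    { toFun := R₀
      map_add' := fun v v' => huniq _ _ (v + v') (hR₀ _) (by
        convert A.graph.add_mem (hR₀ v) (hR₀ v') using 1
        rw [Prod.mk_add_mk, smul_add]
        congr 1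
        abel)
      map_smul' := fun a v => huniq _ _ (a • v) (hR₀ _) (by
        convert A.graph.smul_mem a (hR₀ v) using 1
        rw [RingHom.id_apply, Prod.smul_mk, smul_sub, smul_comm]) }
  let R : F →L[ℂ] F := R₁.mkContinuous c⁻¹ fun v => hle _ _ (hR₀ v)
  have hR : ∀ v, (R v, v - (c : ℂ) • R v) ∈ A.graph := hR₀
  have hnorm : ‖R‖ ≤ c⁻¹ := LinearMap.mkContinuous_norm_le _ (by positivity) _
  have hRpos : R.IsPositive := by
    rw [ContinuousLinearMap.isPositive_iff_complex]
    intro v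
    obtain ⟨r, hr, e⟩ := hpos _ _ (hR v)
    rw [inner_sub_right, inner_smul_right, inner_self_eq_norm_sq_to_K] at e
    have e1 : inner ℂ (R v) v = ((r + c * ‖R v‖ ^ 2 : ℝ) : ℂ) := by
      push_cast
      linear_combination e
    rw [e1]
    refine ⟨by rw [RCLike.re_to_complex, Complex.ofReal_re], ?_⟩
    rw [RCLike.re_to_complex, Complex.ofReal_re]
    positivity
  have hspec : ∀ ζ ∈ _root_.spectrum ℂ R, 0 ≤ ζ.re ∧ ζ.im = 0 ∧ ‖ζ‖ ≤ c⁻¹ := by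
    intro ζ hζ
    have hR0 : 0 ≤ R := (ContinuousLinearMap.nonneg_iff_isPositive R).2 hRpos
    have hsa : IsSelfAdjoint R := IsSelfAdjoint.of_nonneg hR0
    have e := hsa.mem_spectrum_eq_re hζ
    have h1 : ζ.re ∈ _root_.spectrum ℝ R := by
      rw [← spectrum.algebraMap_mem_iff ℂ]
      rw [e] at hζ
      exact hζ
    refine ⟨spectrum_nonneg_of_nonneg hR0 h1, by rw [e]; simp, ?_⟩
    refine (spectrum.norm_le_norm_mul_of_mem hζ).trans ?_
    have : ‖(1 : F →L[ℂ] F)‖ ≤ 1 := ContinuousLinearMap.norm_id_le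
    nlinarith [norm_nonneg R]
  intro z hz
  by_contra hneg
  apply hz
  -- `A - z = (1 - ζ R)(A + c)`, so `R (1 - ζ R)⁻¹` is the resolvent at `z` unless `ζ⁻¹` lies in the
  -- spectrum of `R`; in that case `ζ` is real and at least `c`, that is, `z ≥ 0`.
  set ζ : ℂ := z + c with hζ
  have hunit : IsUnit (1 - ζ • R) := by
    rcases eq_or_ne ζ 0 with h0 | h0
    · rw [h0]; simp
    · have h1 : ζ⁻¹ ∉ _root_.spectrum ℂ R := by
        intro hmem
        obtain ⟨a1, a2, a3⟩ := hspec _ hmem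
        have e : ζ⁻¹ = ((ζ⁻¹).re : ℂ) := Complex.ext (by simp) (by simp [a2])
        set t : ℝ := (ζ⁻¹).re with ht
        have e' : ζ = ((t⁻¹ : ℝ) : ℂ) := by rw [Complex.ofReal_inv, ← e, inv_inv]
        have t0 : t ≠ 0 := by
          intro h
          rw [h] at e'
          simp at e'
          exact h0 e'
        have tpos : 0 < t := lt_of_le_of_ne a1 t0.symm
        rw [e, Complex.norm_real, Real.norm_of_nonneg a1] at a3
        have h2 : c ≤ t⁻¹ := (le_inv_comm₀ tpos hc).1 a3
        have hz' : z = ((t⁻¹ - c : ℝ) : ℂ) := by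
          push_cast at e' ⊢
          rw [← e', hζ]
          ring
        apply hneg
        rw [hz']
        simp only [Complex.ofReal_re, Complex.ofReal_im, and_true]
        linarith
      rw [spectrum.notMem_iff, Algebra.algebraMap_eq_smul_one] at h1
      have h2 : (1 : F →L[ℂ] F) - ζ • R = ζ • (ζ⁻¹ • (1 : F →L[ℂ] F) - R) := by
        rw [smul_sub, smul_smul, mul_inv_cancel₀ h0, one_smul]
      rw [h2]
      exact (isUnit_smul_iff (Units.mk0 ζ h0) _).2 h1
  obtain ⟨Q, hQ⟩ := hunit
  have q1 : ∀ v, (Q⁻¹ : (F →L[ℂ] F)ˣ).1 v - ζ • R ((Q⁻¹ : (F →L[ℂ] F)ˣ).1 v) = v := by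
    intro v
    have := congrArg (fun T : F →L[ℂ] F => T v) Q.mul_inv
    rw [hQ] at this
    simpa using this
  have q2 : ∀ v, (Q⁻¹ : (F →L[ℂ] F)ˣ).1 (v - ζ • R v) = v := by
    intro v
    have := congrArg (fun T : F →L[ℂ] F => T v) Q.inv_mul
    rw [hQ] at this
    simpa using this
  refine ⟨R * (Q⁻¹ : (F →L[ℂ] F)ˣ).1, fun v => ?_, fun u => ?_⟩
  · obtain ⟨h, e⟩ := mem_graph_iff_apply.1 (hR ((Q⁻¹ : (F →L[ℂ] F)ˣ).1 v))
    refine ⟨h, ?_⟩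
    change A ⟨R ((Q⁻¹ : (F →L[ℂ] F)ˣ).1 v), h⟩ - z • R ((Q⁻¹ : (F →L[ℂ] F)ˣ).1 v) = v
    rw [e]
    refine Eq.trans ?_ (q1 v)
    rw [hζ, add_smul]
    abel
  · set y : F := A u + (c : ℂ) • (u : F) with hy
    have e1 : R y = u := huniq _ _ y (hR y) (by
      rw [hy, add_sub_cancel_right]
      exact A.mem_graph u)
    have e2 : A u - z • (u : F) = y - ζ • R y := by
      rw [e1, hy, hζ, add_smul]
      abel
    rw [e2]
    change R ((Q⁻¹ : (F →L[ℂ] F)ˣ).1 (y - ζ • R y)) = u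
    rw [q2, e1]

namespace IsSuperPotential

variable {W dW E : ℝ → ℝ} {w C : ℝ} (S : IsSuperPotential W dW E w C)

include S

/-- Green's formula without boundary term reads `⟨u, v⟩ = ‖φ‖² - w² ‖u‖²`, which `le_norm` makes
nonnegative. The hypothesis `h0` excludes the Robin condition for `σ = -1`, where the zero mode
gives the value `-w² ‖u‖²`. -/
lemma nonneg_form {σ : ℝ} (hσ : σ * σ = 1) {u v φ : L2} {a b : ℂ}
    (h1 : (u, φ) ∈ firstOrderGraph σ W)
    (h2 : (φ, v + (w : ℂ) ^ 2 • u) ∈ firstOrderGraph (-σ) W) (ha : HasTrace u a)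
    (hb : HasTrace φ b) (hab : a = 0 ∨ b = 0) (h0 : a = 0 ∨ σ = 1) :
    ∃ r : ℝ, 0 ≤ r ∧ inner ℂ u v = (r : ℂ) := by
  have hg := S.green (σ := -σ) (by rw [neg_mul_neg, hσ]) (φ := u) (η := φ) (ψ := φ)
    (by rwa [neg_neg]) h2 ha hb
  have h3 : conj a * b = 0 := by
    rcases hab with rfl | rfl <;> simp
  rw [h3, mul_zero, sub_eq_zero, inner_add_right, inner_smul_right, inner_self_eq_norm_sq_to_K,
    inner_self_eq_norm_sq_to_K] at hg
  refine ⟨‖φ‖ ^ 2 - w ^ 2 * ‖u‖ ^ 2, ?_, ?_⟩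
  · have h4 := S.le_norm hσ h1 ha h0
    have h5 := pow_le_pow_left₀ (mul_nonneg S.w_pos.le (norm_nonneg u)) h4 2
    rw [mul_pow] at h5
    linarith
  · push_cast
    linear_combination hg

lemma hasNonnegSpectrum_dirichlet_neg :
    HasNonnegSpectrum (schrodingerOp (partnerPotential (-1) W dW w) ∞) := by
  have hw := S.w_pos
  refine hasNonnegSpectrum_of_graph _ (c := w ^ 2) (by positivity) ?_ ?_
  · intro u v h
    rw [schrodingerOp_graph, S.schrodinger_infty_iff (by norm_num)] at h
    obtain ⟨φ, h1, h2, h3⟩ := h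
    obtain ⟨b, hb⟩ := firstOrderGraph_hasTrace h2
    exact S.nonneg_form (by norm_num) h1 h2 h3 hb (Or.inl rfl) (Or.inl rfl)
  · intro v
    obtain ⟨φ, hφ⟩ := S.exists_preimage v
    obtain ⟨u, hu, hu0⟩ := S.exists_dirichlet φ
    refine ⟨u, ?_⟩
    rw [schrodingerOp_graph, S.schrodinger_infty_iff (by norm_num)]
    refine ⟨φ, hu, ?_, hu0⟩
    push_cast
    simpa using hφ

lemma hasNonnegSpectrum_robin_pos {γ : ℝ} (hγ : γ = -W 0) :
    HasNonnegSpectrum (schrodingerOp (partnerPotential 1 W dW w) (γ : OnePoint ℝ)) := by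
  have hw := S.w_pos
  have hγ' : γ = -1 * W 0 := by rw [hγ]; ring
  refine hasNonnegSpectrum_of_graph _ (c := w ^ 2) (by positivity) ?_ ?_
  · intro u v h
    rw [schrodingerOp_graph, S.schrodinger_robin_iff (by norm_num) hγ'] at h
    obtain ⟨φ, h1, h2, h3⟩ := h
    obtain ⟨a, ha⟩ := firstOrderGraph_hasTrace h1
    exact S.nonneg_form (by norm_num) h1 h2 ha h3 (Or.inr rfl) (Or.inr rfl)
  · intro v
    obtain ⟨φ, hφ, hφ0⟩ := S.exists_dirichlet v
    obtain ⟨u, hu⟩ := S.exists_preimage φ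
    refine ⟨u, ?_⟩
    rw [schrodingerOp_graph, S.schrodinger_robin_iff (by norm_num) hγ']
    refine ⟨φ, hu, ?_, hφ0⟩
    push_cast
    simpa using hφ

lemma hasNonnegSpectrum_dirichlet_pos :
    HasNonnegSpectrum (schrodingerOp (partnerPotential 1 W dW w) ∞) := by
  have hw := S.w_pos
  refine hasNonnegSpectrum_of_graph _ (c := w ^ 2) (by positivity) ?_ ?_
  · intro u v h
    rw [schrodingerOp_graph, S.schrodinger_infty_iff (by norm_num)] at h
    obtain ⟨φ, h1, h2, h3⟩ := h
    obtain ⟨b, hb⟩ := firstOrderGraph_hasTrace h2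
    exact S.nonneg_form (by norm_num) h1 h2 h3 hb (Or.inl rfl) (Or.inl rfl)
  · intro v
    obtain ⟨X, X0, -, hX, hXt⟩ := S.exists_mode
    -- A preimage `u` of `v` under `D^- D^+` need not vanish at `0`. As `D^- D^+ Y = D^- X = 0`, a
    -- multiple of `Y` can be added to correct the trace.
    obtain ⟨Y, hY⟩ := S.exists_preimage X
    obtain ⟨y, hy⟩ := firstOrderGraph_hasTrace hY
    -- If `Y` vanished at `0`, Green's formula would give `‖X‖² = ⟨D^+ Y, X⟩ = ⟨Y, D^- X⟩ = 0`.
    have hy0 : y ≠ 0 := by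
      rintro rfl
      have := S.green (σ := -1) (by norm_num) (φ := Y) (η := X) (ψ := X) (by rwa [neg_neg]) hX hy hXt
      simp at this
      exact X0 this
    obtain ⟨φ, hφ, -⟩ := S.exists_dirichlet v
    obtain ⟨u, hu⟩ := S.exists_preimage φ
    obtain ⟨a, ha⟩ := firstOrderGraph_hasTrace hu
    refine ⟨u + (-(a / y)) • Y, ?_⟩
    rw [schrodingerOp_graph, S.schrodinger_infty_iff (by norm_num)]
    refine ⟨φ + (-(a / y)) • X, firstOrderGraph_add hu (firstOrderGraph_smul _ hY), ?_, ?_⟩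
    · have := firstOrderGraph_add hφ (firstOrderGraph_smul (-(a / y)) hX)
      push_cast
      simpa using this
    · convert ha.add (hy.smul (-(a / y))) using 1
      field_simp
      ring

end IsSuperPotential

end SAdS

/-! ### Intertwining of operator domains and of smooth domains -/

namespace SAdS

open Filter Topology ComplexConjugate

section Abstract

variable {F : Type*} [NormedAddCommGroup F] [NormedSpace ℂ F]

lemma mem_powDomain_succ {A : F →ₗ.[ℂ] F} {n : ℕ} {u : F} :
    u ∈ powDomain A (n + 1) ↔ ∃ v, (u, v) ∈ A.graph ∧ v ∈ powDomain A n := by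
  constructor
  · rintro ⟨h, hv⟩
    exact ⟨_, mem_graph_iff_apply.2 ⟨h, rfl⟩, hv⟩
  · rintro ⟨v, h, hv⟩
    obtain ⟨hd, rfl⟩ := mem_graph_iff_apply.1 h
    exact ⟨hd, hv⟩

lemma add_smul_mem_powDomain {A : F →ₗ.[ℂ] F} {n : ℕ} : ∀ {u v : F} (c : ℂ),
    u ∈ powDomain A n → v ∈ powDomain A n → u + c • v ∈ powDomain A n := by
  induction n with
  | zero => intros; trivial
  | succ n ih =>
    intro u v c hu hv
    rw [mem_powDomain_succ] at hu hv ⊢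
    obtain ⟨u', h1, h2⟩ := hu
    obtain ⟨v', h3, h4⟩ := hv
    exact ⟨u' + c • v', A.graph.add_mem h1 (A.graph.smul_mem c h3), ih c h2 h4⟩

lemma exists_graph_of_mem_smoothDomain {A : F →ₗ.[ℂ] F} {u : F} (hu : u ∈ smoothDomain A) :
    ∃ v, (u, v) ∈ A.graph := by
  obtain ⟨v, h, -⟩ := mem_powDomain_succ.1 (mem_iInter.1 hu 1)
  exact ⟨v, h⟩

lemma smoothDomain_subset (A : F →ₗ.[ℂ] F) : smoothDomain A ⊆ A.domain := by
  intro u hu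
  obtain ⟨v, h⟩ := exists_graph_of_mem_smoothDomain hu
  exact (mem_graph_iff_apply.1 h).1

lemma MapsTo.mono {T : F →ₗ.[ℂ] F} {S S' S'' : Set F} (h : MapsTo T S S') (h' : S' ⊆ S'') :
    MapsTo T S S'' := fun u hu => by
  obtain ⟨h1, h2⟩ := h u hu
  exact ⟨h1, h' h2⟩

lemma InjOn.mono {T : F →ₗ.[ℂ] F} {S S' : Set F} (h : InjOn T S') (h' : S ⊆ S') : InjOn T S :=
  fun u v hu hv => h u v (h' hu) (h' hv)

/-- Bootstrap: if `u` is in the domain of `A ^ n`, so is `A u = v + c u`, hence `u` is in the domain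
of `A ^ (n + 1)`. -/
lemma mem_smoothDomain_of_graph {A : F →ₗ.[ℂ] F} {u v : F} {c : ℂ}
    (h : (u, v + c • u) ∈ A.graph) (hv : v ∈ smoothDomain A) : u ∈ smoothDomain A := by
  refine mem_iInter.2 fun n => ?_
  induction n with
  | zero => trivial
  | succ n ih =>
    exact mem_powDomain_succ.2 ⟨_, h, add_smul_mem_powDomain c (mem_iInter.1 hv n) ih⟩

/-- An operator that intertwines `A` and `B` maps smooth vectors to smooth vectors. -/
lemma mapsTo_smoothDomain {A B T : F →ₗ.[ℂ] F} (hd : A.domain ≤ T.domain)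
    (hi : ∀ u v v', (u, v) ∈ A.graph → (v, v') ∈ A.graph →
      ∃ φ φ', (u, φ) ∈ T.graph ∧ (v, φ') ∈ T.graph ∧ (φ, φ') ∈ B.graph) :
    MapsTo T (smoothDomain A) (smoothDomain B) := by
  -- One power is lost, because `hi` also needs `A u` in the domain of `A`; in the intersection over
  -- all `n` this is harmless.
  have key : ∀ (n : ℕ) (u φ : F), u ∈ powDomain A (n + 1) → (u, φ) ∈ T.graph →
      φ ∈ powDomain B n := by
    intro n
    induction n with
    | zero => intros; trivial
    | succ n ih =>
      intro u φ hu hφ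
      obtain ⟨v, h1, h2⟩ := mem_powDomain_succ.1 hu
      obtain ⟨v', h3, -⟩ := mem_powDomain_succ.1 h2
      obtain ⟨φ₁, φ', e1, e2, e3⟩ := hi u v v' h1 h3
      obtain rfl : φ₁ = φ := LinearPMap.mem_graph_snd_inj T e1 hφ rfl
      exact mem_powDomain_succ.2 ⟨φ', e3, ih v φ' h2 e2⟩
  intro u hu
  have hu' := hd (smoothDomain_subset A hu)
  exact ⟨hu', mem_iInter.2 fun n =>
    key n u _ (mem_iInter.1 hu (n + 1)) (mem_graph_iff_apply.2 ⟨hu', rfl⟩)⟩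

end Abstract

lemma firstOrderOp_mem_graph {σ : ℝ} {W : ℝ → ℝ} {u v : L2} :
    (u, v) ∈ (firstOrderOp σ W).graph ↔ (u, v) ∈ firstOrderGraph σ W := by
  rw [firstOrderOp_graph]

lemma schrodingerOp_mem_graph {V : ℝ → ℝ} {γ : OnePoint ℝ} {u v : L2} :
    (u, v) ∈ (schrodingerOp V γ).graph ↔ (u, v) ∈ schrodingerGraph V γ := by
  rw [schrodingerOp_graph]

namespace IsSuperPotential

variable {W dW E : ℝ → ℝ} {w C : ℝ} (S : IsSuperPotential W dW E w C)

include S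

lemma domain_le {σ : ℝ} (hσ : σ * σ = 1) (γ : OnePoint ℝ) :
    (schrodingerOp (partnerPotential σ W dW w) γ).domain ≤ (firstOrderOp σ W).domain := by
  intro u hu
  have h1 := schrodingerOp_mem_graph.1 (mem_graph_iff_apply.2 ⟨hu, rfl⟩)
  obtain ⟨φ, -, -, h2, -⟩ := (S.schrodinger_iff hσ).1 h1
  exact (mem_firstOrderGraph_iff.1 h2).1

lemma hasTrace_of_mem_dirichlet {σ : ℝ} (hσ : σ * σ = 1) {u : L2}
    (hu : u ∈ (schrodingerOp (partnerPotential σ W dW w) ∞).domain) : HasTrace u 0 := by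
  have h1 := schrodingerOp_mem_graph.1 (mem_graph_iff_apply.2 ⟨hu, rfl⟩)
  obtain ⟨φ, -, -, h2⟩ := (S.schrodinger_infty_iff hσ).1 h1
  exact h2

lemma injOn_dirichlet {σ : ℝ} (hσ : σ * σ = 1) :
    InjOn (firstOrderOp σ W) (schrodingerOp (partnerPotential σ W dW w) ∞).domain := by
  intro u v hu hv e
  have tu := S.hasTrace_of_mem_dirichlet hσ hu
  have tv := S.hasTrace_of_mem_dirichlet hσ hv
  have g : ((u : L2) + (-1 : ℂ) • (v : L2), (0 : L2)) ∈ firstOrderGraph σ W := by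
    have h1 := firstOrderOp_mem_graph.1 ((firstOrderOp σ W).mem_graph u)
    have h2 := firstOrderOp_mem_graph.1 ((firstOrderOp σ W).mem_graph v)
    have := firstOrderGraph_add h1 (firstOrderGraph_smul (-1) h2)
    rw [e] at this
    simpa using this
  have := S.eq_zero_of_firstOrder hσ g (tu.add (tv.smul (-1))) (Or.inl (by simp))
  rw [neg_one_smul, ← sub_eq_add_neg] at this
  exact Subtype.ext (sub_eq_zero.1 this)

/-- The Robin condition for `φ` requires the trace of `H u + w² u` to vanish, so `H u` must satisfy
the Dirichlet condition too. This is why smooth domains appear: `u` in the domain of `H` alone would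
not suffice. -/
lemma mapsTo_dirichlet {σ : ℝ} (hσ : σ * σ = 1) {γ : ℝ} (hγ : γ = σ * W 0) :
    MapsTo (firstOrderOp σ W) (smoothDomain (schrodingerOp (partnerPotential σ W dW w) ∞))
      (smoothDomain (schrodingerOp (partnerPotential (-σ) W dW w) (γ : OnePoint ℝ))) := by
  refine mapsTo_smoothDomain (S.domain_le hσ _) fun u v v' h1 h2 => ?_
  rw [schrodingerOp_mem_graph, S.schrodinger_infty_iff hσ] at h1 h2
  obtain ⟨φ, a1, a2, a3⟩ := h1
  obtain ⟨φ', b1, b2, b3⟩ := h2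
  refine ⟨φ, φ', firstOrderOp_mem_graph.2 a1, firstOrderOp_mem_graph.2 b1, ?_⟩
  rw [schrodingerOp_mem_graph, S.schrodinger_robin_iff (by rw [neg_mul_neg, hσ]) (by rwa [neg_neg]),
    neg_neg]
  refine ⟨v + (w : ℂ) ^ 2 • u, a2, firstOrderGraph_add b1 (firstOrderGraph_smul _ a1), ?_⟩
  convert b3.add (a3.smul ((w : ℂ) ^ 2)) using 1
  simp

lemma mapsTo_robin {σ : ℝ} (hσ : σ * σ = 1) {γ : ℝ} (hγ : γ = -σ * W 0) :
    MapsTo (firstOrderOp σ W)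
      (smoothDomain (schrodingerOp (partnerPotential σ W dW w) (γ : OnePoint ℝ)))
      (smoothDomain (schrodingerOp (partnerPotential (-σ) W dW w) ∞)) := by
  refine mapsTo_smoothDomain (S.domain_le hσ _) fun u v v' h1 h2 => ?_
  rw [schrodingerOp_mem_graph, S.schrodinger_robin_iff hσ hγ] at h1 h2
  obtain ⟨φ, a1, a2, a3⟩ := h1
  obtain ⟨φ', b1, b2, b3⟩ := h2
  refine ⟨φ, φ', firstOrderOp_mem_graph.2 a1, firstOrderOp_mem_graph.2 b1, ?_⟩
  rw [schrodingerOp_mem_graph, S.schrodinger_infty_iff (by rw [neg_mul_neg, hσ]), neg_neg]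
  exact ⟨v + (w : ℂ) ^ 2 • u, a2, firstOrderGraph_add b1 (firstOrderGraph_smul _ a1), a3⟩

/-- From `D^- u = φ` one reads off `H^+ u = D^+ φ - w² u`; of `hφ` only the existence of `D^+ φ` in
`L²` is needed. -/
lemma graph_of_dirichlet_preimage {γ : ℝ} (hγ : γ = -W 0) {φ η u : L2}
    (hφ : (φ, η) ∈ schrodingerGraph (partnerPotential 1 W dW w) (γ : OnePoint ℝ))
    (hu : (u, φ) ∈ firstOrderGraph (-1) W) (hu0 : HasTrace u 0) :
    ∃ ξ, (φ, ξ) ∈ firstOrderGraph 1 W ∧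
      (u, ξ + (-(w : ℂ) ^ 2) • u) ∈ schrodingerGraph (partnerPotential (-1) W dW w) ∞ := by
  rw [S.schrodinger_robin_iff (by norm_num) (by rw [hγ]; ring)] at hφ
  obtain ⟨ξ, h1, -⟩ := hφ
  refine ⟨ξ, h1, ?_⟩
  rw [S.schrodinger_infty_iff (by norm_num)]
  refine ⟨φ, hu, ?_, hu0⟩
  simpa using h1

/-- The Robin condition on `u` only constrains `φ = D^- u`, so any preimage will do. -/
lemma graph_of_robin_preimage {φ η u : L2}
    (hφ : (φ, η) ∈ schrodingerGraph (partnerPotential 1 W dW w) ∞)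
    (hu : (u, φ) ∈ firstOrderGraph (-1) W) {γ : ℝ} (hγ : γ = W 0) :
    ∃ ξ, (φ, ξ) ∈ firstOrderGraph 1 W ∧ (u, ξ + (-(w : ℂ) ^ 2) • u) ∈
      schrodingerGraph (partnerPotential (-1) W dW w) (γ : OnePoint ℝ) := by
  rw [S.schrodinger_infty_iff (by norm_num)] at hφ
  obtain ⟨ξ, h1, -, h2⟩ := hφ
  refine ⟨ξ, h1, ?_⟩
  rw [S.schrodinger_robin_iff (by norm_num) (by rw [hγ]; ring)]
  refine ⟨φ, hu, ?_, h2⟩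
  simpa using h1

lemma surjOn_dirichlet {γ : ℝ} (hγ : γ = -W 0) :
    SurjOn (firstOrderOp (-1) W) (schrodingerOp (partnerPotential (-1) W dW w) ∞).domain
      (schrodingerOp (partnerPotential 1 W dW w) (γ : OnePoint ℝ)).domain := by
  intro φ hφ
  have h1 := schrodingerOp_mem_graph.1 (mem_graph_iff_apply.2 ⟨hφ, rfl⟩)
  obtain ⟨u, hu, hu0⟩ := S.exists_dirichlet φ
  obtain ⟨ξ, -, h2⟩ := S.graph_of_dirichlet_preimage hγ h1 hu hu0
  obtain ⟨h3, e⟩ := mem_firstOrderGraph_iff.1 hu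
  exact ⟨⟨u, h3⟩, (mem_schrodingerGraph_iff.1 h2).1, e⟩

lemma surjOn_robin {γ : ℝ} (hγ : γ = W 0) :
    SurjOn (firstOrderOp (-1) W)
      (schrodingerOp (partnerPotential (-1) W dW w) (γ : OnePoint ℝ)).domain
      (schrodingerOp (partnerPotential 1 W dW w) ∞).domain := by
  intro φ hφ
  have h1 := schrodingerOp_mem_graph.1 (mem_graph_iff_apply.2 ⟨hφ, rfl⟩)
  obtain ⟨u, hu, hu0⟩ := S.exists_dirichlet φ
  obtain ⟨ξ, -, h2⟩ := S.graph_of_robin_preimage h1 hu hγ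
  obtain ⟨h3, e⟩ := mem_firstOrderGraph_iff.1 hu
  exact ⟨⟨u, h3⟩, (mem_schrodingerGraph_iff.1 h2).1, e⟩

lemma surjOn_smooth_dirichlet {γ : ℝ} (hγ : γ = -W 0) :
    SurjOn (firstOrderOp (-1) W) (smoothDomain (schrodingerOp (partnerPotential (-1) W dW w) ∞))
      (smoothDomain (schrodingerOp (partnerPotential 1 W dW w) (γ : OnePoint ℝ))) := by
  intro φ hφ
  obtain ⟨η, h1⟩ := exists_graph_of_mem_smoothDomain hφ
  obtain ⟨u, hu, hu0⟩ := S.exists_dirichlet φ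
  obtain ⟨ξ, k1, h2⟩ := S.graph_of_dirichlet_preimage hγ (schrodingerOp_mem_graph.1 h1) hu hu0
  obtain ⟨h3, e⟩ := mem_firstOrderGraph_iff.1 hu
  -- `D^+ φ` is a smooth vector of the target of the opposite intertwiner, so the bootstrap applies
  -- to `H^+ u = D^+ φ - w² u`.
  obtain ⟨h4, h5⟩ := S.mapsTo_robin (σ := 1) (by norm_num) (by rw [hγ]; ring) φ hφ
  rw [LinearPMap.mem_graph_snd_inj _ (mem_graph_iff_apply.2 ⟨h4, rfl⟩)
    (firstOrderOp_mem_graph.2 k1) rfl] at h5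
  exact ⟨⟨u, h3⟩, mem_smoothDomain_of_graph (schrodingerOp_mem_graph.2 h2) h5, e⟩

lemma surjOn_smooth_robin {γ : ℝ} (hγ : γ = W 0) :
    SurjOn (firstOrderOp (-1) W)
      (smoothDomain (schrodingerOp (partnerPotential (-1) W dW w) (γ : OnePoint ℝ)))
      (smoothDomain (schrodingerOp (partnerPotential 1 W dW w) ∞)) := by
  intro φ hφ
  obtain ⟨η, h1⟩ := exists_graph_of_mem_smoothDomain hφ
  obtain ⟨u, hu, hu0⟩ := S.exists_dirichlet φ
  obtain ⟨ξ, k1, h2⟩ := S.graph_of_robin_preimage (schrodingerOp_mem_graph.1 h1) hu hγ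
  obtain ⟨h3, e⟩ := mem_firstOrderGraph_iff.1 hu
  obtain ⟨h4, h5⟩ := S.mapsTo_dirichlet (σ := 1) (by norm_num) (γ := γ) (by rw [hγ]; ring) φ hφ
  rw [LinearPMap.mem_graph_snd_inj _ (mem_graph_iff_apply.2 ⟨h4, rfl⟩)
    (firstOrderOp_mem_graph.2 k1) rfl] at h5
  exact ⟨⟨u, h3⟩, mem_smoothDomain_of_graph (schrodingerOp_mem_graph.2 h2) h5, e⟩

lemma mode_graph {X : L2} (hX : (X, (0 : L2)) ∈ firstOrderGraph (-1) W) {γ : ℝ} (hγ : γ = W 0) :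
    (X, (-(w : ℂ) ^ 2) • X) ∈
      (schrodingerOp (partnerPotential (-1) W dW w) (γ : OnePoint ℝ)).graph := by
  rw [schrodingerOp_mem_graph, S.schrodinger_robin_iff (by norm_num) (by rw [hγ]; ring)]
  refine ⟨0, hX, ?_, ⟨_, _, IsPrimitive.zero, Lp.coeFn_zero _ _ _, rfl⟩⟩
  rw [neg_smul, neg_add_cancel]
  exact (firstOrderGraph _ W).zero_mem

lemma mode_mem_spectrum {X : L2} (hX : (X, (0 : L2)) ∈ firstOrderGraph (-1) W) (X0 : X ≠ 0)
    {γ : ℝ} (hγ : γ = W 0) : -(w : ℂ) ^ 2 ∈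
      spectrum (schrodingerOp (partnerPotential (-1) W dW w) (γ : OnePoint ℝ)) := by
  rintro ⟨R, -, h⟩
  obtain ⟨h1, e⟩ := mem_graph_iff_apply.1 (S.mode_graph hX hγ)
  have := h ⟨X, h1⟩
  rw [e, sub_self, map_zero] at this
  exact X0 this.symm

/-- `D` is left free so that the smooth domain and the full operator domain are treated at once. -/
lemma kerOn_eq {X : L2} (hX : (X, (0 : L2)) ∈ firstOrderGraph (-1) W) (hX0 : HasTrace X (E 0))
    {D : Set L2} (hD : ∀ c : ℂ, c • X ∈ D) :
    kerOn (firstOrderOp (-1) W) D = (Submodule.span ℂ {X} : Set L2) := by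
  ext u
  rw [SetLike.mem_coe, Submodule.mem_span_singleton]
  constructor
  · rintro ⟨-, h⟩
    obtain ⟨c, rfl⟩ := S.eq_smul_mode hX hX0 (mem_firstOrderGraph_iff.2 h)
    exact ⟨c, rfl⟩
  · rintro ⟨c, rfl⟩
    have := firstOrderGraph_smul c hX
    rw [smul_zero] at this
    exact ⟨hD c, mem_firstOrderGraph_iff.1 this⟩

lemma smul_mode_mem_smoothDomain {X : L2} (hX : (X, (0 : L2)) ∈ firstOrderGraph (-1) W)
    {γ : ℝ} (hγ : γ = W 0) (c : ℂ) :
    c • X ∈ smoothDomain (schrodingerOp (partnerPotential (-1) W dW w) (γ : OnePoint ℝ)) := by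
  have h1 := (schrodingerOp (partnerPotential (-1) W dW w) (γ : OnePoint ℝ)).graph.smul_mem c
    (S.mode_graph hX hγ)
  refine mem_smoothDomain_of_graph (v := 0) (c := -(w : ℂ) ^ 2) ?_ ?_
  · convert h1 using 1
    rw [Prod.smul_mk, zero_add, smul_comm]
  · refine mem_iInter.2 fun n => ?_
    induction n with
    | zero => trivial
    | succ n ih => exact mem_powDomain_succ.2 ⟨0, LinearPMap.graph _ |>.zero_mem, ih⟩

end IsSuperPotential

end SAdS

/-! ### Cut-off local solutions and the classification of boundary conditions -/

namespace SAdS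

open Filter Topology ComplexConjugate

/-- Local solvability of the initial value problem for `u'' = q u`. -/
lemma exists_local_solution {q : ℝ → ℝ} (hq : Continuous q) (a b : ℝ) :
    ∃ ε > 0, ∃ u u' : ℝ → ℝ, u 0 = a ∧ u' 0 = b ∧ ∀ x ∈ Ioo (-ε) ε,
      HasDerivAt u (u' x) x ∧ HasDerivAt u' (q x * u x) x := by
  obtain ⟨B, hB⟩ := isCompact_Icc.exists_bound_of_continuousOn (s := Icc (-1 : ℝ) 1) hq.continuousOn
  set K : NNReal := ⟨max 1 B, le_max_of_le_left zero_le_one⟩ with hK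
  have hK1 : (1 : ℝ) ≤ K := le_max_left _ _
  have hKB : ∀ t ∈ Icc (-1 : ℝ) 1, |q t| ≤ K := fun t ht => (hB t ht).trans (le_max_right _ _)
  -- `L` bounds the vector field on the closed ball of radius `1` about `(a, b)`, and `ε ≤ L⁻¹`
  -- keeps the solution in that ball.
  set L : NNReal := K * (‖(a, b)‖₊ + 1) with hL
  have hLpos : (0 : ℝ) < L := by
    rw [hL]
    push_cast
    have : 0 ≤ ‖(a, b)‖ := norm_nonneg _
    positivity
  set ε : ℝ := min 1 (L : ℝ)⁻¹ with hε
  have hε0 : 0 < ε := lt_min one_pos (inv_pos.2 hLpos)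
  have hsub : Icc (-ε) ε ⊆ Icc (-1 : ℝ) 1 :=
    Icc_subset_Icc (neg_le_neg (min_le_left _ _)) (min_le_left _ _)
  set f : ℝ → ℝ × ℝ → ℝ × ℝ := fun t p => (p.2, q t * p.1) with hf
  have hlip : ∀ t ∈ Icc (-ε) ε, LipschitzWith K (f t) := by
    intro t ht
    refine LipschitzWith.of_dist_le_mul fun p p' => ?_
    have h1 := hKB t (hsub ht)
    rw [Prod.dist_eq]
    refine max_le ?_ ?_
    · have h2 : dist p.2 p'.2 ≤ dist p p' := le_max_right _ _
      have h3 : (0 : ℝ) ≤ dist p p' := dist_nonneg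
      change dist p.2 p'.2 ≤ _
      nlinarith
    · change dist (q t * p.1) (q t * p'.1) ≤ _
      rw [Real.dist_eq, ← mul_sub, abs_mul, ← Real.dist_eq]
      have h2 : dist p.1 p'.1 ≤ dist p p' := le_max_left _ _
      exact mul_le_mul h1 h2 dist_nonneg K.2
  have hP : IsPicardLindelof f (tmin := -ε) (tmax := ε) ⟨0, by constructor <;> linarith⟩
      (a, b) 1 0 L K := by
    refine ⟨fun t ht => (hlip t ht).lipschitzOnWith, fun p _ => ?_, fun t ht p hp => ?_, ?_⟩
    · exact (continuous_const.prodMk (hq.mul continuous_const)).continuousOn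
    · have h1 := (hlip t ht).dist_le_mul p 0
      have h2 : f t 0 = 0 := by simp [hf]
      rw [h2, dist_zero_right, dist_zero_right] at h1
      refine h1.trans ?_
      rw [hL]
      push_cast
      refine mul_le_mul_of_nonneg_left ?_ K.2
      have h3 := norm_le_norm_add_norm_sub' p (a, b)
      rw [Metric.mem_closedBall, dist_eq_norm] at hp
      exact h3.trans (by
        have : ‖p - (a, b)‖ ≤ 1 := hp
        linarith)
    · have h1 : (L : ℝ) * ε ≤ L * (L : ℝ)⁻¹ :=
        mul_le_mul_of_nonneg_left (min_le_right _ _) hLpos.le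
      rw [mul_inv_cancel₀ hLpos.ne'] at h1
      simpa using h1
  obtain ⟨α, h0, hα⟩ := hP.exists_eq_forall_mem_Icc_hasDerivWithinAt₀
  refine ⟨ε, hε0, fun x => (α x).1, fun x => (α x).2, congrArg Prod.fst h0, congrArg Prod.snd h0,
    fun x hx => ?_⟩
  have h1 := (hα x ⟨hx.1.le, hx.2.le⟩).hasDerivAt (Icc_mem_nhds hx.1 hx.2)
  exact ⟨h1.fst, h1.snd⟩

/-- A solution of `u'' = q u` is smooth where `q` is. -/
lemma contDiffOn_of_solution {q u u' : ℝ → ℝ} {s : Set ℝ} (hs : IsOpen s)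
    (hq : ContDiffOn ℝ (⊤ : ℕ∞) q s)
    (hu : ∀ x ∈ s, HasDerivAt u (u' x) x ∧ HasDerivAt u' (q x * u x) x) :
    ContDiffOn ℝ (⊤ : ℕ∞) u s := by
  have key : ∀ n : ℕ, ContDiffOn ℝ n u s ∧ ContDiffOn ℝ n u' s := by
    intro n
    induction n with
    | zero =>
      simp only [Nat.cast_zero, contDiffOn_zero]
      exact ⟨fun x hx => (hu x hx).1.continuousAt.continuousWithinAt,
        fun x hx => (hu x hx).2.continuousAt.continuousWithinAt⟩
    | succ n ih =>
      push_cast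
      rw [contDiffOn_succ_iff_deriv_of_isOpen hs, contDiffOn_succ_iff_deriv_of_isOpen hs]
      refine ⟨⟨fun x hx => (hu x hx).1.differentiableAt.differentiableWithinAt, by simp, ?_⟩,
        ⟨fun x hx => (hu x hx).2.differentiableAt.differentiableWithinAt, by simp, ?_⟩⟩
      · exact ih.2.congr fun x hx => (hu x hx).1.deriv
      · exact ((hq.of_le (by exact_mod_cast le_top)).mul ih.1).congr fun x hx => (hu x hx).2.deriv
  exact contDiffOn_infty.2 fun n => (key n).1

/-- `g` is smooth on the open half line, has bounded support, and agrees with `v` near `0`. -/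
def IsCutoffOf (δ : ℝ) (g v : ℝ → ℝ) : Prop :=
  ContDiffOn ℝ (⊤ : ℕ∞) g (Iio 0) ∧ (∀ x ∈ Ioc (-δ) 0, g x = v x) ∧ ∀ x < -(2 * δ), g x = 0

lemma IsCutoffOf.continuousOn {δ : ℝ} (hδ : 0 < δ) {g v : ℝ → ℝ} (h : IsCutoffOf δ g v)
    (hv : ContinuousAt v 0) : ContinuousOn g (Iic 0) := by
  intro x hx
  rcases (mem_Iic.1 hx).eq_or_lt with rfl | hx'
  · have h1 : ContinuousWithinAt v (Iic 0) 0 := hv.continuousWithinAt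
    refine h1.congr_of_eventuallyEq ?_ (h.2.1 0 ⟨by linarith, le_rfl⟩)
    filter_upwards [self_mem_nhdsWithin, mem_nhdsWithin_of_mem_nhds (Ioi_mem_nhds (by linarith :
      -δ < 0))] with y h1 h2
    exact h.2.1 y ⟨h2, h1⟩
  · exact (h.1.continuousOn.continuousAt (Iio_mem_nhds hx')).continuousWithinAt

/-- The derivative is prescribed by `v'` for `x ≥ 0`, because `g` is only known to be smooth on the
open half line and the value at `0` serves as a boundary trace. -/
lemma IsCutoffOf.exists_deriv {δ : ℝ} (hδ : 0 < δ) {g v v' : ℝ → ℝ} (h : IsCutoffOf δ g v)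
    (hv : ∀ x ∈ Ioo (-δ) 0, HasDerivAt v (v' x) x) :
    ∃ g', IsCutoffOf δ g' v' ∧ ∀ x < (0 : ℝ), HasDerivAt g (g' x) x := by
  classical
  refine ⟨fun x => if x < 0 then deriv g x else v' x, ⟨?_, ?_, ?_⟩, ?_⟩
  · have h1 : ContDiffOn ℝ (⊤ : ℕ∞) (deriv g) (Iio 0) :=
      ((contDiffOn_infty_iff_deriv_of_isOpen isOpen_Iio).1 h.1).2
    exact h1.congr fun x hx => if_pos hx
  · intro x hx
    rcases hx.2.eq_or_lt with rfl | hx'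
    · simp
    · simp only [hx', if_true]
      have h1 : g =ᶠ[𝓝 x] v := by
        filter_upwards [Ioo_mem_nhds hx.1 hx'] with y hy
        exact h.2.1 y ⟨hy.1, hy.2.le⟩
      rw [h1.deriv_eq]
      exact (hv x ⟨hx.1, hx'⟩).deriv
  · intro x hx
    by_cases hx' : x < 0
    · simp only [hx', if_true]
      have h1 : g =ᶠ[𝓝 x] fun _ => 0 := by
        filter_upwards [Iio_mem_nhds hx] with y hy
        exact h.2.2 y hy
      rw [h1.deriv_eq]
      simp
    · linarith
  · intro x hx
    simp only [hx, if_true]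
    exact ((h.1.differentiableOn (by simp)).differentiableAt (Iio_mem_nhds hx)).hasDerivAt

lemma isPrimitive_ofReal {g h : ℝ → ℝ} (cg : ContinuousOn g (Iic 0))
    (ch : ContinuousOn h (Iic 0)) (hd : ∀ x < (0 : ℝ), HasDerivAt g (h x) x) :
    IsPrimitive (fun x => (g x : ℂ)) (fun x => (h x : ℂ)) :=
  IsPrimitive.of_hasDerivAt (Complex.continuous_ofReal.comp_continuousOn cg)
    (fun x hx => (hd x hx).ofReal_comp) (Complex.continuous_ofReal.comp_continuousOn ch)

/-- Every local solution can be cut off. -/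
lemma exists_isCutoffOf {δ : ℝ} (hδ : 0 < δ) {u : ℝ → ℝ}
    (hu : ContDiffOn ℝ (⊤ : ℕ∞) u (Ioo (-(4 * δ)) 0)) : ∃ g, IsCutoffOf δ g u := by
  -- `θ` is `0` for `x ≤ -2δ` and `1` for `x ≥ -δ`, so the transition stays inside `(-4δ, 0)`, where
  -- `u` is smooth.
  set θ : ℝ → ℝ := fun x => Real.smoothTransition ((x + 2 * δ) / δ) with hθ
  have hθs : ContDiff ℝ (⊤ : ℕ∞) θ := by
    refine Real.smoothTransition.contDiff.comp ?_
    fun_prop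
  refine ⟨fun x => θ x * u x, ?_, ?_, ?_⟩
  · intro x hx
    rcases lt_or_ge (-(3 * δ)) x with h | h
    · have h1 : ContDiffAt ℝ (⊤ : ℕ∞) u x := hu.contDiffAt (Ioo_mem_nhds (by linarith) hx)
      exact (hθs.contDiffAt.mul h1).contDiffWithinAt
    · have h1 : (fun x => θ x * u x) =ᶠ[𝓝 x] fun _ => 0 := by
        filter_upwards [Iio_mem_nhds (by linarith : x < -(2 * δ))] with y hy
        have : (y + 2 * δ) / δ ≤ 0 := div_nonpos_of_nonpos_of_nonneg (by linarith [mem_Iio.1 hy]) hδ.le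
        simp only [hθ]
        rw [Real.smoothTransition.zero_of_nonpos this, zero_mul]
      exact (contDiffAt_const.congr_of_eventuallyEq h1).contDiffWithinAt
  · intro x hx
    have : 1 ≤ (x + 2 * δ) / δ := by
      rw [le_div_iff₀ hδ]
      linarith [hx.1]
    simp only [hθ]
    rw [Real.smoothTransition.one_of_one_le this, one_mul]
  · intro x hx
    have : (x + 2 * δ) / δ ≤ 0 := div_nonpos_of_nonpos_of_nonneg (by linarith) hδ.le
    simp only [hθ]
    rw [Real.smoothTransition.zero_of_nonpos this, zero_mul]

namespace IsSuperPotential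

variable {W dW E : ℝ → ℝ} {w C : ℝ} (S : IsSuperPotential W dW E w C)

include S

lemma contDiffOn_deriv : ContDiffOn ℝ (⊤ : ℕ∞) dW (Iio 0) :=
  (((contDiffOn_infty_iff_deriv_of_isOpen isOpen_Iio).1 S.contDiffOn).2).congr
    fun x hx => (S.hasDerivAt x hx).deriv.symm

lemma continuous_partner (σ : ℝ) : Continuous (partnerPotential σ W dW w) :=
  ((S.continuous.pow 2).sub (continuous_const.mul S.continuous_deriv)).sub continuous_const

lemma contDiffOn_partner (σ : ℝ) :
    ContDiffOn ℝ (⊤ : ℕ∞) (partnerPotential σ W dW w) (Iio 0) :=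
  ((S.contDiffOn.pow 2).sub (contDiffOn_const.mul S.contDiffOn_deriv)).sub contDiffOn_const

/-- Comparison with the square integrable mode `E`, which is bounded below on the compact interval
outside which `g` vanishes. -/
lemma memLp_cutoff {δ : ℝ} (hδ : 0 < δ) {g v : ℝ → ℝ} (h : IsCutoffOf δ g v)
    (hv : ContinuousAt v 0) : MemLp (fun x => (g x : ℂ)) 2 halfVol := by
  have hc := h.continuousOn hδ hv
  obtain ⟨K, hK⟩ := isCompact_Icc.exists_bound_of_continuousOn (s := Icc (-(2 * δ)) 0)
    ((hc.mono fun x hx => hx.2).div S.mode_continuous.continuousOn fun x _ => (S.mode_pos x).ne')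
  refine S.memLp_mode.of_le_mul (c := K) ?_ ?_
  · exact (Complex.continuous_ofReal.comp_continuousOn
      (hc.mono Iio_subset_Iic_self)).aestronglyMeasurable measurableSet_Iio
  · filter_upwards [ae_restrict_mem measurableSet_Iio] with x hx
    have hE := S.mode_pos x
    rw [Complex.norm_real, Complex.norm_real, Real.norm_of_nonneg hE.le]
    rcases lt_or_ge x (-(2 * δ)) with h1 | h1
    · rw [h.2.2 x h1, norm_zero]
      have := (norm_nonneg _).trans (hK 0 ⟨by linarith, le_rfl⟩)
      positivity
    · have := hK x ⟨h1, le_of_lt hx⟩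
      rwa [Pi.div_apply, norm_div, Real.norm_of_nonneg hE.le, div_le_iff₀ hE] at this

/-- Near `0` the smooth vectors are as rich as the local solutions of `-u'' + V u = κ u`. -/
lemma exists_smooth_local_eigenvector {σ : ℝ} (hσ : σ * σ = 1) {γ : OnePoint ℝ} {a b : ℝ}
    (hab : BoundaryCondition γ a b) (κ : ℝ) :
    ∃ U φ η : L2, U ∈ smoothDomain (schrodingerOp (partnerPotential σ W dW w) γ) ∧
      (U, φ) ∈ firstOrderGraph σ W ∧ (φ, η) ∈ firstOrderGraph (-σ) W ∧
      HasTrace φ (σ * b + W 0 * a) ∧ HasTrace η ((κ + w ^ 2) * a) := by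
  set V := partnerPotential σ W dW w with hV
  have hVc : Continuous V := S.continuous_partner σ
  obtain ⟨ε, hε, u, u', u0, u0', hu⟩ := exists_local_solution (hVc.sub continuous_const :
    Continuous fun x => V x - κ) a b
  set δ := ε / 4 with hδ
  have hδ0 : 0 < δ := by positivity
  have hus : ContDiffOn ℝ (⊤ : ℕ∞) u (Ioo (-(4 * δ)) 0) := by
    refine contDiffOn_of_solution isOpen_Ioo (((S.contDiffOn_partner σ).sub
      contDiffOn_const).mono fun x hx => hx.2) fun x hx => hu x ⟨?_, ?_⟩
    · have := hx.1
      rw [hδ] at this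
      linarith
    · exact hx.2.trans hε
  have hu' : ∀ x ∈ Ioo (-δ) 0, HasDerivAt u (u' x) x ∧ HasDerivAt u' ((V x - κ) * u x) x :=
    fun x hx => hu x ⟨by have := hx.1; rw [hδ] at this; linarith, hx.2.trans hε⟩
  have hcu : ContinuousAt u 0 := (hu 0 ⟨by linarith, hε⟩).1.continuousAt
  have hcu' : ContinuousAt u' 0 := (hu 0 ⟨by linarith, hε⟩).2.continuousAt
  -- The cutoffs of multiples of `u` are stable under `H`: near `0` the result is `κ` times the
  -- input. With the multiple `c` free this iterates, and each of them lies in every power domain.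
  have step : ∀ (c : ℝ) (g : ℝ → ℝ) (U : L2), IsCutoffOf δ g (fun x => c * u x) →
      U =ᵐ[halfVol] (fun x => (g x : ℂ)) → ∃ (g₁ k : ℝ → ℝ) (g₂ : ℝ → ℂ) (Y : L2),
        IsCutoffOf δ g₁ (fun x => c * u' x) ∧ IsCutoffOf δ k (fun x => c * κ * u x) ∧
        IsPrimitive (fun x => (g x : ℂ)) (fun x => (g₁ x : ℂ)) ∧
        IsPrimitive (fun x => (g₁ x : ℂ)) g₂ ∧
        (U, Y) ∈ schrodingerGraph V γ ∧ Y =ᵐ[halfVol] (fun x => (k x : ℂ)) := by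
    intro c g U hg hU
    obtain ⟨g₁, hg₁, d₁⟩ := hg.exists_deriv hδ0 (v' := fun x => c * u' x)
      fun x hx => (hu' x hx).1.const_mul c
    obtain ⟨g₂, hg₂, d₂⟩ := hg₁.exists_deriv hδ0 (v' := fun x => c * ((V x - κ) * u x))
      fun x hx => (hu' x hx).2.const_mul c
    have c0 := hg.continuousOn hδ0 (continuousAt_const.mul hcu)
    have c1 := hg₁.continuousOn hδ0 (continuousAt_const.mul hcu')
    have c2 := hg₂.continuousOn hδ0
      (continuousAt_const.mul ((hVc.continuousAt.sub continuousAt_const).mul hcu))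
    have P0 := isPrimitive_ofReal c0 c1 d₁
    have P1 := isPrimitive_ofReal c1 c2 d₂
    have hk : IsCutoffOf δ (fun x => -g₂ x + V x * g x) (fun x => c * κ * u x) := by
      refine ⟨hg₂.1.neg.add ((S.contDiffOn_partner σ).mul hg.1), fun x hx => ?_, fun x hx => ?_⟩
      · beta_reduce
        rw [hg₂.2.1 x hx, hg.2.1 x hx]
        ring
      · beta_reduce
        rw [hg₂.2.2 x hx, hg.2.2 x hx]
        ring
    have mk := S.memLp_cutoff hδ0 hk (continuousAt_const.mul hcu)
    refine ⟨g₁, _, _, mk.toLp _, hg₁, hk, P0, P1, ⟨_, _, _, P0, P1, ?_, hU, ?_⟩, mk.coeFn_toLp⟩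
    · have h0 : (0 : ℝ) ∈ Ioc (-δ) 0 := ⟨by linarith, le_rfl⟩
      rw [hg.2.1 0 h0, hg₁.2.1 0 h0]
      beta_reduce
      rw [u0, u0']
      push_cast
      exact hab.smul c
    · filter_upwards [mk.coeFn_toLp] with x hx
      rw [hx]
      push_cast
      rfl
  have pow : ∀ (n : ℕ) (c : ℝ) (g : ℝ → ℝ) (U : L2), IsCutoffOf δ g (fun x => c * u x) →
      U =ᵐ[halfVol] (fun x => (g x : ℂ)) → U ∈ powDomain (schrodingerOp V γ) n := by
    intro n
    induction n with
    | zero => intros; trivial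
    | succ n ih =>
      intro c g U hg hU
      obtain ⟨g₁, k, g₂, Y, -, hk, -, -, hY, eY⟩ := step c g U hg hU
      exact mem_powDomain_succ.2 ⟨Y, schrodingerOp_mem_graph.2 hY, ih _ k Y hk eY⟩
  obtain ⟨g, hg'⟩ := exists_isCutoffOf hδ0 hus
  have hg : IsCutoffOf δ g (fun x => 1 * u x) := by simpa using hg'
  have mg := S.memLp_cutoff hδ0 hg (continuousAt_const.mul hcu)
  have eU := mg.coeFn_toLp
  obtain ⟨g₁, k, g₂, Y, hg₁, hk, P0, P1, hY, eY⟩ := step 1 g _ hg eU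
  have h0 : (0 : ℝ) ∈ Ioc (-δ) 0 := ⟨by linarith, le_rfl⟩
  obtain ⟨φ, a', b', h1, h2, -⟩ := (S.schrodinger_iff hσ).1 hY
  refine ⟨_, φ, _, mem_iInter.2 fun n => pow n 1 g _ hg eU, h1, h2, ?_, ?_⟩
  · obtain ⟨p, r, Hp, e1, e2⟩ := h1
    simp only at e1 e2
    have e3 := Hp.unique P0 (e1.symm.trans eU)
    refine ⟨_, _, (P1.smul (σ : ℂ)).add (S.isPrimitive.mul P0), ?_, ?_⟩
    · filter_upwards [e2, e3.2, e1, eU] with x h1 h2 h3 h4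
      rw [h1, h2, ← h3, h4]
    · rw [hg.2.1 0 h0, hg₁.2.1 0 h0]
      beta_reduce
      rw [u0, u0', one_mul, one_mul]
  · obtain ⟨k₁, hk₁, d⟩ := hk.exists_deriv hδ0 (v' := fun x => 1 * κ * u' x)
      fun x hx => (hu' x hx).1.const_mul _
    have Pk := isPrimitive_ofReal (hk.continuousOn hδ0 (continuousAt_const.mul hcu))
      (hk₁.continuousOn hδ0 (continuousAt_const.mul hcu')) d
    have t1 : HasTrace Y (k 0) := ⟨_, _, Pk, eY, rfl⟩
    have t2 : HasTrace (mg.toLp _) (g 0) := ⟨_, _, P0, eU, rfl⟩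
    convert t1.add (t2.smul ((w : ℂ) ^ 2)) using 1
    rw [hg.2.1 0 h0, hk.2.1 0 h0]
    beta_reduce
    rw [u0]
    push_cast
    ring

/-- The pairs of boundary conditions that are compatible with `σ d/dx + W`. -/
lemma mapsTo_iff {σ : ℝ} (hσ : σ * σ = 1) (γ γ' : OnePoint ℝ) :
    MapsTo (firstOrderOp σ W) (smoothDomain (schrodingerOp (partnerPotential σ W dW w) γ))
      (schrodingerOp (partnerPotential (-σ) W dW w) γ').domain ↔
    (γ = ∞ ∧ γ' = ((σ * W 0 : ℝ) : OnePoint ℝ)) ∨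
      (γ = ((-σ * W 0 : ℝ) : OnePoint ℝ) ∧ γ' = ∞) := by
  have hσ' : (σ : ℂ) * σ = 1 := by exact_mod_cast hσ
  constructor
  · intro hm
    -- The condition `γ'` for the image `φ` of a cut-off solution with data `(a, b)`: the arguments
    -- are `φ(0)` and `φ'(0)`, the latter read off from `-σ φ' + W φ = (κ + w²) u` at `0`.
    have key : ∀ (a b κ : ℝ), BoundaryCondition γ a b → BoundaryCondition γ' (σ * b + W 0 * a)
        (-σ * ((κ + w ^ 2) * a - W 0 * (σ * b + W 0 * a))) := by
      intro a b κ hab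
      obtain ⟨U, φ, η, hU, h1, h2, h3, h4⟩ := S.exists_smooth_local_eigenvector hσ hab κ
      obtain ⟨hd, h5⟩ := hm U hU
      obtain rfl := LinearPMap.mem_graph_snd_inj _ (mem_graph_iff_apply.2 ⟨hd, rfl⟩)
        (firstOrderOp_mem_graph.2 h1) rfl
      have h6 := schrodingerOp_mem_graph.1 (mem_graph_iff_apply.2 ⟨h5, rfl⟩)
      obtain ⟨η', a', b', k1, -, k2, k3, k4⟩ :=
        (S.schrodinger_iff (σ := -σ) (by rw [neg_mul_neg, hσ])).1 h6
      obtain rfl := firstOrderGraph_unique k1 h2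
      rw [k2.unique h3, k3.unique h4] at k4
      push_cast at k4
      exact k4
    have hσ0 : (σ : ℂ) ≠ 0 := fun h => by rw [h] at hσ'; simp at hσ'
    rcases γ with _ | γ
    · left
      refine ⟨rfl, ?_⟩
      have h1 := key 0 1 0 (by rfl)
      rcases γ' with _ | γ'
      · change (σ : ℂ) * ((1 : ℝ) : ℂ) + W 0 * ((0 : ℝ) : ℂ) = 0 at h1
        exact absurd (by simpa using h1) hσ0
      · change _ = (γ' : ℂ) * _ at h1
        push_cast at h1
        have h2 : (γ' : ℂ) = ((σ * W 0 : ℝ) : ℂ) := by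
          push_cast
          linear_combination (-σ : ℂ) * h1 + ((σ : ℂ) * W 0 - γ') * hσ'
        change ((γ' : ℝ) : OnePoint ℝ) = _
        rw [Complex.ofReal_inj.1 h2]
    · right
      have hb : BoundaryCondition ((γ : ℝ) : OnePoint ℝ) (1 : ℝ) (γ : ℝ) := by
        change ((γ : ℝ) : ℂ) = (γ : ℂ) * ((1 : ℝ) : ℂ)
        simp
      rcases γ' with _ | γ'
      · refine ⟨?_, rfl⟩
        have h1 := key 1 γ 0 hb
        change (σ : ℂ) * γ + W 0 * ((1 : ℝ) : ℂ) = 0 at h1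
        have h2 : (γ : ℂ) = ((-σ * W 0 : ℝ) : ℂ) := by
          push_cast at h1 ⊢
          linear_combination (σ : ℂ) * h1 - γ * hσ'
        change ((γ : ℝ) : OnePoint ℝ) = _
        rw [Complex.ofReal_inj.1 h2]
      -- Passing from `κ = 0` to `κ = 1` changes `φ'(0)` by `-σ` and leaves `φ(0)` fixed, which no
      -- finite `γ'` allows.
      · exfalso
        have h1 := key 1 γ 0 hb
        have h2 := key 1 γ 1 hb
        change _ = (γ' : ℂ) * _ at h1
        change _ = (γ' : ℂ) * _ at h2
        push_cast at h1 h2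
        apply hσ0
        linear_combination h1 - h2
  · rintro (⟨rfl, rfl⟩ | ⟨rfl, rfl⟩)
    · exact (S.mapsTo_dirichlet hσ rfl).mono (smoothDomain_subset _)
    · exact (S.mapsTo_robin hσ rfl).mono (smoothDomain_subset _)

end IsSuperPotential

end SAdS

/-! ### The tortoise coordinate, its inverse, and the superpotential in the variable `1 / r` -/

noncomputable section

namespace SAdS

open Filter Topology

section Horizon

variable {M Λ : ℝ} (hM : 0 < M) (hΛ : Λ < 0)

lemma mul_metricF {r : ℝ} (hr : r ≠ 0) : r * metricF M Λ r = r - 2 * M - Λ * r ^ 3 / 3 := by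
  unfold metricF
  field_simp

lemma continuousOn_metricF : ContinuousOn (metricF M Λ) (Ioi 0) := by
  unfold metricF
  refine ContinuousOn.sub (ContinuousOn.sub continuousOn_const
    (continuousOn_const.div continuousOn_id fun x hx => ne_of_gt hx)) ?_
  fun_prop

include hΛ in
-- `r f(r) = r - 2M - Λ r³/3` is a polynomial with increasing terms; it gives the unique zero of `f`
-- and its sign beyond it.
lemma mul_metricF_strictMono {r s : ℝ} (hr : 0 < r) (hrs : r < s) :
    r * metricF M Λ r < s * metricF M Λ s := by
  rw [mul_metricF hr.ne', mul_metricF (hr.trans hrs).ne']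
  have : r ^ 3 < s ^ 3 := pow_lt_pow_left₀ hrs hr.le (by norm_num)
  nlinarith

include hM hΛ in
lemma horizonRadius_spec :
    0 < horizonRadius M Λ ∧ metricF M Λ (horizonRadius M Λ) = 0 := by
  have h1 : ∃ ρ ∈ Icc (0 : ℝ) (2 * M), ρ - 2 * M - Λ * ρ ^ 3 / 3 = 0 := by
    have hc : ContinuousOn (fun r : ℝ => r - 2 * M - Λ * r ^ 3 / 3) (Icc 0 (2 * M)) := by fun_prop
    have := intermediate_value_Icc (by positivity : (0 : ℝ) ≤ 2 * M) hc
    obtain ⟨ρ, h, e⟩ := this (show (0 : ℝ) ∈ _ from ⟨by simp [hM.le], by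
      have : 0 < (2 * M) ^ 3 := by positivity
      nlinarith⟩)
    exact ⟨ρ, h, e⟩
  obtain ⟨ρ, hρ, e⟩ := h1
  have hρ0 : 0 < ρ := by
    refine lt_of_le_of_ne hρ.1 fun h => ?_
    rw [← h] at e
    norm_num at e
    exact hM.ne' e
  have e' : metricF M Λ ρ = 0 := by
    rw [← mul_metricF hρ0.ne'] at e
    exact (mul_eq_zero.1 e).resolve_left hρ0.ne'
  have hs : {r | 0 < r ∧ metricF M Λ r = 0} = {ρ} := by
    ext r
    simp only [mem_ofPred_eq, mem_singleton_iff]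
    constructor
    · rintro ⟨hr, er⟩
      rcases lt_trichotomy r ρ with h | h | h
      · have := mul_metricF_strictMono (M := M) hΛ hr h
        rw [er, e'] at this
        simp at this
      · exact h
      · have := mul_metricF_strictMono (M := M) hΛ hρ0 h
        rw [er, e'] at this
        simp at this
    · rintro rfl
      exact ⟨hρ0, e'⟩
  have : horizonRadius M Λ = ρ := by
    unfold horizonRadius
    rw [hs, csSup_singleton]
  rw [this]
  exact ⟨hρ0, e'⟩

include hM hΛ in
lemma metricF_pos {r : ℝ} (hr : horizonRadius M Λ < r) : 0 < metricF M Λ r := by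
  obtain ⟨h1, h2⟩ := horizonRadius_spec hM hΛ
  have := mul_metricF_strictMono (M := M) hΛ h1 hr
  rw [h2, mul_zero] at this
  exact pos_of_mul_pos_right this (h1.trans hr).le

include hM hΛ in
lemma continuousOn_inv_metricF :
    ContinuousOn (fun s => (metricF M Λ s)⁻¹) (Ioi (horizonRadius M Λ)) :=
  (continuousOn_metricF.mono (Ioi_subset_Ioi (horizonRadius_spec hM hΛ).1.le)).inv₀
    fun _ hx => (metricF_pos hM hΛ hx).ne'

include hM hΛ in
lemma inv_metricF_le {s : ℝ} (hs : 2 * M < s) :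
    (metricF M Λ s)⁻¹ ≤ 3 / -Λ * s ^ (-2 : ℝ) ∧ 0 ≤ (metricF M Λ s)⁻¹ := by
  have hs0 : 0 < s := lt_trans (by positivity) hs
  have h1 : -Λ * s ^ 2 / 3 ≤ metricF M Λ s := by
    have : 2 * M / s ≤ 1 := (div_le_one hs0).2 hs.le
    unfold metricF
    linarith
  have h2 : 0 < -Λ * s ^ 2 / 3 := by
    have : 0 < -Λ := by linarith
    positivity
  refine ⟨?_, by have := h2.trans_le h1; positivity⟩
  refine (inv_anti₀ h2 h1).trans (le_of_eq ?_)
  rw [Real.rpow_neg hs0.le, show (2 : ℝ) = ((2 : ℕ) : ℝ) by norm_num, Real.rpow_natCast]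
  have : Λ ≠ 0 := hΛ.ne
  field_simp

include hM hΛ in
lemma integrableOn_inv_metricF {r : ℝ} (hr : horizonRadius M Λ < r) :
    IntegrableOn (fun s => (metricF M Λ s)⁻¹) (Ioi r) := by
  have hc := continuousOn_inv_metricF hM hΛ
  set R := max r (2 * M) with hR
  have hR0 : 0 < R := lt_of_lt_of_le (by positivity) (le_max_right _ _)
  rw [← Ioc_union_Ioi_eq_Ioi (le_max_left r (2 * M))]
  refine IntegrableOn.union ?_ ?_
  · have : IntegrableOn (fun s => (metricF M Λ s)⁻¹) (Icc r R) :=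
      (hc.mono fun x hx => hr.trans_le hx.1).integrableOn_Icc
    exact this.mono_set Ioc_subset_Icc_self
  · refine Integrable.mono' ((integrableOn_Ioi_rpow_of_lt (by norm_num : (-2 : ℝ) < -1) hR0).const_mul
      (3 / -Λ)) ((hc.mono fun x hx => hr.trans_le ((le_max_left _ _).trans (le_of_lt hx))).aestronglyMeasurable
        measurableSet_Ioi) ?_
    filter_upwards [ae_restrict_mem measurableSet_Ioi] with s hs
    obtain ⟨h1, h2⟩ := inv_metricF_le hM hΛ ((le_max_right r (2 * M)).trans_lt hs)
    rwa [Real.norm_of_nonneg h2]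

include hM hΛ in
lemma tortoise_hasDerivAt {r : ℝ} (hr : horizonRadius M Λ < r) :
    HasDerivAt (tortoise M Λ) (metricF M Λ r)⁻¹ r := by
  have hc := continuousOn_inv_metricF hM hΛ
  have h1 : HasDerivAt (fun u => ∫ s in r..u, (metricF M Λ s)⁻¹) (metricF M Λ r)⁻¹ r :=
    intervalIntegral.integral_hasDerivAt_right IntervalIntegrable.refl
      (hc.stronglyMeasurableAtFilter isOpen_Ioi r hr) (hc.continuousAt (Ioi_mem_nhds hr))
  refine (h1.sub_const (∫ s in Ioi r, (metricF M Λ s)⁻¹)).congr_of_eventuallyEq ?_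
  filter_upwards [Ioi_mem_nhds hr] with u hu
  rw [← intervalIntegral.integral_Ioi_sub_Ioi' (integrableOn_inv_metricF hM hΛ hr)
    (integrableOn_inv_metricF hM hΛ hu), tortoise]
  ring

include hM hΛ in
lemma tortoise_strictMonoOn : StrictMonoOn (tortoise M Λ) (Ioi (horizonRadius M Λ)) := by
  refine strictMonoOn_of_hasDerivWithinAt_pos (f' := fun r => (metricF M Λ r)⁻¹) (convex_Ioi _)
    (fun x hx => (tortoise_hasDerivAt hM hΛ hx).continuousAt.continuousWithinAt)
    (fun x hx => ?_) fun x hx => ?_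
  · rw [interior_Ioi] at hx
    exact (tortoise_hasDerivAt hM hΛ hx).hasDerivWithinAt
  · rw [interior_Ioi] at hx
    exact inv_pos.2 (metricF_pos hM hΛ hx)

include hM hΛ in
lemma tortoise_neg {r : ℝ} (hr : horizonRadius M Λ < r) : tortoise M Λ r < 0 := by
  have h1 : horizonRadius M Λ < r + 1 := hr.trans (by linarith)
  refine (tortoise_strictMonoOn hM hΛ hr h1 (by linarith)).trans_le ?_
  unfold tortoise
  rw [neg_nonpos]
  exact setIntegral_nonneg measurableSet_Ioi fun s hs =>
    (inv_pos.2 (metricF_pos hM hΛ (h1.trans hs))).le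

include hM hΛ in
lemma exists_tortoise_gt {y : ℝ} (hy : y < 0) : ∃ r, horizonRadius M Λ < r ∧ y < tortoise M Λ r := by
  have hΛ' : 0 < -Λ := by linarith
  obtain ⟨h0, -⟩ := horizonRadius_spec hM hΛ
  set R := max (horizonRadius M Λ) (max (2 * M) (3 / -Λ / -y)) + 1 with hR
  have h1 : horizonRadius M Λ < R := (le_max_left _ _).trans_lt (lt_add_one _)
  have h2 : 2 * M < R := ((le_max_left _ _).trans (le_max_right _ _)).trans_lt (lt_add_one _)
  have h3 : 3 / -Λ / -y < R := ((le_max_right _ _).trans (le_max_right _ _)).trans_lt (lt_add_one _)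
  have hR0 : 0 < R := h0.trans h1
  refine ⟨R, h1, ?_⟩
  have h4 : ∫ s in Ioi R, (metricF M Λ s)⁻¹ ≤ ∫ s in Ioi R, 3 / -Λ * s ^ (-2 : ℝ) :=
    setIntegral_mono_on (integrableOn_inv_metricF hM hΛ h1)
      ((integrableOn_Ioi_rpow_of_lt (by norm_num) hR0).const_mul _) measurableSet_Ioi
      fun s hs => (inv_metricF_le hM hΛ (h2.trans hs)).1
  rw [integral_const_mul, integral_Ioi_rpow_of_lt (by norm_num) hR0] at h4
  have h5 : -R ^ ((-2 : ℝ) + 1) / (-2 + 1) = R⁻¹ := by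
    norm_num
    exact Real.rpow_neg_one R
  rw [h5] at h4
  have h6 : 3 / -Λ * R⁻¹ < -y := by
    rw [div_lt_iff₀ (by linarith)] at h3
    rw [← div_eq_mul_inv, div_lt_iff₀ hR0]
    linarith
  unfold tortoise
  linarith

include hM hΛ in
-- The zero of `f` at the horizon is at least of first order: `f ≤ K (r - ρ)` on `(ρ, ρ + 1]`. Hence
-- `x(r) - K⁻¹ log (r - ρ)` is increasing there, and the logarithm drives `x` to `-∞`.
lemma exists_tortoise_lt (y : ℝ) : ∃ r, horizonRadius M Λ < r ∧ tortoise M Λ r < y := by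
  obtain ⟨h0, e0⟩ := horizonRadius_spec hM hΛ
  set ρ := horizonRadius M Λ with hρ
  have hΛ' : 0 < -Λ := by linarith
  set K := (1 - Λ * (ρ + 1) ^ 2) / ρ with hK
  have hK0 : 0 < K := by
    have : 0 < -Λ * (ρ + 1) ^ 2 := by positivity
    rw [hK]
    apply div_pos _ h0
    linarith
  have hle : ∀ r, ρ < r → r ≤ ρ + 1 → metricF M Λ r ≤ K * (r - ρ) := by
    intro r h1 h2
    have hr : 0 < r := h0.trans h1
    have e1 := mul_metricF (M := M) (Λ := Λ) h0.ne'
    have e2 := mul_metricF (M := M) (Λ := Λ) hr.ne'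
    rw [e0, mul_zero] at e1
    -- Subtracting the equation of the horizon factors out `r - ρ`; bounding the cofactor by its
    -- value with `(ρ + 1)²` is the origin of `K`.
    have e3 : r * metricF M Λ r = (r - ρ) * (1 + -Λ * ((r ^ 2 + r * ρ + ρ ^ 2) / 3)) := by
      rw [e2]
      linear_combination -e1
    have e4 : (r ^ 2 + r * ρ + ρ ^ 2) / 3 ≤ (ρ + 1) ^ 2 := by nlinarith
    have e5 : r * metricF M Λ r ≤ (r - ρ) * (1 + -Λ * (ρ + 1) ^ 2) := by
      rw [e3]
      exact mul_le_mul_of_nonneg_left (add_le_add le_rfl (mul_le_mul_of_nonneg_left e4 hΛ'.le))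
        (by linarith)
    have e6 : (r - ρ) * (1 + -Λ * (ρ + 1) ^ 2) = ρ * (K * (r - ρ)) := by
      rw [hK]
      field_simp
      ring
    rw [e6] at e5
    have e7 : 0 < metricF M Λ r := metricF_pos hM hΛ h1
    have e8 : ρ * metricF M Λ r ≤ ρ * (K * (r - ρ)) :=
      (mul_le_mul_of_nonneg_right h1.le e7.le).trans e5
    exact le_of_mul_le_mul_left e8 h0
  have hmono : MonotoneOn (fun r => tortoise M Λ r - K⁻¹ * Real.log (r - ρ)) (Ioc ρ (ρ + 1)) := by
    have hd : ∀ r, ρ < r → HasDerivAt (fun r => tortoise M Λ r - K⁻¹ * Real.log (r - ρ))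
        ((metricF M Λ r)⁻¹ - K⁻¹ * (1 / (r - ρ))) r := fun r hr =>
      (tortoise_hasDerivAt hM hΛ hr).sub
        ((((hasDerivAt_id r).sub_const ρ).log (sub_pos.2 hr).ne').const_mul _)
    refine monotoneOn_of_hasDerivWithinAt_nonneg (f' := fun r => (metricF M Λ r)⁻¹ -
      K⁻¹ * (1 / (r - ρ))) (convex_Ioc _ _)
      (fun r hr => (hd r hr.1).continuousAt.continuousWithinAt) (fun r hr => ?_) fun r hr => ?_
    · rw [interior_Ioc] at hr
      exact (hd r hr.1).hasDerivWithinAt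
    · rw [interior_Ioc] at hr
      have h1 := inv_anti₀ (metricF_pos hM hΛ hr.1) (hle r hr.1 hr.2.le)
      rw [mul_inv] at h1
      rw [one_div]
      linarith
  set t := min 0 (K * (y - tortoise M Λ (ρ + 1)) - 1) with ht
  have ht0 : t ≤ 0 := min_le_left _ _
  have hexp : Real.exp t ≤ 1 := Real.exp_le_one_iff.2 ht0
  have hexp0 := Real.exp_pos t
  refine ⟨ρ + Real.exp t, by linarith, ?_⟩
  have h1 := hmono (show ρ + Real.exp t ∈ Ioc ρ (ρ + 1) from ⟨by linarith, by linarith⟩)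
    (show ρ + 1 ∈ Ioc ρ (ρ + 1) from ⟨by linarith, le_rfl⟩) (by linarith)
  simp only [add_sub_cancel_left, Real.log_exp, Real.log_one, mul_zero, sub_zero] at h1
  have h2 : t ≤ K * (y - tortoise M Λ (ρ + 1)) - 1 := min_le_right _ _
  have h3 : K⁻¹ * t < y - tortoise M Λ (ρ + 1) := by
    rw [inv_mul_lt_iff₀ hK0]
    linarith
  linarith

include hM hΛ in
lemma exists_tortoise_eq {y : ℝ} (hy : y < 0) :
    ∃ r ∈ Ioi (horizonRadius M Λ), tortoise M Λ r = y := by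
  obtain ⟨r₁, h1, e1⟩ := exists_tortoise_lt hM hΛ y
  obtain ⟨r₂, h2, e2⟩ := exists_tortoise_gt hM hΛ hy
  have hc : ContinuousOn (tortoise M Λ) (Ioi (horizonRadius M Λ)) := fun x hx =>
    (tortoise_hasDerivAt hM hΛ hx).continuousAt.continuousWithinAt
  exact isPreconnected_Ioi.intermediate_value h1 h2 hc ⟨e1.le, e2.le⟩

include hM hΛ in
lemma radius_spec {x : ℝ} (hx : x < 0) :
    horizonRadius M Λ < radius M Λ x ∧ tortoise M Λ (radius M Λ x) = x :=
  ⟨Function.invFunOn_mem (exists_tortoise_eq hM hΛ hx),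
    Function.invFunOn_eq (exists_tortoise_eq hM hΛ hx)⟩

include hM hΛ in
lemma lt_radius {r x : ℝ} (hr : horizonRadius M Λ < r) (hx : x < 0) (h : tortoise M Λ r < x) :
    r < radius M Λ x := by
  obtain ⟨h1, h2⟩ := radius_spec hM hΛ hx
  rw [← h2] at h
  exact ((tortoise_strictMonoOn hM hΛ).lt_iff_lt hr h1).1 h

include hM hΛ in
lemma radius_hasDerivAt {x : ℝ} (hx : x < 0) :
    HasDerivAt (radius M Λ) (metricF M Λ (radius M Λ x)) x := by
  obtain ⟨h1, h2⟩ := radius_spec hM hΛ hx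
  have hmono : StrictMonoOn (radius M Λ) (Iio 0) := by
    intro y hy z hz hyz
    exact lt_radius hM hΛ (radius_spec hM hΛ hy).1 hz (by rwa [(radius_spec hM hΛ hy).2])
  have himg : Ioi (horizonRadius M Λ) ⊆ radius M Λ '' Iio 0 := by
    intro r hr
    have hn := tortoise_neg hM hΛ hr
    refine ⟨tortoise M Λ r, hn, ?_⟩
    exact (tortoise_strictMonoOn hM hΛ).injOn (radius_spec hM hΛ hn).1 hr (radius_spec hM hΛ hn).2
  have hcont : ContinuousAt (radius M Λ) x :=
    hmono.continuousAt_of_image_mem_nhds (Iio_mem_nhds hx)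
      (mem_of_superset (Ioi_mem_nhds h1) himg)
  have := (tortoise_hasDerivAt hM hΛ h1).of_local_left_inverse hcont
    (inv_pos.2 (metricF_pos hM hΛ h1)).ne' (by
      filter_upwards [Iio_mem_nhds hx] with y hy
      exact (radius_spec hM hΛ hy).2)
  rwa [inv_inv] at this

end Horizon

/-- The inverse radius `1 / r(x)`, extended by `0` to `x ≥ 0`. -/
def invRadius (M Λ x : ℝ) : ℝ := if x < 0 then (radius M Λ x)⁻¹ else 0

/-- `f / r²` as a function of `1 / r`. -/
def metricPoly (M Λ s : ℝ) : ℝ := s ^ 2 - 2 * M * s ^ 3 - Λ / 3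

section InvRadius

variable {M Λ : ℝ} (hM : 0 < M) (hΛ : Λ < 0)

/-- With `r' = f`, this turns the equation for `s = 1/r` into the autonomous `s' = -P(s)`, regular
at `s = 0`. -/
lemma metricF_eq {r : ℝ} (hr : r ≠ 0) : metricF M Λ r = r ^ 2 * metricPoly M Λ r⁻¹ := by
  unfold metricF metricPoly
  field_simp

lemma invRadius_of_nonneg {x : ℝ} (hx : 0 ≤ x) : invRadius M Λ x = 0 := if_neg hx.not_gt

lemma invRadius_of_neg {x : ℝ} (hx : x < 0) : invRadius M Λ x = (radius M Λ x)⁻¹ := if_pos hx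

include hM hΛ in
lemma radius_pos {x : ℝ} (hx : x < 0) : 0 < radius M Λ x :=
  (horizonRadius_spec hM hΛ).1.trans (radius_spec hM hΛ hx).1

include hM hΛ in
lemma invRadius_hasDerivAt {x : ℝ} (hx : x < 0) :
    HasDerivAt (invRadius M Λ) (-metricPoly M Λ (invRadius M Λ x)) x := by
  have hr := radius_pos hM hΛ hx
  have h1 := (radius_hasDerivAt hM hΛ hx).inv hr.ne'
  have e : -metricF M Λ (radius M Λ x) / radius M Λ x ^ 2 =
      -metricPoly M Λ (invRadius M Λ x) := by
    rw [invRadius_of_neg hx, metricF_eq hr.ne']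
    field_simp
  rw [e] at h1
  refine h1.congr_of_eventuallyEq ?_
  filter_upwards [Iio_mem_nhds hx] with y hy
  exact invRadius_of_neg hy

include hM hΛ in
lemma invRadius_mem (x : ℝ) : invRadius M Λ x ∈ Icc 0 (horizonRadius M Λ)⁻¹ := by
  have h0 := (horizonRadius_spec hM hΛ).1
  rcases lt_or_ge x 0 with hx | hx
  · rw [invRadius_of_neg hx]
    exact ⟨(inv_pos.2 (radius_pos hM hΛ hx)).le, inv_anti₀ h0 (radius_spec hM hΛ hx).1.le⟩
  · rw [invRadius_of_nonneg hx]
    exact ⟨le_rfl, (inv_pos.2 h0).le⟩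

include hM hΛ in
lemma metricPoly_invRadius_nonneg (x : ℝ) : 0 ≤ metricPoly M Λ (invRadius M Λ x) := by
  rcases lt_or_ge x 0 with hx | hx
  · have hr := radius_pos hM hΛ hx
    have h1 := metricF_pos hM hΛ (radius_spec hM hΛ hx).1
    rw [metricF_eq hr.ne'] at h1
    rw [invRadius_of_neg hx]
    exact (pos_of_mul_pos_right h1 (by positivity)).le
  · rw [invRadius_of_nonneg hx]
    unfold metricPoly
    linarith

include hM hΛ in
lemma continuous_invRadius : Continuous (invRadius M Λ) := by
  rw [continuous_iff_continuousAt]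
  intro x
  rcases lt_trichotomy x 0 with hx | rfl | hx
  · exact (invRadius_hasDerivAt hM hΛ hx).continuousAt
  · rw [Metric.continuousAt_iff]
    intro ε hε
    have h0 := (horizonRadius_spec hM hΛ).1
    set R := max (horizonRadius M Λ) ε⁻¹ + 1 with hR
    have hR1 : horizonRadius M Λ < R := (le_max_left _ _).trans_lt (lt_add_one _)
    have hR2 : ε⁻¹ < R := (le_max_right _ _).trans_lt (lt_add_one _)
    refine ⟨-tortoise M Λ R, by linarith [tortoise_neg hM hΛ hR1], fun {y} hy => ?_⟩
    rw [invRadius_of_nonneg le_rfl, dist_zero_right, Real.norm_of_nonneg (invRadius_mem hM hΛ y).1]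
    rcases lt_or_ge y 0 with h | h
    · rw [dist_zero_right, Real.norm_of_nonpos h.le] at hy
      have h1 := lt_radius hM hΛ hR1 h (by linarith)
      rw [invRadius_of_neg h]
      exact inv_lt_of_inv_lt₀ hε (hR2.trans h1)
    · rw [invRadius_of_nonneg h]
      exact hε
  · have : invRadius M Λ =ᶠ[𝓝 x] fun _ => 0 := by
      filter_upwards [Ioi_mem_nhds hx] with y hy
      exact invRadius_of_nonneg (le_of_lt hy)
    exact this.continuousAt

/-- A solution of an autonomous equation with smooth right hand side is smooth. -/
lemma contDiffOn_of_autonomous {G s : ℝ → ℝ} {U : Set ℝ} (hU : IsOpen U)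
    (hG : ContDiff ℝ (⊤ : ℕ∞) G) (hs : ∀ x ∈ U, HasDerivAt s (G (s x)) x) :
    ContDiffOn ℝ (⊤ : ℕ∞) s U := by
  refine contDiffOn_infty.2 fun n => ?_
  induction n with
  | zero =>
    simp only [Nat.cast_zero, contDiffOn_zero]
    exact fun x hx => (hs x hx).continuousAt.continuousWithinAt
  | succ n ih =>
    push_cast
    rw [contDiffOn_succ_iff_deriv_of_isOpen hU]
    refine ⟨fun x hx => (hs x hx).differentiableAt.differentiableWithinAt, by simp, ?_⟩
    exact ((hG.of_le (by exact_mod_cast le_top)).comp_contDiffOn ih).congr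
      fun x hx => (hs x hx).deriv

include hM hΛ in
lemma contDiffOn_invRadius : ContDiffOn ℝ (⊤ : ℕ∞) (invRadius M Λ) (Iio 0) := by
  refine contDiffOn_of_autonomous (G := fun s => -metricPoly M Λ s) isOpen_Iio ?_
    fun x hx => invRadius_hasDerivAt hM hΛ hx
  unfold metricPoly
  fun_prop

end InvRadius

/-- The superpotential as a function of `1 / r`. -/
def superWOf (M Λ : ℝ) (ℓ : ℕ) (s : ℝ) : ℝ :=
  wFreq M ℓ + 6 * M * metricPoly M Λ s / (mu ℓ + 6 * M * s)

/-- The derivative of the superpotential with respect to `x`, as a function of `1 / r`. -/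
def superWDerivOf (M Λ : ℝ) (ℓ : ℕ) (s : ℝ) : ℝ :=
  (6 * M * (2 * s - 6 * M * s ^ 2) * (mu ℓ + 6 * M * s) - 6 * M * metricPoly M Λ s * (6 * M)) /
    (mu ℓ + 6 * M * s) ^ 2 * -metricPoly M Λ s

lemma mu_pos {ℓ : ℕ} (hℓ : 2 ≤ ℓ) : 0 < mu ℓ := by
  have : (2 : ℝ) ≤ ℓ := by exact_mod_cast hℓ
  unfold mu
  nlinarith

/-- The factorials telescope to `(ℓ-1) ℓ (ℓ+1) (ℓ+2) = μ (μ + 2)`. It is this value of `w` that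
makes `W² ∓ W' - w²` equal to the two potentials. -/
lemma wFreq_eq {M : ℝ} (hM : 0 < M) {ℓ : ℕ} (hℓ : 2 ≤ ℓ) :
    wFreq M ℓ = mu ℓ * (mu ℓ + 2) / (12 * M) := by
  obtain ⟨k, rfl⟩ := Nat.exists_eq_add_of_le hℓ
  have e1 : (2 + k + 2).factorial = (k + 4) * ((k + 3) * ((k + 2) * ((k + 1) * k.factorial))) := by
    rw [show 2 + k + 2 = k + 3 + 1 by ring, Nat.factorial_succ, Nat.factorial_succ,
      Nat.factorial_succ, Nat.factorial_succ]
  have e2 : 2 + k - 2 = k := by omega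
  have e3 : (k.factorial : ℝ) ≠ 0 := by exact_mod_cast k.factorial_ne_zero
  unfold wFreq mu
  rw [e1, e2]
  push_cast
  field_simp
  ring

section Potentials

variable {M Λ : ℝ} (hM : 0 < M) (hΛ : Λ < 0) {ℓ : ℕ} (hℓ : 2 ≤ ℓ)

include hM hℓ in
lemma denom_pos {s : ℝ} (hs : 0 ≤ s) : 0 < mu ℓ + 6 * M * s := by
  have := mu_pos hℓ
  positivity

include hM hΛ hℓ in
lemma isSuperPotential : ∃ C, IsSuperPotential
    (fun x => superWOf M Λ ℓ (invRadius M Λ x)) (fun x => superWDerivOf M Λ ℓ (invRadius M Λ x))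
    (fun x => Real.exp (wFreq M ℓ * x) / (mu ℓ + 6 * M * invRadius M Λ x)) (wFreq M ℓ) C := by
  have hμ := mu_pos hℓ
  have hd : ∀ x, 0 < mu ℓ + 6 * M * invRadius M Λ x := fun x =>
    denom_pos hM hℓ (invRadius_mem hM hΛ x).1
  have c1 : ContinuousOn (superWOf M Λ ℓ) (Icc 0 (horizonRadius M Λ)⁻¹) := by
    unfold superWOf metricPoly
    refine continuousOn_const.add (ContinuousOn.div (by fun_prop) (by fun_prop)
      fun x hx => (denom_pos hM hℓ hx.1).ne')
  have c2 : ContinuousOn (superWDerivOf M Λ ℓ) (Icc 0 (horizonRadius M Λ)⁻¹) := by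
    unfold superWDerivOf metricPoly
    refine ContinuousOn.mul (ContinuousOn.div (by fun_prop) (by fun_prop)
      fun x hx => (pow_pos (denom_pos hM hℓ hx.1) 2).ne') (by fun_prop)
  obtain ⟨C₁, hC₁⟩ := isCompact_Icc.exists_bound_of_continuousOn c1
  obtain ⟨C₂, hC₂⟩ := isCompact_Icc.exists_bound_of_continuousOn c2
  have cs := continuous_invRadius hM hΛ
  refine ⟨max C₁ C₂, ?_, ?_, ?_, ?_, ?_, ?_, ?_, ?_, ?_, ?_, ?_⟩
  · rw [wFreq_eq hM hℓ]
    positivity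
  · exact c1.comp_continuous cs (invRadius_mem hM hΛ)
  · exact c2.comp_continuous cs (invRadius_mem hM hΛ)
  · intro x
    have h1 := metricPoly_invRadius_nonneg hM hΛ x
    have h2 := hd x
    simp only [superWOf]
    have : 0 ≤ 6 * M * metricPoly M Λ (invRadius M Λ x) / (mu ℓ + 6 * M * invRadius M Λ x) := by
      positivity
    linarith
  · intro x
    exact (le_abs_self _).trans ((hC₁ _ (invRadius_mem hM hΛ x)).trans (le_max_left _ _))
  · intro x
    exact (hC₂ _ (invRadius_mem hM hΛ x)).trans (le_max_right _ _)
  · intro x hx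
    have hs := invRadius_hasDerivAt hM hΛ hx
    have hP : HasDerivAt (metricPoly M Λ) (2 * invRadius M Λ x - 6 * M * invRadius M Λ x ^ 2)
        (invRadius M Λ x) := by
      have := (((hasDerivAt_pow 2 (invRadius M Λ x)).sub
        ((hasDerivAt_pow 3 (invRadius M Λ x)).const_mul (2 * M))).sub_const (Λ / 3))
      refine this.congr_deriv ?_
      push_cast
      ring
    have hD : HasDerivAt (fun s => mu ℓ + 6 * M * s) (6 * M) (invRadius M Λ x) := by
      simpa using ((hasDerivAt_id (invRadius M Λ x)).const_mul (6 * M)).const_add (mu ℓ)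
    have hW := ((hP.const_mul (6 * M)).div hD (hd x).ne').const_add (wFreq M ℓ)
    exact hW.comp x hs
  · have h1 := contDiffOn_invRadius hM hΛ
    unfold superWOf metricPoly
    refine contDiffOn_const.add (ContDiffOn.div (by fun_prop) (by fun_prop) fun x _ => (hd x).ne')
  · intro x
    exact div_pos (Real.exp_pos _) (hd x)
  · exact Continuous.div (by fun_prop) (by fun_prop) fun x => (hd x).ne'
  · intro x hx
    have hs := invRadius_hasDerivAt hM hΛ hx
    have hE : HasDerivAt (fun x => Real.exp (wFreq M ℓ * x))
        (Real.exp (wFreq M ℓ * x) * wFreq M ℓ) x := by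
      simpa using ((hasDerivAt_id x).const_mul (wFreq M ℓ)).exp
    have hD := (hs.const_mul (6 * M)).const_add (mu ℓ)
    refine (hE.div hD (hd x).ne').congr_deriv ?_
    have := (hd x).ne'
    simp only [superWOf]
    field_simp
    ring

include hM hΛ in
lemma superW_eq {x : ℝ} (hx : x < 0) :
    superW M Λ ℓ x = superWOf M Λ ℓ (invRadius M Λ x) := by
  have hr := radius_pos hM hΛ hx
  unfold superW superWOf
  rw [invRadius_of_neg hx, metricF_eq hr.ne']
  congr 1
  field_simp

include hM hΛ in
lemma chiPlus_eq {x : ℝ} (hx : x < 0) : chiPlus M Λ ℓ x =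
    Real.exp (wFreq M ℓ * x) / (mu ℓ + 6 * M * invRadius M Λ x) := by
  have hr := radius_pos hM hΛ hx
  unfold chiPlus
  rw [invRadius_of_neg hx]
  field_simp

lemma superWOf_zero : superWOf M Λ ℓ 0 = gammaCh M Λ ℓ := by
  unfold superWOf gammaCh metricPoly
  ring

lemma ell_mul : (ℓ : ℝ) * (ℓ + 1) = mu ℓ + 2 := by
  unfold mu
  ring

include hM hΛ hℓ in
lemma VMinus_eq {x : ℝ} (hx : x < 0) : VMinus M Λ ℓ x =
    partnerPotential 1 (fun x => superWOf M Λ ℓ (invRadius M Λ x))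
      (fun x => superWDerivOf M Λ ℓ (invRadius M Λ x)) (wFreq M ℓ) x := by
  have hr := radius_pos hM hΛ hx
  have hd := denom_pos hM hℓ (invRadius_mem hM hΛ x).1
  unfold VMinus reggeWheelerPotential
  rw [metricF_eq hr.ne', ell_mul]
  have e : radius M Λ x ^ 2 * metricPoly M Λ (radius M Λ x)⁻¹ *
      ((mu ℓ + 2) / radius M Λ x ^ 2 - 6 * M / radius M Λ x ^ 3) =
      metricPoly M Λ (invRadius M Λ x) * (mu ℓ + 2 - 6 * M * invRadius M Λ x) := by
    rw [invRadius_of_neg hx]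
    field_simp
  rw [e]
  simp only [partnerPotential, superWOf, superWDerivOf]
  generalize invRadius M Λ x = s at *
  rw [wFreq_eq hM hℓ]
  -- Eliminating `μ` in favour of the denominator `D` leaves a polynomial identity once `D` and `M`
  -- are cleared.
  obtain ⟨D, hD⟩ : ∃ D, D = mu ℓ + 6 * M * s := ⟨_, rfl⟩
  rw [← hD] at hd ⊢
  rw [show mu ℓ = D - 6 * M * s by rw [hD]; ring]
  have hd' := hd.ne'
  unfold metricPoly
  field_simp
  ring

include hM hΛ hℓ in
lemma VPlus_eq {x : ℝ} (hx : x < 0) : VPlus M Λ ℓ x =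
    partnerPotential (-1) (fun x => superWOf M Λ ℓ (invRadius M Λ x))
      (fun x => superWDerivOf M Λ ℓ (invRadius M Λ x)) (wFreq M ℓ) x := by
  have hr := radius_pos hM hΛ hx
  have hμ := mu_pos hℓ
  have hd := denom_pos hM hℓ (invRadius_mem hM hΛ x).1
  unfold VPlus zerilliPotential
  rw [metricF_eq hr.ne', ell_mul]
  have e : radius M Λ x ^ 2 * metricPoly M Λ (radius M Λ x)⁻¹ *
      (((mu ℓ ^ 2 * (mu ℓ + 2) - 24 * M ^ 2 * Λ) * radius M Λ x ^ 3 +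
        6 * mu ℓ ^ 2 * M * radius M Λ x ^ 2 + 36 * mu ℓ * M ^ 2 * radius M Λ x + 72 * M ^ 3) /
        (radius M Λ x ^ 3 * (6 * M + mu ℓ * radius M Λ x) ^ 2)) =
      metricPoly M Λ (invRadius M Λ x) *
      (((mu ℓ ^ 2 * (mu ℓ + 2) - 24 * M ^ 2 * Λ) + 6 * mu ℓ ^ 2 * M * invRadius M Λ x +
        36 * mu ℓ * M ^ 2 * invRadius M Λ x ^ 2 + 72 * M ^ 3 * invRadius M Λ x ^ 3) /
        (mu ℓ + 6 * M * invRadius M Λ x) ^ 2) := by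
    rw [invRadius_of_neg hx]
    have h1 : 6 * M + mu ℓ * radius M Λ x ≠ 0 := by positivity
    have h2 : mu ℓ + 6 * M * (radius M Λ x)⁻¹ =
      (6 * M + mu ℓ * radius M Λ x) / radius M Λ x := by
      field_simp
      ring
    rw [h2]
    field_simp
  rw [e]
  simp only [partnerPotential, superWOf, superWDerivOf]
  generalize invRadius M Λ x = s at *
  rw [wFreq_eq hM hℓ]
  obtain ⟨D, hD⟩ : ∃ D, D = mu ℓ + 6 * M * s := ⟨_, rfl⟩
  rw [← hD] at hd ⊢
  rw [show mu ℓ = D - 6 * M * s by rw [hD]; ring]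
  have hd' := hd.ne'
  unfold metricPoly
  field_simp
  ring

end Potentials

end SAdS

end

/-! ### Transfer to the given operators and conclusion -/

namespace SAdS

open Filter Topology

/-- `radius` is an arbitrary choice for `x ≥ 0`, so `superW` has no meaningful value at `0`. The
operators only see `x < 0`, which permits the continuous extension through `invRadius`. -/
lemma firstOrderOp_congr {σ : ℝ} {W W' : ℝ → ℝ} (h : ∀ x < (0 : ℝ), W x = W' x) :
    firstOrderOp σ W = firstOrderOp σ W' := by
  have key : ∀ {W W' : ℝ → ℝ}, (∀ x < (0 : ℝ), W x = W' x) →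
      firstOrderGraph σ W ≤ firstOrderGraph σ W' := by
    rintro W W' h ⟨u, v⟩ ⟨g, k, H, e1, e2⟩
    refine ⟨g, k, H, e1, ?_⟩
    filter_upwards [e2, ae_restrict_mem measurableSet_Iio] with x h1 h2
    rw [h1, h x h2]
  unfold firstOrderOp
  rw [le_antisymm (key h) (key fun x hx => (h x hx).symm)]

lemma schrodingerOp_congr {γ : OnePoint ℝ} {V V' : ℝ → ℝ} (h : ∀ x < (0 : ℝ), V x = V' x) :
    schrodingerOp V γ = schrodingerOp V' γ := by
  have key : ∀ {V V' : ℝ → ℝ}, (∀ x < (0 : ℝ), V x = V' x) →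
      schrodingerGraph V γ ≤ schrodingerGraph V' γ := by
    rintro V V' h ⟨u, v⟩ ⟨g, g₁, g₂, H, H₁, B, e1, e2⟩
    refine ⟨g, g₁, g₂, H, H₁, B, e1, ?_⟩
    filter_upwards [e2, ae_restrict_mem measurableSet_Iio] with x h1 h2
    rw [h1, h x h2]
  unfold schrodingerOp
  rw [le_antisymm (key h) (key fun x hx => (h x hx).symm)]

/-- The factorization of `-d²/dx² + W² - σ W' - w²`. -/
lemma schrodingerExpr_eq {σ : ℝ} (hσ : σ * σ = 1) {V W dW : ℝ → ℝ} {w x : ℝ}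
    (hV : V x = W x ^ 2 - σ * dW x - w ^ 2) (hW : HasDerivAt W (dW x) x)
    {ψ : ℝ → ℂ} (hψ : ContDiffOn ℝ 2 ψ (Iio 0)) (hx : x < 0) :
    schrodingerExpr V ψ x =
      firstOrderExpr (-σ) W (firstOrderExpr σ W ψ) x - (w : ℂ) ^ 2 * ψ x := by
  have hσ' : (σ : ℂ) * σ = 1 := by exact_mod_cast hσ
  have h2 : ContDiffOn ℝ (1 + 1) ψ (Iio 0) := by
    rw [one_add_one_eq_two]
    exact hψ
  obtain ⟨d0, -, d1⟩ := (contDiffOn_succ_iff_deriv_of_isOpen isOpen_Iio).1 h2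
  have k0 := (d0.differentiableAt (Iio_mem_nhds hx)).hasDerivAt
  have k1 := ((d1.differentiableOn (by simp)).differentiableAt (Iio_mem_nhds hx)).hasDerivAt
  have k2 : HasDerivAt (firstOrderExpr σ W ψ)
      (σ * deriv (deriv ψ) x + (dW x * ψ x + W x * deriv ψ x)) x :=
    (k1.const_mul (σ : ℂ)).add (hW.ofReal_comp.mul k0)
  have e : firstOrderExpr (-σ) W (firstOrderExpr σ W ψ) x = ((-σ : ℝ) : ℂ) *
      deriv (firstOrderExpr σ W ψ) x + W x * firstOrderExpr σ W ψ x := rfl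
  rw [e, k2.deriv]
  unfold schrodingerExpr firstOrderExpr
  rw [hV]
  push_cast
  linear_combination (deriv (deriv ψ) x) * hσ'

end SAdS

theorem proposition7 (M Λ : ℝ) (hM : 0 < M) (hΛ : Λ < 0) (ℓ : ℕ) (hℓ : 2 ≤ ℓ) :
    -- the factorizations `H⁺ = D⁺ D⁻ - w²` and `H⁻ = D⁻ D⁺ - w²`
    (∀ ψ : ℝ → ℂ, ContDiffOn ℝ 2 ψ (Set.Iio 0) → ∀ x < (0 : ℝ),
      SAdS.schrodingerExpr (SAdS.VPlus M Λ ℓ) ψ x =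
        SAdS.firstOrderExpr 1 (SAdS.superW M Λ ℓ)
          (SAdS.firstOrderExpr (-1) (SAdS.superW M Λ ℓ) ψ) x
          - (SAdS.wFreq M ℓ : ℂ) ^ 2 * ψ x ∧
      SAdS.schrodingerExpr (SAdS.VMinus M Λ ℓ) ψ x =
        SAdS.firstOrderExpr (-1) (SAdS.superW M Λ ℓ)
          (SAdS.firstOrderExpr 1 (SAdS.superW M Λ ℓ) ψ) x
          - (SAdS.wFreq M ℓ : ℂ) ^ 2 * ψ x) ∧
    -- (i)
    (SAdS.HasNonnegSpectrum (SAdS.HPlus M Λ ℓ ∞) ∧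
      SAdS.HasNonnegSpectrum (SAdS.HMinus M Λ ℓ ((-SAdS.gammaCh M Λ ℓ : ℝ) : OnePoint ℝ)) ∧
      -- `D⁻` is a bijection between the smooth domains
      (SAdS.MapsTo (SAdS.DMinus M Λ ℓ) (SAdS.smoothDomain (SAdS.HPlus M Λ ℓ ∞))
          (SAdS.smoothDomain (SAdS.HMinus M Λ ℓ ((-SAdS.gammaCh M Λ ℓ : ℝ) : OnePoint ℝ))) ∧
        SAdS.InjOn (SAdS.DMinus M Λ ℓ) (SAdS.smoothDomain (SAdS.HPlus M Λ ℓ ∞)) ∧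
        SAdS.SurjOn (SAdS.DMinus M Λ ℓ) (SAdS.smoothDomain (SAdS.HPlus M Λ ℓ ∞))
          (SAdS.smoothDomain
            (SAdS.HMinus M Λ ℓ ((-SAdS.gammaCh M Λ ℓ : ℝ) : OnePoint ℝ)))) ∧
      -- on the full operator domain `D⁻` is defined and injective, with image containing the
      -- full operator domain
      ((SAdS.HPlus M Λ ℓ ∞).domain ≤ (SAdS.DMinus M Λ ℓ).domain ∧
        SAdS.InjOn (SAdS.DMinus M Λ ℓ) (SAdS.HPlus M Λ ℓ ∞).domain ∧
        SAdS.SurjOn (SAdS.DMinus M Λ ℓ) (SAdS.HPlus M Λ ℓ ∞).domain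
          (SAdS.HMinus M Λ ℓ ((-SAdS.gammaCh M Λ ℓ : ℝ) : OnePoint ℝ)).domain)) ∧
    -- (ii)
    (SAdS.HasNonnegSpectrum (SAdS.HMinus M Λ ℓ ∞) ∧
      (∃ X : SAdS.L2, X ≠ 0 ∧
        (X =ᵐ[SAdS.halfVol] fun x => (SAdS.chiPlus M Λ ℓ x : ℂ)) ∧
        -- `χ⁺` is an eigenfunction with the negative eigenvalue `-w²`
        (-(SAdS.wFreq M ℓ) ^ 2 < 0 ∧
          (∃ h : X ∈ (SAdS.HPlus M Λ ℓ (SAdS.gammaCh M Λ ℓ : ℝ)).domain,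
            SAdS.HPlus M Λ ℓ (SAdS.gammaCh M Λ ℓ : ℝ) ⟨X, h⟩ =
              (-(SAdS.wFreq M ℓ : ℂ) ^ 2) • X) ∧
          -(SAdS.wFreq M ℓ : ℂ) ^ 2 ∈
            SAdS.spectrum (SAdS.HPlus M Λ ℓ (SAdS.gammaCh M Λ ℓ : ℝ))) ∧
        -- the kernel of `D⁻`, on the smooth domain and on the full one, is spanned by `χ⁺`
        SAdS.kerOn (SAdS.DMinus M Λ ℓ)
          (SAdS.smoothDomain (SAdS.HPlus M Λ ℓ (SAdS.gammaCh M Λ ℓ : ℝ))) =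
            (Submodule.span ℂ {X} : Set SAdS.L2) ∧
        SAdS.kerOn (SAdS.DMinus M Λ ℓ)
          (SAdS.HPlus M Λ ℓ (SAdS.gammaCh M Λ ℓ : ℝ)).domain =
            (Submodule.span ℂ {X} : Set SAdS.L2)) ∧
      -- `D⁻` maps the smooth domain onto the smooth domain
      (SAdS.MapsTo (SAdS.DMinus M Λ ℓ)
          (SAdS.smoothDomain (SAdS.HPlus M Λ ℓ (SAdS.gammaCh M Λ ℓ : ℝ)))
          (SAdS.smoothDomain (SAdS.HMinus M Λ ℓ ∞)) ∧
        SAdS.SurjOn (SAdS.DMinus M Λ ℓ)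
          (SAdS.smoothDomain (SAdS.HPlus M Λ ℓ (SAdS.gammaCh M Λ ℓ : ℝ)))
          (SAdS.smoothDomain (SAdS.HMinus M Λ ℓ ∞))) ∧
      -- the image of the full operator domain under `D⁻` contains the full operator domain
      ((SAdS.HPlus M Λ ℓ (SAdS.gammaCh M Λ ℓ : ℝ)).domain ≤ (SAdS.DMinus M Λ ℓ).domain ∧
        SAdS.SurjOn (SAdS.DMinus M Λ ℓ)
          (SAdS.HPlus M Λ ℓ (SAdS.gammaCh M Λ ℓ : ℝ)).domain
          (SAdS.HMinus M Λ ℓ ∞).domain) ∧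
      -- `D⁺` in the other direction is injective
      (SAdS.MapsTo (SAdS.DPlus M Λ ℓ) (SAdS.smoothDomain (SAdS.HMinus M Λ ℓ ∞))
          (SAdS.smoothDomain (SAdS.HPlus M Λ ℓ (SAdS.gammaCh M Λ ℓ : ℝ))) ∧
        SAdS.InjOn (SAdS.DPlus M Λ ℓ) (SAdS.smoothDomain (SAdS.HMinus M Λ ℓ ∞))) ∧
      ((SAdS.HMinus M Λ ℓ ∞).domain ≤ (SAdS.DPlus M Λ ℓ).domain ∧
        SAdS.InjOn (SAdS.DPlus M Λ ℓ) (SAdS.HMinus M Λ ℓ ∞).domain)) ∧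
    -- (iii) `D^∓` maps the smooth domain into the operator domain for no other `γ`, `γ'`
    (∀ γ γ' : OnePoint ℝ,
      (SAdS.MapsTo (SAdS.DMinus M Λ ℓ) (SAdS.smoothDomain (SAdS.HPlus M Λ ℓ γ))
          (SAdS.HMinus M Λ ℓ γ').domain ↔
        (γ = ∞ ∧ γ' = ((-SAdS.gammaCh M Λ ℓ : ℝ) : OnePoint ℝ)) ∨
        (γ = (SAdS.gammaCh M Λ ℓ : ℝ) ∧ γ' = ∞)) ∧
      (SAdS.MapsTo (SAdS.DPlus M Λ ℓ) (SAdS.smoothDomain (SAdS.HMinus M Λ ℓ γ))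
          (SAdS.HPlus M Λ ℓ γ').domain ↔
        (γ = ((-SAdS.gammaCh M Λ ℓ : ℝ) : OnePoint ℝ) ∧ γ' = ∞) ∨
        (γ = ∞ ∧ γ' = (SAdS.gammaCh M Λ ℓ : ℝ)))) := by
  obtain ⟨C, S⟩ := SAdS.isSuperPotential hM hΛ hℓ
  have hW : ∀ x < (0 : ℝ), SAdS.superW M Λ ℓ x =
      SAdS.superWOf M Λ ℓ (SAdS.invRadius M Λ x) := fun x hx => SAdS.superW_eq hM hΛ hx
  have hVp := fun x hx => SAdS.VPlus_eq hM hΛ hℓ (x := x) hx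
  have hVm := fun x hx => SAdS.VMinus_eq hM hΛ hℓ (x := x) hx
  have hχ := fun x hx => SAdS.chiPlus_eq hM hΛ (ℓ := ℓ) (x := x) hx
  -- `γ_Ch` is the boundary value at infinity, `s = 0`, of the extended superpotential.
  have hγ : SAdS.gammaCh M Λ ℓ = SAdS.superWOf M Λ ℓ (SAdS.invRadius M Λ 0) := by
    rw [SAdS.invRadius_of_nonneg le_rfl, SAdS.superWOf_zero]
  have eDm : SAdS.DMinus M Λ ℓ = _ := SAdS.firstOrderOp_congr hW
  have eDp : SAdS.DPlus M Λ ℓ = _ := SAdS.firstOrderOp_congr hW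
  have eHp : SAdS.HPlus M Λ ℓ = _ := funext fun γ => SAdS.schrodingerOp_congr (γ := γ) hVp
  have eHm : SAdS.HMinus M Λ ℓ = _ := funext fun γ => SAdS.schrodingerOp_congr (γ := γ) hVm
  refine ⟨fun ψ hψ x hx => ?_, ?_⟩
  · have hd : HasDerivAt (SAdS.superW M Λ ℓ)
        (SAdS.superWDerivOf M Λ ℓ (SAdS.invRadius M Λ x)) x := by
      refine (S.hasDerivAt x hx).congr_of_eventuallyEq ?_
      filter_upwards [Iio_mem_nhds hx] with y hy
      exact hW y hy
    constructor
    · have h1 := SAdS.schrodingerExpr_eq (σ := -1) (V := SAdS.VPlus M Λ ℓ)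
        (dW := fun x => SAdS.superWDerivOf M Λ ℓ (SAdS.invRadius M Λ x)) (w := SAdS.wFreq M ℓ)
        (by norm_num) (by rw [hVp x hx, hW x hx]; rfl) hd hψ hx
      rwa [neg_neg] at h1
    · exact SAdS.schrodingerExpr_eq (σ := 1) (V := SAdS.VMinus M Λ ℓ)
        (dW := fun x => SAdS.superWDerivOf M Λ ℓ (SAdS.invRadius M Λ x)) (w := SAdS.wFreq M ℓ)
        (by norm_num) (by rw [hVm x hx, hW x hx]; rfl) hd hψ hx
  clear hW hVp hVm
  have hγ' : -SAdS.gammaCh M Λ ℓ = -SAdS.superWOf M Λ ℓ (SAdS.invRadius M Λ 0) := by rw [hγ]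
  have one : (1 : ℝ) * 1 = 1 := one_mul 1
  have mone : (-1 : ℝ) * -1 = 1 := by norm_num
  rw [eDm, eDp, eHp, eHm]
  refine ⟨⟨S.hasNonnegSpectrum_dirichlet_neg, S.hasNonnegSpectrum_robin_pos hγ',
    ⟨?_, (S.injOn_dirichlet mone).mono (SAdS.smoothDomain_subset _),
      S.surjOn_smooth_dirichlet hγ'⟩,
    S.domain_le mone _, S.injOn_dirichlet mone, S.surjOn_dirichlet hγ'⟩,
    ⟨S.hasNonnegSpectrum_dirichlet_pos, ?_, ⟨?_, S.surjOn_smooth_robin hγ⟩,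
      ⟨S.domain_le mone _, S.surjOn_robin hγ⟩,
      ⟨S.mapsTo_dirichlet one (by rw [hγ, one_mul]),
        (S.injOn_dirichlet one).mono (SAdS.smoothDomain_subset _)⟩,
      S.domain_le one _, S.injOn_dirichlet one⟩, fun γ γ' => ⟨?_, ?_⟩⟩
  · have h1 := S.mapsTo_dirichlet mone (γ := -SAdS.gammaCh M Λ ℓ) (by rw [hγ]; ring)
    rwa [neg_neg] at h1
  · obtain ⟨X, X0, eX, hX, hXt⟩ := S.exists_mode
    have hmem := S.smul_mode_mem_smoothDomain hX hγ
    refine ⟨X, X0, ?_, ⟨?_, SAdS.mem_graph_iff_apply.1 (S.mode_graph hX hγ),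
      S.mode_mem_spectrum hX X0 hγ⟩, S.kerOn_eq hX hXt hmem,
      S.kerOn_eq hX hXt fun c => SAdS.smoothDomain_subset _ (hmem c)⟩
    · filter_upwards [eX, ae_restrict_mem measurableSet_Iio] with x h1 h2
      rw [h1, hχ x h2]
    · exact neg_lt_zero.2 (pow_pos S.w_pos 2)
  · have h1 := S.mapsTo_robin mone (γ := SAdS.gammaCh M Λ ℓ) (by rw [hγ]; ring)
    rwa [neg_neg] at h1
  · have h1 := S.mapsTo_iff mone γ γ'
    simp only [neg_neg, neg_one_mul, one_mul] at h1
    rw [← hγ] at h1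
    exact h1
  · have h1 := S.mapsTo_iff one γ γ'
    simp only [neg_one_mul, one_mul] at h1
    rw [← hγ, or_comm] at h1
    exact h1
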